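/- **Setting.** Fix $\beta>1$. For $m\in[-1,1]$ let $\phi_{\beta,h}(m)=-\frac{m^2}{2}-hm-\frac{\mathcal S(m)}{\beta}$ with $\mathcal S(m)=-\frac{1-m}{2}\log\frac{1-m}{2}-\frac{1+m}{2}\log\frac{1+m}{2}$, let $h_c>0$ be such that $\phi_{\beta,h}$ is a double well exactly for $|h|<h_c$, let $m_+(h)$, $h\ge -h_c$, be the largest solution of $m=\tanh(\beta(m+h))$ (the upper stable branch), and let $m_c=m_+(-h_c)$. For $N\ge 1$ let $h_N(t)=-h_c\cos(N^{-2/3}t)$, and let $(m_N(t))$, $t\in N^{2/3}[-\frac\pi2,\frac\pi2]$, be the magnetization of the mean field Glauber dynamics, i.e. the time-inhomogeneous Markov jump process on $\{-1,-1+\frac2N,\dots,1\}$ which starts at time $-\frac\pi2N^{2/3}$ from a deterministic value $m_N$ and has generator $\mathcal L_{h_N(t)}$, where $$\mathcal L_hf(m)=c^+(m,h)\big[f(m+\tfrac2N)-f(m)\big]+c^-(m,h)\big[f(m-\tfrac2N)-f(m)\big],\qquad c^\pm(m,h)=\frac N2(1\mp m)\,\frac{e^{\pm\beta(h+m\pm\frac1N)}}{e^{\beta(h+m\pm\frac1N)}+e^{-\beta(h+m\pm\frac1N)}}.$$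 Let $\mathcal P_N$ be its law, and put $$Y_N(t)=\nu N^{1/3}\big(m_N(\mu N^{1/3}t)-m_c\big),\qquad \mu=\Big(\frac{2}{\beta h_cm_c}\Big)^{1/4},\qquad \nu=(\beta m_c)^{3/4}\Big(\frac{2}{h_c}\Big)^{1/4},$$ $$\mathcal H^+_\gamma(\{t\})=\big\{|m_N(t)-m_+(h_N(t))|\le N^{-1/2+\gamma}\big\}.$$ Say that the initial values are *near the upper branch* if, for some $\gamma_0\in(0,\frac12)$, $|m_N-m_+(0)|\le N^{-1/2+\gamma_0}$ for all large $N$. **Theorem.** There is $c>0$, depending only on $\beta$, such that the following hold. (i) There are $T_0,\varepsilon_0>0$ such that for all $T\ge T_0$, all $\varepsilon\in(0,\varepsilon_0]$ and all initial values near the upper branch, $$\limsup_{N\to\infty}\mathcal P_N\big\{|Y_N(-T)-T|\le\varepsilon\big\}\ \ge\ 1-e^{-c\varepsilon^2T}.$$ (ii) For every $E>0$ there is $T_0>0$ such that for all $T\ge T_0$, $\varepsilon\in(0,E]$, $\eta\in(0,\frac\pi2]$, $\gamma>0$ and all initial values $m_N$ (assumed near the upper branch if $\gamma\ge\frac12$),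 $$\limsup_{N\to\infty}\mathcal P_N\Big\{|Y_N(-T)-T|\ge\varepsilon\ \Big|\ \mathcal H^+_\gamma(\{-\eta N^{2/3}\})\Big\}\ \le\ e^{-c\varepsilon^2T},$$ and, for all initial values $m_N$ and all $\gamma>0$, $$\limsup_{N\to\infty}\mathcal P_N\Big\{\big(\mathcal H^+_\gamma(\{\eta N^{2/3}\})\big)^c\ \Big|\ |Y_N(T)-T|\le\varepsilon\Big\}\ \le\ e^{-c\varepsilon^2T}.$$ (Conditional probabilities given a null event are read as $0$.) -/

import Mathlib

open Filter Topology MeasureTheory ProbabilityTheory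

noncomputable section

namespace CurieWeiss

/-- The entropy density of the mean field Ising model. -/
def entropy (m : ℝ) : ℝ :=
  -((1 - m) / 2) * Real.log ((1 - m) / 2) - ((1 + m) / 2) * Real.log ((1 + m) / 2)

/-- The mean field free energy density, a function of the magnetization `m ∈ [-1, 1]`. -/
def freeEnergy (β h m : ℝ) : ℝ :=
  -(m ^ 2 / 2) - h * m - entropy m / β

/-- The free energy density is a double well: inside `(-1, 1)` it has exactly two local
minimizers `a < c`, and exactly one local maximizer `b`, which lies between them. -/
def IsDoubleWell (β h : ℝ) : Prop :=
  ∃ a b c : ℝ, a < b ∧ b < c ∧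
    {m | m ∈ Set.Ioo (-1 : ℝ) 1 ∧ IsLocalMin (freeEnergy β h) m} = {a, c} ∧
    {m | m ∈ Set.Ioo (-1 : ℝ) 1 ∧ IsLocalMax (freeEnergy β h) m} = {b}

/-- The coercive field `h_c`: for `β > 1` the free energy density is a double well exactly for
`|h| < h_c`. -/
def hc (β : ℝ) : ℝ := sSup {h : ℝ | IsDoubleWell β h}

/-- The upper branch `m_+(h)`, `h ≥ -h_c`: the largest solution of the mean field equation
`m = tanh (β (m + h))`. For `|h| < h_c` this is the larger local minimizer of the free energy
density, and at `h = -h_c` it is the limit of `m_+(h)` as `h` decreases to `-h_c`. -/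
def mPlus (β h : ℝ) : ℝ := sSup {m : ℝ | m = Real.tanh (β * (m + h))}

/-- The critical magnetization `m_c = m_+(-h_c)`. -/
def mc (β : ℝ) : ℝ := mPlus β (-hc β)

/-- The coefficient `μ` of the time scaling. -/
def mu (β : ℝ) : ℝ := (2 / (β * hc β * mc β)) ^ (1 / 4 : ℝ)

/-- The coefficient `ν` of the space scaling. -/
def nu (β : ℝ) : ℝ := (β * mc β) ^ (3 / 4 : ℝ) * (2 / hc β) ^ (1 / 4 : ℝ)

/-- The slowly oscillating field `h_N(t) = -h_c cos (N^{-2/3} t)`. -/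
def hN (β : ℝ) (N : ℕ) (t : ℝ) : ℝ := -hc β * Real.cos ((N : ℝ) ^ (-(2 / 3) : ℝ) * t)

/-- The set `{-1, -1 + 2/N, …, 1 - 2/N, 1}` of magnetization densities of `N` spins. -/
def magnetizations (N : ℕ) : Set ℝ :=
  {m | ∃ k : ℕ, k ≤ N ∧ m = (-(N : ℝ) + 2 * (k : ℝ)) / (N : ℝ)}

/-- The rate `c^+(m, h)` of the jump `m → m + 2/N`. -/
def ratePlus (β : ℝ) (N : ℕ) (m h : ℝ) : ℝ :=
  (N : ℝ) / 2 * (1 - m) *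
    (Real.exp (β * (h + (m + 1 / (N : ℝ)))) /
      (Real.exp (-(β * (h + (m + 1 / (N : ℝ))))) + Real.exp (β * (h + (m + 1 / (N : ℝ))))))

/-- The rate `c^-(m, h)` of the jump `m → m - 2/N`. -/
def rateMinus (β : ℝ) (N : ℕ) (m h : ℝ) : ℝ :=
  (N : ℝ) / 2 * (1 + m) *
    (Real.exp (-(β * (h + (m - 1 / (N : ℝ))))) /
      (Real.exp (-(β * (h + (m - 1 / (N : ℝ))))) + Real.exp (β * (h + (m - 1 / (N : ℝ))))))

/-- The generator `L_h` of the magnetization under the Glauber dynamics. -/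
def generator (β : ℝ) (N : ℕ) (h : ℝ) (f : ℝ → ℝ) (m : ℝ) : ℝ :=
  ratePlus β N m h * (f (m + 2 / (N : ℝ)) - f m) +
    rateMinus β N m h * (f (m - 2 / (N : ℝ)) - f m)

/-- The microscopic time window `N^{2/3} [-π/2, π/2]`. -/
def window (N : ℕ) : Set ℝ :=
  Set.Icc (-((N : ℝ) ^ (2 / 3 : ℝ) * (Real.pi / 2))) ((N : ℝ) ^ (2 / 3 : ℝ) * (Real.pi / 2))

/-- `X` is, on the probability space `(Ω, P)`, the time inhomogeneous Markov jump process
`m_N(t)`, `t ∈ N^{2/3} [-π/2, π/2]`, with generator `L_{h_N(t)}`, started from `m₀`. The law is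
prescribed by the martingale problem: the paths are right continuous with left limits in the
finite state space, and for each `f` the process
`f (X_t) - ∫ (L_{h_N(r)} f) (X_r) dr` is a martingale in the natural filtration of `X`. -/
structure IsMagnetizationProcess (β : ℝ) (N : ℕ) (m₀ : ℝ) {Ω : Type*} [MeasurableSpace Ω]
    (P : Measure Ω) (X : ℝ → Ω → ℝ) : Prop where
  isProbabilityMeasure : IsProbabilityMeasure P
  measurable : ∀ t ∈ window N, Measurable (X t)
  mem : ∀ t ∈ window N, ∀ ω, X t ω ∈ magnetizations N
  right_cont : ∀ ω, ∀ t ∈ window N, ContinuousWithinAt (fun r => X r ω) (window N ∩ Set.Ici t) t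
  left_lim : ∀ ω, ∀ t ∈ window N, ∃ l : ℝ,
    Tendsto (fun r => X r ω) (𝓝[window N ∩ Set.Iio t] t) (𝓝 l)
  start : ∀ᵐ ω ∂P, X (-((N : ℝ) ^ (2 / 3 : ℝ) * (Real.pi / 2))) ω = m₀
  martingale : ∀ f : ℝ → ℝ, ∀ s ∈ window N, ∀ t ∈ window N, s ≤ t → ∀ A : Set Ω,
    MeasurableSet[⨆ r ∈ window N ∩ Set.Iic s, MeasurableSpace.comap (X r) (borel ℝ)] A →
      ∫ ω in A, (f (X t ω) - f (X s ω) - ∫ r in s..t, generator β N (hN β N r) f (X r ω)) ∂P = 0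

/-- The rescaled process `Y_N(t) = ν N^{1/3} (m_N(μ N^{1/3} t) - m_c)`. -/
def rescaled (β : ℝ) (N : ℕ) {Ω : Type*} (X : ℝ → Ω → ℝ) (t : ℝ) (ω : Ω) : ℝ :=
  nu β * (N : ℝ) ^ (1 / 3 : ℝ) * (X (mu β * (N : ℝ) ^ (1 / 3 : ℝ) * t) ω - mc β)

/-- The event `H^+_γ(I)` that, at all times in `I`, the magnetization is within `N^{-1/2 + γ}` of
the upper branch. -/
def nearUpper (β : ℝ) (N : ℕ) {Ω : Type*} (X : ℝ → Ω → ℝ) (γ : ℝ) (I : Set ℝ) : Set Ω :=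
  {ω | ∀ t ∈ I, |X t ω - mPlus β (hN β N t)| ≤ (N : ℝ) ^ (-(1 / 2) + γ : ℝ)}

/-- The initial magnetizations `m₀ N` lie within `N^{-1/2 + γ}` of `m_+(0)`, for some
`γ ∈ (0, 1/2)` and all large `N`. -/
def StartsNearUpper (β : ℝ) (m₀ : ℕ → ℝ) : Prop :=
  ∃ γ : ℝ, 0 < γ ∧ γ < 1 / 2 ∧
    ∀ᶠ N : ℕ in atTop, |m₀ N - mPlus β 0| ≤ (N : ℝ) ^ (-(1 / 2) + γ : ℝ)

end CurieWeiss

end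

/-! ### The magnetization grid, the forward equation, and regularity in time. -/

namespace CurieWeiss

/-! Write n = N^{1/3}, let M(r) be the upper branch at macroscopic time r = t/n², and put v = n(m -
M). Near r = 0 the branch leaves m_c linearly, and the drift towards it is marginal at m_c; hence at
|t| = τn the drift contracts v at a rate of order τ/n, while the jumps diffuse v at a rate of order
1/n. Heuristically v has variance of order 1/τ, and a deviation x costs e^{-cx²τ}. The constants μ
and ν are such that νn(M - m_c) tends to T at |t| = μTn, so that Y_N - T is νv up to a vanishing
term, with τ = μT.

Conditioning is handled by linearity. If A is known at time s, the masses P(A ∩ {X_t = ·}), t ≥ s,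
solve the forward equation (`IsMagnetizationProcess.isFlow`). Every estimate is proved for such
flows and is proportional to the total mass Λ = P(A), so division by P(A) gives the conditional
statements.

Flows are compared with explicit barriers. A barrier G is composed with a concave cutoff that is
flat beyond 1, so the supersolution inequality is needed only where G < 1, that is, close enough to
the branch for the drift to contract. This takes the place of stopping times
(`IsFlow.mass_barrier_le`). There are three test functions: a quadratic one
(`exists_macroscopic_contraction`), by which, away from r = 0, the distance to the branch shrinks
exponentially up to noise of order N^{-1/2}; an exponential one (`exists_gaussian_tail`), which
follows the process between |t| of order n² and |t| = τ₁n and yields tails C e^{-aτ₁x²}; a shrinking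
bump (`exists_anticoncentration`), which bounds from below the mass within x of the branch.

The bump is needed because the theorem asks for e^{-cε²T} with no prefactor, for arbitrarily small
ε. If ε²T is large, the prefactor C is absorbed by lowering the exponent. If ε²T is bounded, the
tail bound says nothing, and what is needed is a deviation probability of at most 1 - cε²T: this is
a lower bound of order x²τ₁ for the mass near the branch (`exists_deviation_before`).

After the critical time ε may be enlarged to E, so only the tail bound is needed: the exponential
barrier brings the process along the branch to macroscopic times, and the quadratic one squeezes it
to distance N^{-1/2+γ} in a time of order log n (`exists_convergence_after`). -/

/-- The `k`-th magnetization density. -/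
noncomputable def grid (N k : ℕ) : ℝ := (-(N : ℝ) + 2 * (k : ℝ)) / (N : ℝ)

lemma grid_injective {N : ℕ} (hN : 1 ≤ N) : Function.Injective (grid N) := by
  intro i j h
  have hN' : (N : ℝ) ≠ 0 := by positivity
  unfold grid at h
  rw [div_left_inj' hN'] at h
  have : (i : ℝ) = j := by linarith
  exact_mod_cast this

lemma mem_magnetizations_iff {N : ℕ} {m : ℝ} :
    m ∈ magnetizations N ↔ ∃ k ∈ Finset.range (N + 1), m = grid N k := by
  simp [magnetizations, grid]

/-- A nonnegative solution, of total mass `Λ`, of the Kolmogorov forward equation of the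
magnetization process on the time interval `[s, e]`. -/
structure IsFlow (β : ℝ) (N : ℕ) (s e Λ : ℝ) (p : ℝ → ℕ → ℝ) : Prop where
  nonneg : ∀ t ∈ Set.Icc s e, ∀ k, 0 ≤ p t k
  mass : ∀ t ∈ Set.Icc s e, ∑ k ∈ Finset.range (N + 1), p t k = Λ
  forward : ∀ f : ℝ → ℝ, ∀ t ∈ Set.Icc s e,
    HasDerivWithinAt (fun r => ∑ k ∈ Finset.range (N + 1), p r k * f (grid N k))
      (∑ k ∈ Finset.range (N + 1), p t k * generator β N (hN β N t) f (grid N k))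
      (Set.Icc s e) t

lemma IsFlow.mono {β : ℝ} {N : ℕ} {s e s' e' Λ : ℝ} {p : ℝ → ℕ → ℝ}
    (hp : IsFlow β N s e Λ p) (hs : s ≤ s') (he : e' ≤ e) : IsFlow β N s' e' Λ p := by
  have hsub : Set.Icc s' e' ⊆ Set.Icc s e := Set.Icc_subset_Icc hs he
  exact ⟨fun t ht => hp.nonneg t (hsub ht), fun t ht => hp.mass t (hsub ht),
    fun f t ht => (hp.forward f t (hsub ht)).mono hsub⟩

/-- Sampling at the next point of the grid of mesh 1/(n+1) strictly to the right gives jointly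
measurable processes, which converge pointwise by right continuity. -/
lemma measurable_uncurry_of_right_continuous {Ω : Type*} [MeasurableSpace Ω] {Z : ℝ → Ω → ℝ}
    (hZ : ∀ r, Measurable (Z r))
    (hc : ∀ ω r, ContinuousWithinAt (fun r => Z r ω) (Set.Ici r) r) :
    Measurable (Function.uncurry Z) := by
  have happrox : ∀ n : ℕ, Measurable (fun q : ℝ × Ω =>
      Z (((⌊((n : ℝ) + 1) * q.1⌋ : ℝ) + 1) / ((n : ℝ) + 1)) q.2) := by
    intro n
    have h1 : Measurable (fun q : ℤ × Ω => Z (((q.1 : ℝ) + 1) / ((n : ℝ) + 1)) q.2) :=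
      measurable_from_prod_countable_right fun z => hZ (((z : ℝ) + 1) / ((n : ℝ) + 1))
    have h2 : Measurable (fun q : ℝ × Ω => ((⌊((n : ℝ) + 1) * q.1⌋ : ℤ), q.2)) :=
      (Int.measurable_floor.comp (measurable_const.mul measurable_fst)).prodMk measurable_snd
    exact h1.comp h2
  refine measurable_of_tendsto_metrizable happrox ?_
  rw [tendsto_pi_nhds]
  rintro ⟨r, ω⟩
  refine (hc ω r).tendsto.comp ?_
  refine tendsto_nhdsWithin_iff.2 ⟨?_, Eventually.of_forall fun n => ?_⟩
  · have hlim : Tendsto (fun n : ℕ => r + 1 / ((n : ℝ) + 1)) atTop (𝓝 r) := by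
      simpa using tendsto_const_nhds.add (tendsto_one_div_add_atTop_nhds_zero_nat (𝕜 := ℝ))
    refine tendsto_of_tendsto_of_tendsto_of_le_of_le tendsto_const_nhds hlim ?_ ?_
    · intro n
      have hn : (0 : ℝ) < n + 1 := by positivity
      simp only
      rw [le_div_iff₀ hn]
      nlinarith [Int.lt_floor_add_one (((n : ℝ) + 1) * r)]
    · intro n
      have hn : (0 : ℝ) < n + 1 := by positivity
      simp only
      rw [div_le_iff₀ hn, add_mul r, one_div, inv_mul_cancel₀ hn.ne']
      nlinarith [Int.floor_le (((n : ℝ) + 1) * r)]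
  · have hn : (0 : ℝ) < n + 1 := by positivity
    simp only [Set.mem_Ici]
    rw [le_div_iff₀ hn]
    nlinarith [Int.lt_floor_add_one (((n : ℝ) + 1) * r)]

lemma continuous_hN (β : ℝ) (N : ℕ) : Continuous (hN β N) := by
  unfold hN; fun_prop

lemma continuous_generator (β : ℝ) (N : ℕ) (f : ℝ → ℝ) (m : ℝ) :
    Continuous (fun t => generator β N (hN β N t) f m) := by
  have h := continuous_hN β N
  unfold generator ratePlus rateMinus
  have h1 : ∀ x : ℝ, Real.exp (-x) + Real.exp x ≠ 0 := fun x => by positivity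
  refine ((Continuous.mul continuous_const (Continuous.div ?_ ?_ fun t => h1 _)).mul
    continuous_const).add ((Continuous.mul continuous_const
      (Continuous.div ?_ ?_ fun t => h1 _)).mul continuous_const) <;> fun_prop

/-! ### From the martingale problem to the forward equation. -/

section ProcessFlow

variable {β : ℝ} {N : ℕ} {m₀ : ℝ} {Ω : Type*} [MeasurableSpace Ω] {P : Measure Ω}
  {X : ℝ → Ω → ℝ}

/-- The mass that the law of `X t`, restricted to `A`, gives to the magnetizations. -/
noncomputable def massOn (P : Measure Ω) (X : ℝ → Ω → ℝ) (N : ℕ) (A : Set Ω) (t : ℝ) (k : ℕ) : ℝ :=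
  P.real (A ∩ {ω | X t ω = grid N k})

lemma IsMagnetizationProcess.setIntegral_eq_sum
    (hX : IsMagnetizationProcess β N m₀ P X) (hN : 1 ≤ N) {A : Set Ω}
    (f : ℝ → ℝ) {t : ℝ} (ht : t ∈ window N) :
    ∫ ω in A, f (X t ω) ∂P =
      ∑ k ∈ Finset.range (N + 1), massOn P X N A t k * f (grid N k) := by
  have := hX.isProbabilityMeasure
  have hpt : ∀ ω, f (X t ω) = ∑ k ∈ Finset.range (N + 1),
      Set.indicator {ω | X t ω = grid N k} (fun _ => f (grid N k)) ω := by
    intro ω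
    obtain ⟨j, hj, hjX⟩ := mem_magnetizations_iff.1 (hX.mem t ht ω)
    rw [Finset.sum_eq_single_of_mem j hj]
    · simp [Set.indicator, hjX]
    · intro i _ hij
      have : X t ω ≠ grid N i := by
        rw [hjX]; exact fun h => hij ((grid_injective hN h).symm)
      simp [Set.indicator, this]
  have hms : ∀ k, MeasurableSet {ω | X t ω = grid N k} := fun k =>
    hX.measurable t ht (measurableSet_singleton (grid N k))
  simp_rw [hpt]
  rw [integral_finsetSum _ fun k _ => (integrable_const _).indicator (hms k)]
  refine Finset.sum_congr rfl fun k _ => ?_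
  rw [integral_indicator_const _ (hms k), smul_eq_mul, massOn, measureReal_restrict_apply (hms k),
    Set.inter_comm]

/-- Integrating the martingale identity over A and using Fubini gives an integral equation for the
masses. It bootstraps: a primitive is continuous, so the masses are continuous, so the integrand is
continuous, and the fundamental theorem of calculus gives the derivative. -/
theorem IsMagnetizationProcess.isFlow
    (hX : IsMagnetizationProcess β N m₀ P X) (hN : 1 ≤ N) {s e : ℝ} (hs : s ∈ window N)
    (he : e ∈ window N) (hse : s ≤ e) {A : Set Ω}
    (hA : MeasurableSet[⨆ r ∈ window N ∩ Set.Iic s, MeasurableSpace.comap (X r) (borel ℝ)] A) :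
    IsFlow β N s e (P.real A) (massOn P X N A) := by
  have := hX.isProbabilityMeasure
  have hwin : ∀ t ∈ Set.Icc s e, t ∈ window N := fun t ht => ⟨hs.1.trans ht.1, ht.2.trans he.2⟩
  -- Clamping time to [s, e] extends the process to all real times, where joint measurability and
  -- continuity can be stated without boundary conditions.
  set c : ℝ → ℝ := fun r => (Set.projIcc s e hse r : ℝ) with hcdef
  have hcc : Continuous c := continuous_subtype_val.comp continuous_projIcc
  have hcm : ∀ r, c r ∈ Set.Icc s e := fun r => (Set.projIcc s e hse r).2
  have hcid : ∀ r ∈ Set.Icc s e, c r = r := fun r hr => by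
    simp [hcdef, Set.projIcc_of_mem hse hr]
  have hjoint : Measurable (Function.uncurry fun r ω => X (c r) ω) := by
    refine measurable_uncurry_of_right_continuous (fun r => hX.measurable _ (hwin _ (hcm r))) ?_
    intro ω r
    refine (hX.right_cont ω (c r) (hwin _ (hcm r))).comp hcc.continuousWithinAt ?_
    intro q hq
    exact ⟨hwin _ (hcm q), Set.monotone_projIcc hse hq⟩
  have hms : ∀ k, MeasurableSet {q : ℝ × Ω | X (c q.1) q.2 = grid N k} := fun k =>
    hjoint (measurableSet_singleton (grid N k))
  set q : (ℝ → ℝ) → ℝ → ℝ := fun f r =>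
    ∑ k ∈ Finset.range (N + 1), massOn P X N A (c r) k * generator β N (CurieWeiss.hN β N r) f (grid N k)
    with hq
  have hind : ∀ (f : ℝ → ℝ) r ω, f (X (c r) ω) =
      ∑ k ∈ Finset.range (N + 1), Set.indicator {q : ℝ × Ω | X (c q.1) q.2 = grid N k}
        (fun _ => f (grid N k)) (r, ω) := by
    intro f r ω
    obtain ⟨j, hj, hjX⟩ := mem_magnetizations_iff.1 (hX.mem _ (hwin _ (hcm r)) ω)
    rw [Finset.sum_eq_single_of_mem j hj]
    · simp [Set.indicator, hjX]
    · intro i _ hij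
      have : X (c r) ω ≠ grid N i := by
        rw [hjX]; exact fun h => hij ((grid_injective hN h).symm)
      simp [Set.indicator, this]
  have hI : ∀ (f : ℝ → ℝ), ∀ t, Integrable (Function.uncurry fun r ω =>
      generator β N (CurieWeiss.hN β N r) f (X (c r) ω))
      ((volume.restrict (Set.Ioc s t)).prod (P.restrict A)) := by
    intro f t
    have : (Function.uncurry fun r ω => generator β N (CurieWeiss.hN β N r) f (X (c r) ω)) =
        fun z => ∑ k ∈ Finset.range (N + 1),
          Set.indicator {q : ℝ × Ω | X (c q.1) q.2 = grid N k}
          (fun q => generator β N (CurieWeiss.hN β N q.1) f (grid N k)) z := by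
      funext ⟨r, ω⟩
      refine (hind (generator β N (CurieWeiss.hN β N r) f) r ω).trans ?_
      refine Finset.sum_congr rfl fun k _ => ?_
      simp only [Set.indicator]
    rw [this]
    refine integrable_finsetSum _ fun k _ => Integrable.indicator ?_ (hms k)
    have h1 : IntegrableOn (fun r => generator β N (CurieWeiss.hN β N r) f (grid N k))
        (Set.Ioc s t) :=
      ((continuous_generator β N f (grid N k)).integrableOn_Icc).mono_set Set.Ioc_subset_Icc_self
    exact Integrable.comp_fst h1 (P.restrict A)
  have hqe : ∀ f r, ∫ ω in A, generator β N (CurieWeiss.hN β N r) f (X (c r) ω) ∂P = q f r :=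
    fun f r => hX.setIntegral_eq_sum hN _ (hwin _ (hcm r))
  have hint : ∀ f : ℝ → ℝ, ∀ t ∈ Set.Icc s e, ∫ ω in A, f (X t ω) ∂P =
      ∫ ω in A, f (X s ω) ∂P + ∫ r in s..t, q f r := by
    intro f t ht
    have hst := ht.1
    have hcongr : ∀ ω, ∫ r in s..t, generator β N (CurieWeiss.hN β N r) f (X r ω) =
        ∫ r in Set.Ioc s t, generator β N (CurieWeiss.hN β N r) f (X (c r) ω) := by
      intro ω
      rw [intervalIntegral.integral_of_le hst]
      refine setIntegral_congr_fun measurableSet_Ioc fun r hr => ?_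
      simp only [hcid r ⟨hr.1.le, hr.2.trans ht.2⟩]
    have hfi : ∀ t ∈ Set.Icc s e, Integrable (fun ω => f (X t ω)) (P.restrict A) := by
      intro t ht
      have h1 : (fun ω => f (X t ω)) = fun ω => ∑ k ∈ Finset.range (N + 1),
          Set.indicator {ω | X t ω = grid N k} (fun _ => f (grid N k)) ω := by
        funext ω
        have := hind f t ω
        rw [hcid t ht] at this
        rw [this]
        simp only [Set.indicator, Set.mem_ofPred_eq, hcid t ht]
      rw [h1]
      exact integrable_finsetSum _ fun k _ => (integrable_const _).indicator
        (hX.measurable t (hwin t ht) (measurableSet_singleton (grid N k)))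
    have hmart := hX.martingale f s hs t (hwin t ht) hst A hA
    simp_rw [hcongr] at hmart
    have h2 : Integrable (fun ω => ∫ r in Set.Ioc s t,
        generator β N (CurieWeiss.hN β N r) f (X (c r) ω)) (P.restrict A) :=
      (hI f t).integral_prod_right
    have h3 : Integrable (fun ω => f (X t ω) - f (X s ω)) (P.restrict A) :=
      (hfi t ht).sub (hfi s ⟨le_rfl, hse⟩)
    rw [integral_sub h3 h2, integral_sub (hfi t ht) (hfi s ⟨le_rfl, hse⟩)] at hmart
    have hswap := integral_integral_swap (hI f t)
    have hq' : ∫ r in s..t, q f r = ∫ r in Set.Ioc s t, ∫ ω in A,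
        generator β N (CurieWeiss.hN β N r) f (X (c r) ω) ∂P := by
      rw [intervalIntegral.integral_of_le hst]
      simp_rw [hqe]
    rw [hq', hswap]
    linarith
  have hqI : ∀ f, IntegrableOn (q f) (Set.uIcc s e) := by
    intro f
    rw [Set.uIcc_of_le hse, integrableOn_Icc_iff_integrableOn_Ioc]
    have h1 := (hI f e).integral_prod_left
    refine h1.congr (Eventually.of_forall fun r => ?_)
    exact hqe f r
  have hsum : ∀ f : ℝ → ℝ, ∀ t ∈ Set.Icc s e,
      ∑ k ∈ Finset.range (N + 1), massOn P X N A t k * f (grid N k) =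
        ∑ k ∈ Finset.range (N + 1), massOn P X N A s k * f (grid N k) + ∫ r in s..t, q f r := by
    intro f t ht
    rw [← hX.setIntegral_eq_sum hN f (hwin t ht), ← hX.setIntegral_eq_sum hN f hs,
      hint f t ht]
  have hcontsum : ∀ f : ℝ → ℝ, ContinuousOn (fun t =>
      ∑ k ∈ Finset.range (N + 1), massOn P X N A t k * f (grid N k)) (Set.Icc s e) := by
    intro f
    have h1 := (intervalIntegral.continuousOn_primitive_interval (hqI f))
    rw [Set.uIcc_of_le hse] at h1
    exact (continuousOn_const.add h1).congr fun t ht => hsum f t ht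
  have hcont : ∀ k ∈ Finset.range (N + 1), Continuous fun r => massOn P X N A (c r) k := by
    intro k hk
    have h1 : ContinuousOn (fun t => massOn P X N A t k) (Set.Icc s e) := by
      classical
      refine (hcontsum (fun x => if x = grid N k then 1 else 0)).congr fun t _ => ?_
      simp only
      rw [Finset.sum_eq_single_of_mem k hk]
      · simp
      · intro i _ hik
        have : grid N i ≠ grid N k := fun h => hik (grid_injective hN h)
        simp [this]
    exact h1.comp_continuous hcc hcm
  have hqc : ∀ f, Continuous (q f) := fun f =>
    continuous_finsetSum _ fun k hk => (hcont k hk).mul (continuous_generator β N f (grid N k))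
  refine ⟨fun t _ k => measureReal_nonneg, fun t ht => ?_, fun f t ht => ?_⟩
  · have h := hX.setIntegral_eq_sum hN (A := A) (fun _ => 1) (hwin t ht)
    simp only [mul_one] at h
    rw [← h]
    simp
  · have h1 : HasDerivAt (fun t => ∑ k ∈ Finset.range (N + 1), massOn P X N A s k * f (grid N k) +
        ∫ r in s..t, q f r) (q f t) t :=
      (intervalIntegral.integral_hasDerivAt_right ((hqc f).intervalIntegrable _ _)
        ((hqc f).stronglyMeasurableAtFilter _ _) (hqc f).continuousAt).const_add _
    have h2 : q f t = ∑ k ∈ Finset.range (N + 1),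
        massOn P X N A t k * generator β N (CurieWeiss.hN β N t) f (grid N k) := by
      simp only [hq, hcid t ht]
    rw [← h2]
    exact h1.hasDerivWithinAt.congr (fun r hr => hsum f r hr) (hsum f t ht)

end ProcessFlow

/-! ### Comparison principle and barriers. -/

section Comparison

variable {β : ℝ} {N : ℕ} {s e Λ : ℝ} {p : ℝ → ℕ → ℝ}

lemma IsFlow.hasDerivWithinAt_mass (hp : IsFlow β N s e Λ p) (hN : 1 ≤ N) {k : ℕ}
    (hk : k ∈ Finset.range (N + 1)) {t : ℝ} (ht : t ∈ Set.Icc s e) :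
    ∃ d, HasDerivWithinAt (fun r => p r k) d (Set.Icc s e) t := by
  classical
  refine ⟨_, (hp.forward (fun x => if x = grid N k then 1 else 0) t ht).congr_of_mem ?_ ht⟩
  intro r _
  rw [Finset.sum_eq_single_of_mem k hk]
  · simp
  · intro i _ hik
    have : grid N i ≠ grid N k := fun h => hik (grid_injective hN h)
    simp [this]

/-- Product rule. The derivatives of the single masses are left unnamed: `IsFlow.forward` with the
test function frozen at time `t`, together with uniqueness of derivatives, identifies their pairing
with `F t`. -/
lemma IsFlow.hasDerivWithinAt_sum (hp : IsFlow β N s e Λ p) (hN : 1 ≤ N) (hse : s < e)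
    {F F' : ℝ → ℝ → ℝ} {t : ℝ} (ht : t ∈ Set.Icc s e)
    (hF : ∀ k ∈ Finset.range (N + 1),
      HasDerivWithinAt (fun r => F r (grid N k)) (F' t (grid N k)) (Set.Icc s e) t) :
    HasDerivWithinAt (fun r => ∑ k ∈ Finset.range (N + 1), p r k * F r (grid N k))
      (∑ k ∈ Finset.range (N + 1),
        p t k * (F' t (grid N k) + generator β N (CurieWeiss.hN β N t) (F t) (grid N k)))
      (Set.Icc s e) t := by
  choose! d hd using fun k (hk : k ∈ Finset.range (N + 1)) => hp.hasDerivWithinAt_mass hN hk ht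
  have h1 : HasDerivWithinAt (fun r => ∑ k ∈ Finset.range (N + 1), p r k * F t (grid N k))
      (∑ k ∈ Finset.range (N + 1), d k * F t (grid N k)) (Set.Icc s e) t :=
    HasDerivWithinAt.fun_sum fun k hk => (hd k hk).mul_const _
  have h2 := hp.forward (F t) t ht
  have h3 := (uniqueDiffOn_Icc hse t ht).eq_deriv _ h1 h2
  have h4 : HasDerivWithinAt (fun r => ∑ k ∈ Finset.range (N + 1), p r k * F r (grid N k))
      (∑ k ∈ Finset.range (N + 1), (d k * F t (grid N k) + p t k * F' t (grid N k)))
      (Set.Icc s e) t :=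
    HasDerivWithinAt.fun_sum fun k hk => (hd k hk).mul (hF k hk)
  convert h4 using 1
  rw [Finset.sum_add_distrib, h3, ← Finset.sum_add_distrib]
  exact Finset.sum_congr rfl fun k _ => by ring

/-- Comparison principle for the forward equation. -/
theorem IsFlow.sum_le_of_supersolution (hp : IsFlow β N s e Λ p) (hN : 1 ≤ N) (hse : s ≤ e)
    {F F' : ℝ → ℝ → ℝ} {S S' : ℝ → ℝ}
    (hF : ∀ t ∈ Set.Icc s e, ∀ k ∈ Finset.range (N + 1),
      HasDerivAt (fun r => F r (grid N k)) (F' t (grid N k)) t)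
    (hS : ∀ t ∈ Set.Icc s e, HasDerivAt S (S' t) t)
    (hle : ∀ t ∈ Set.Icc s e, ∀ k ∈ Finset.range (N + 1),
      F' t (grid N k) + generator β N (CurieWeiss.hN β N t) (F t) (grid N k) ≤ S' t) :
    ∑ k ∈ Finset.range (N + 1), p e k * F e (grid N k) ≤
      ∑ k ∈ Finset.range (N + 1), p s k * F s (grid N k) + Λ * (S e - S s) := by
  rcases hse.eq_or_lt with rfl | hse'
  · simp
  have hd : ∀ t ∈ Set.Icc s e, HasDerivWithinAt
      (fun r => ∑ k ∈ Finset.range (N + 1), p r k * F r (grid N k) - Λ * S r)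
      (∑ k ∈ Finset.range (N + 1),
        p t k * (F' t (grid N k) + generator β N (CurieWeiss.hN β N t) (F t) (grid N k)) - Λ * S' t)
      (Set.Icc s e) t := fun t ht =>
    (hp.hasDerivWithinAt_sum hN hse' ht fun k hk => (hF t ht k hk).hasDerivWithinAt).sub
      ((hS t ht).hasDerivWithinAt.const_mul Λ)
  -- Since the masses sum to Λ, the derivative of the difference is a sum of nonnegative masses
  -- times nonpositive defects.
  have hanti := antitoneOn_of_hasDerivWithinAt_nonpos (convex_Icc s e)
    (fun t ht => (hd t ht).continuousWithinAt)
    (fun t ht => (hd t (interior_subset ht)).mono interior_subset) (by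
      intro t ht
      have ht' := interior_subset ht
      rw [← hp.mass t ht', Finset.sum_mul, ← Finset.sum_sub_distrib]
      refine Finset.sum_nonpos fun k hk => ?_
      rw [← mul_sub]
      exact mul_nonpos_of_nonneg_of_nonpos (hp.nonneg t ht' k) (by linarith [hle t ht' k hk]))
  have := hanti (Set.left_mem_Icc.2 hse) (Set.right_mem_Icc.2 hse) hse
  simp only at this
  linarith

/-- The concave cutoff `x ↦ (1 - (1 - x)₊²) / 2`. -/
noncomputable def cutoff (x : ℝ) : ℝ := (1 - max (1 - x) 0 ^ 2) / 2

lemma hasDerivAt_max_zero_pow (n : ℕ) (x : ℝ) :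
    HasDerivAt (fun y : ℝ => max y 0 ^ (n + 2)) ((n + 2 : ℝ) * max x 0 ^ (n + 1)) x := by
  rcases lt_trichotomy x 0 with h | h | h
  · have h1 : (fun y : ℝ => max y 0 ^ (n + 2)) =ᶠ[𝓝 x] fun _ => 0 := by
      filter_upwards [Iio_mem_nhds h] with y hy
      rw [max_eq_right (le_of_lt hy)]; simp
    rw [max_eq_right h.le]
    simpa using (hasDerivAt_const x (0 : ℝ)).congr_of_eventuallyEq h1
  · subst h
    have h1 : (fun y : ℝ => max y 0 ^ (n + 2)) =o[𝓝 0] fun y : ℝ => y := by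
      have h2 : (fun y : ℝ => y ^ 2) =o[𝓝 0] fun y : ℝ => y := by
        simpa using Asymptotics.isLittleO_pow_id (𝕜 := ℝ) (n := 2) (by norm_num)
      refine Asymptotics.IsBigO.trans_isLittleO ?_ h2
      refine Asymptotics.IsBigO.of_bound 1 ?_
      filter_upwards [Ioo_mem_nhds (by norm_num : (-1 : ℝ) < 0) (by norm_num : (0 : ℝ) < 1)]
        with y hy
      have h3 : 0 ≤ max y 0 := le_max_right _ _
      have h4 : max y 0 ≤ 1 := max_le hy.2.le zero_le_one
      have h5 : max y 0 ^ 2 ≤ y ^ 2 := by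
        rcases le_total y 0 with h | h
        · rw [max_eq_right h]; nlinarith [sq_nonneg y]
        · rw [max_eq_left h]
      rw [Real.norm_of_nonneg (pow_nonneg h3 _), Real.norm_of_nonneg (sq_nonneg y), one_mul]
      calc max y 0 ^ (n + 2) = max y 0 ^ n * max y 0 ^ 2 := by ring
        _ ≤ 1 * max y 0 ^ 2 := by gcongr; exact pow_le_one₀ h3 h4
        _ ≤ y ^ 2 := by linarith
    rw [hasDerivAt_iff_isLittleO_nhds_zero]
    simpa using h1
  · have h1 : (fun y : ℝ => max y 0 ^ (n + 2)) =ᶠ[𝓝 x] fun y => y ^ (n + 2) := by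
      filter_upwards [Ioi_mem_nhds h] with y hy
      rw [max_eq_left (le_of_lt hy)]
    rw [max_eq_left h.le]
    simpa using (hasDerivAt_pow (n + 2) x).congr_of_eventuallyEq h1

lemma hasDerivAt_cutoff (x : ℝ) : HasDerivAt cutoff (max (1 - x) 0) x := by
  have h1 := (hasDerivAt_max_zero_pow 0 (1 - x)).comp x ((hasDerivAt_id x).const_sub 1)
  have h2 := (h1.const_sub 1).div_const 2
  refine h2.congr_deriv ?_
  push_cast
  ring

/-- Concavity: the graph lies below its tangents. The slope is zero beyond 1, and this is what
localizes the barriers. -/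
lemma cutoff_sub_le (x y : ℝ) : cutoff y - cutoff x ≤ max (1 - x) 0 * (y - x) := by
  unfold cutoff
  rcases max_cases (1 - x) 0 with ⟨h1, h1'⟩ | ⟨h1, h1'⟩ <;>
    rcases max_cases (1 - y) 0 with ⟨h2, h2'⟩ | ⟨h2, h2'⟩ <;> rw [h1, h2] <;>
    nlinarith [sq_nonneg (x - y)]

lemma cutoff_nonneg {x : ℝ} (hx : 0 ≤ x) : 0 ≤ cutoff x := by
  unfold cutoff
  rcases max_cases (1 - x) 0 with ⟨h1, h1'⟩ | ⟨h1, h1'⟩ <;> rw [h1] <;> nlinarith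

lemma cutoff_le_self {x : ℝ} (hx : 0 ≤ x) : cutoff x ≤ x := by
  unfold cutoff
  rcases max_cases (1 - x) 0 with ⟨h1, h1'⟩ | ⟨h1, h1'⟩ <;> rw [h1] <;> nlinarith

lemma cutoff_le_one (x : ℝ) : cutoff x ≤ 1 := by
  unfold cutoff; nlinarith [sq_nonneg (max (1 - x) 0)]

lemma half_le_cutoff {x : ℝ} (hx : 1 ≤ x) : 1 / 2 ≤ cutoff x := by
  unfold cutoff; rw [max_eq_right (by linarith)]; norm_num

lemma neg_one_le_grid {N : ℕ} (hN : 1 ≤ N) (k : ℕ) : -1 ≤ grid N k := by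
  have hN' : (0 : ℝ) < N := by positivity
  unfold grid; rw [le_div_iff₀ hN']; nlinarith [(Nat.cast_nonneg k : (0 : ℝ) ≤ k)]

lemma grid_le_one {N : ℕ} (hN : 1 ≤ N) {k : ℕ} (hk : k ∈ Finset.range (N + 1)) :
    grid N k ≤ 1 := by
  have hN' : (0 : ℝ) < N := by positivity
  have hk' : (k : ℝ) ≤ N := by exact_mod_cast Nat.lt_succ_iff.1 (Finset.mem_range.1 hk)
  unfold grid; rw [div_le_iff₀ hN']; linarith

lemma ratePlus_nonneg {m : ℝ} (h : ℝ) (hm : m ≤ 1) : 0 ≤ ratePlus β N m h := by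
  unfold ratePlus
  have : 0 ≤ 1 - m := by linarith
  positivity

lemma rateMinus_nonneg {m : ℝ} (h : ℝ) (hm : -1 ≤ m) : 0 ≤ rateMinus β N m h := by
  unfold rateMinus
  have : 0 ≤ 1 + m := by linarith
  positivity

/-- The expected cutoff of a barrier `G ≥ 0` that is a supersolution, up to the source `S'`,
where `G < 1`. -/
theorem IsFlow.sum_cutoff_le (hp : IsFlow β N s e Λ p) (hN : 1 ≤ N) (hse : s ≤ e)
    {G G' : ℝ → ℝ → ℝ} {S S' : ℝ → ℝ}
    (hG : ∀ t ∈ Set.Icc s e, ∀ k ∈ Finset.range (N + 1),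
      HasDerivAt (fun r => G r (grid N k)) (G' t (grid N k)) t)
    (hG0 : ∀ t m, 0 ≤ G t m)
    (hS : ∀ t ∈ Set.Icc s e, HasDerivAt S (S' t) t) (hS0 : ∀ t ∈ Set.Icc s e, 0 ≤ S' t)
    (hle : ∀ t ∈ Set.Icc s e, ∀ k ∈ Finset.range (N + 1), G t (grid N k) < 1 →
      G' t (grid N k) + generator β N (CurieWeiss.hN β N t) (G t) (grid N k) ≤ S' t) :
    ∑ k ∈ Finset.range (N + 1), p e k * cutoff (G e (grid N k)) ≤
      ∑ k ∈ Finset.range (N + 1), p s k * cutoff (G s (grid N k)) + Λ * (S e - S s) := by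
  refine hp.sum_le_of_supersolution (F := fun t m => cutoff (G t m))
    (F' := fun t m => max (1 - G t m) 0 * G' t m) hN hse
    (fun t ht k hk => (hasDerivAt_cutoff _).comp t (hG t ht k hk)) hS ?_
  intro t ht k hk
  set m := grid N k
  have hcp := ratePlus_nonneg (β := β) (N := N) (CurieWeiss.hN β N t) (grid_le_one hN hk)
  have hcm := rateMinus_nonneg (β := β) (N := N) (CurieWeiss.hN β N t) (neg_one_le_grid hN k)
  have h1 := mul_le_mul_of_nonneg_left (cutoff_sub_le (G t m) (G t (m + 2 / N))) hcp
  have h2 := mul_le_mul_of_nonneg_left (cutoff_sub_le (G t m) (G t (m - 2 / N))) hcm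
  -- The jump rates are nonnegative, so the tangent inequality can be applied to each jump
  -- separately; it turns the generator of the cut-off barrier into the slope times the generator of
  -- `G`.
  have h3 : max (1 - G t m) 0 * G' t m + generator β N (CurieWeiss.hN β N t)
      (fun m => cutoff (G t m)) m ≤ max (1 - G t m) 0 *
      (G' t m + generator β N (CurieWeiss.hN β N t) (G t) m) := by
    unfold generator
    simp only
    linarith
  refine h3.trans ?_
  -- Where `G` is at least 1 the slope vanishes and nothing is required of `G`; elsewhere the slope
  -- lies in [0, 1] because `G` is nonnegative, so the source is not increased.
  rcases lt_or_ge (G t m) 1 with hlt | hge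
  · rw [max_eq_left (by linarith)]
    have h5 := hle t ht k hk hlt
    have h6 := hS0 t ht
    have h7 := hG0 t m
    nlinarith [mul_le_mul_of_nonneg_left h5 (by linarith : 0 ≤ 1 - G t m)]
  · rw [max_eq_right (by linarith), zero_mul]
    exact hS0 t ht

open Classical in
/-- Mass of the set where the barrier is at least one. -/
theorem IsFlow.mass_barrier_le (hp : IsFlow β N s e Λ p) (hN : 1 ≤ N) (hse : s ≤ e)
    {G G' : ℝ → ℝ → ℝ} {S S' : ℝ → ℝ}
    (hG : ∀ t ∈ Set.Icc s e, ∀ k ∈ Finset.range (N + 1),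
      HasDerivAt (fun r => G r (grid N k)) (G' t (grid N k)) t)
    (hG0 : ∀ t m, 0 ≤ G t m)
    (hS : ∀ t ∈ Set.Icc s e, HasDerivAt S (S' t) t) (hS0 : ∀ t ∈ Set.Icc s e, 0 ≤ S' t)
    (hle : ∀ t ∈ Set.Icc s e, ∀ k ∈ Finset.range (N + 1), G t (grid N k) < 1 →
      G' t (grid N k) + generator β N (CurieWeiss.hN β N t) (G t) (grid N k) ≤ S' t)
    {D D₀ : Set ℝ} (hD : ∀ k ∈ Finset.range (N + 1), grid N k ∈ D → 1 ≤ G e (grid N k))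
    {g : ℝ} (hg : ∀ k ∈ Finset.range (N + 1), grid N k ∉ D₀ → G s (grid N k) ≤ g) (hg0 : 0 ≤ g) :
    ∑ k ∈ Finset.range (N + 1), (if grid N k ∈ D then p e k else 0) ≤
      2 * (∑ k ∈ Finset.range (N + 1), (if grid N k ∈ D₀ then p s k else 0) +
        Λ * (g + (S e - S s))) := by
  have h1 := hp.sum_cutoff_le hN hse hG hG0 hS hS0 hle
  have hse' := Set.right_mem_Icc.2 hse
  have hss' := Set.left_mem_Icc.2 hse
  -- The cutoff is at least 1/2 where the barrier exceeds 1; this produces the factor 2 of the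
  -- statement.
  have h2 : 1 / 2 * ∑ k ∈ Finset.range (N + 1), (if grid N k ∈ D then p e k else 0) ≤
      ∑ k ∈ Finset.range (N + 1), p e k * cutoff (G e (grid N k)) := by
    rw [Finset.mul_sum]
    refine Finset.sum_le_sum fun k hk => ?_
    split_ifs with h
    · nlinarith [hp.nonneg e hse' k, half_le_cutoff (hD k hk h)]
    · simpa using mul_nonneg (hp.nonneg e hse' k) (cutoff_nonneg (hG0 _ _))
  have h3 : ∑ k ∈ Finset.range (N + 1), p s k * cutoff (G s (grid N k)) ≤
      ∑ k ∈ Finset.range (N + 1), (if grid N k ∈ D₀ then p s k else 0) + Λ * g := by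
    rw [← hp.mass s hss', Finset.sum_mul, ← Finset.sum_add_distrib]
    refine Finset.sum_le_sum fun k hk => ?_
    have h0 := hp.nonneg s hss' k
    split_ifs with h
    · nlinarith [cutoff_le_one (G s (grid N k)), mul_nonneg h0 hg0]
    · rw [zero_add]
      exact mul_le_mul_of_nonneg_left ((cutoff_le_self (hG0 _ _)).trans (hg k hk h)) h0
  linarith

end Comparison

/-! ### The free energy, the coercive field and the upper branch. -/

section Statics

lemma hasDerivAt_tanh (x : ℝ) : HasDerivAt Real.tanh (1 - Real.tanh x ^ 2) x := by
  have hc := (Real.cosh_pos x).ne'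
  have h := (Real.hasDerivAt_sinh x).div (Real.hasDerivAt_cosh x) hc
  have h1 : Real.tanh = fun x => Real.sinh x / Real.cosh x := by
    funext y; exact Real.tanh_eq_sinh_div_cosh y
  rw [h1]
  refine h.congr_deriv ?_
  field_simp

lemma hasDerivAt_artanh {m : ℝ} (hm : m ∈ Set.Ioo (-1 : ℝ) 1) :
    HasDerivAt Real.artanh (1 / (1 - m ^ 2)) m := by
  have h1 : (0 : ℝ) < 1 + m := by linarith [hm.1]
  have h2 : (0 : ℝ) < 1 - m := by linarith [hm.2]
  have h3 : HasDerivAt (fun x : ℝ => 1 / 2 * Real.log ((1 + x) / (1 - x))) (1 / (1 - m ^ 2)) m := by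
    have := (((hasDerivAt_id m).const_add 1).div ((hasDerivAt_id m).const_sub 1) h2.ne').log
      (div_pos h1 h2).ne'
    refine (this.const_mul (1 / 2)).congr_deriv ?_
    have h4 : 1 - m ^ 2 = (1 + m) * (1 - m) := by ring
    simp only [Pi.div_apply, id]
    rw [h4]
    field_simp
    ring
  refine h3.congr_of_eventuallyEq ?_
  filter_upwards [Ioo_mem_nhds hm.1 hm.2] with x hx
  exact Real.artanh_eq_half_log ⟨hx.1.le, hx.2.le⟩

/-- The field for which `m` is a critical point of the free energy. -/
noncomputable def field (β m : ℝ) : ℝ := Real.artanh m / β - m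

/-- The positive inflection point of the free energy. -/
noncomputable def inflection (β : ℝ) : ℝ := √(1 - 1 / β)

variable {β : ℝ}

lemma inflection_sq (hβ : 1 < β) : inflection β ^ 2 = 1 - 1 / β := by
  unfold inflection
  rw [Real.sq_sqrt]
  have : 1 / β ≤ 1 := by rw [div_le_one (by linarith)]; exact hβ.le
  linarith

lemma beta_mul_one_sub_inflection_sq (hβ : 1 < β) : β * (1 - inflection β ^ 2) = 1 := by
  rw [inflection_sq hβ]; field_simp; ring

lemma inflection_pos (hβ : 1 < β) : 0 < inflection β := by
  refine Real.sqrt_pos.2 ?_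
  have : 1 / β < 1 := by rw [div_lt_one (by linarith)]; exact hβ
  linarith

lemma inflection_lt_one (hβ : 1 < β) : inflection β < 1 := by
  have h1 := inflection_sq hβ
  have h2 : 0 < 1 / β := by positivity
  nlinarith [inflection_pos hβ]

lemma hasDerivAt_field (hβ : 1 < β) {m : ℝ} (hm : m ∈ Set.Ioo (-1 : ℝ) 1) :
    HasDerivAt (field β) ((m ^ 2 - inflection β ^ 2) / (1 - m ^ 2)) m := by
  have h := ((hasDerivAt_artanh hm).div_const β).sub (hasDerivAt_id m)
  refine h.congr_deriv ?_
  have h1 : (1 - m ^ 2) ≠ 0 := by nlinarith [hm.1, hm.2]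
  have h2 : β ≠ 0 := by positivity
  rw [inflection_sq hβ]
  field_simp
  ring

lemma field_neg (m : ℝ) (hm : m ∈ Set.Ioo (-1 : ℝ) 1) : field β (-m) = -field β m := by
  unfold field
  have : Real.artanh (-m) = -Real.artanh m := by
    rw [← Real.tanh_artanh hm, ← Real.tanh_neg, Real.artanh_tanh, Real.artanh_tanh]
  rw [this]; ring

lemma continuousOn_field (hβ : 1 < β) : ContinuousOn (field β) (Set.Ioo (-1) 1) :=
  fun _ hm => (hasDerivAt_field hβ hm).continuousAt.continuousWithinAt

lemma strictMonoOn_field_right (hβ : 1 < β) :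
    StrictMonoOn (field β) (Set.Ico (inflection β) 1) := by
  have hp := inflection_pos hβ
  refine strictMonoOn_of_deriv_pos (convex_Ico _ _)
    ((continuousOn_field hβ).mono fun x hx => ⟨by linarith [hx.1], hx.2⟩) fun x hx => ?_
  rw [interior_Ico] at hx
  rw [(hasDerivAt_field hβ ⟨by linarith [hx.1], hx.2⟩).deriv]
  exact div_pos (by nlinarith [hx.1]) (by nlinarith [hx.1, hx.2])

lemma strictAntiOn_field (hβ : 1 < β) :
    StrictAntiOn (field β) (Set.Icc (-inflection β) (inflection β)) := by
  have hp := inflection_pos hβ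
  have hl := inflection_lt_one hβ
  refine strictAntiOn_of_deriv_neg (convex_Icc _ _)
    ((continuousOn_field hβ).mono fun x hx => ⟨by linarith [hx.1], by linarith [hx.2]⟩) fun x hx => ?_
  rw [interior_Icc] at hx
  rw [(hasDerivAt_field hβ ⟨by linarith [hx.1], by linarith [hx.2]⟩).deriv]
  exact div_neg_of_neg_of_pos (by nlinarith [hx.1, hx.2]) (by nlinarith [hx.1, hx.2])

lemma strictMonoOn_field_left (hβ : 1 < β) :
    StrictMonoOn (field β) (Set.Ioc (-1) (-inflection β)) := by
  have hp := inflection_pos hβ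
  have hl := inflection_lt_one hβ
  intro x hx y hy hxy
  have h := strictMonoOn_field_right hβ (a := -y) (b := -x) ⟨by linarith [hy.2], by linarith [hy.1]⟩
    ⟨by linarith [hx.2], by linarith [hx.1]⟩ (by linarith)
  rw [field_neg y ⟨hy.1, by linarith [hy.2]⟩, field_neg x ⟨hx.1, by linarith [hx.2]⟩] at h
  linarith

lemma field_zero : field β 0 = 0 := by simp [field]

lemma field_inflection_neg (hβ : 1 < β) : field β (inflection β) < 0 := by
  have hp := inflection_pos hβ
  have := strictAntiOn_field hβ (a := 0) (b := inflection β) ⟨by linarith, hp.le⟩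
    ⟨by linarith, le_rfl⟩ hp
  rwa [field_zero] at this

lemma eq_tanh_iff (hβ : 1 < β) (m h : ℝ) :
    m = Real.tanh (β * (m + h)) ↔ m ∈ Set.Ioo (-1 : ℝ) 1 ∧ field β m = h := by
  have hβ0 : β ≠ 0 := by positivity
  constructor
  · intro hm
    have hmem : m ∈ Set.Ioo (-1 : ℝ) 1 := by
      rw [hm]; exact Real.tanh_bijOn.mapsTo (Set.mem_univ _)
    refine ⟨hmem, ?_⟩
    have : Real.artanh m = β * (m + h) := by
      conv_lhs => rw [hm]
      exact Real.artanh_tanh _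
    unfold field
    rw [this]; field_simp; ring
  · rintro ⟨hmem, rfl⟩
    have : β * (m + field β m) = Real.artanh m := by unfold field; field_simp; ring
    rw [this, Real.tanh_artanh hmem]

lemma exists_field_eq_right (hβ : 1 < β) {h : ℝ} (hh : field β (inflection β) ≤ h) :
    ∃ m ∈ Set.Ico (inflection β) 1, field β m = h := by
  have hp := inflection_pos hβ
  have hl := inflection_lt_one hβ
  -- The summand β(|h| + 1) makes artanh/β exceed |h| + 1, while the subtracted magnetization is
  -- below 1.
  set y := Real.artanh (inflection β) + β * (|h| + 1) with hy
  have hβ0 : 0 < β := by linarith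
  have hmem : Real.tanh y ∈ Set.Ioo (-1 : ℝ) 1 := Real.tanh_bijOn.mapsTo (Set.mem_univ _)
  have hlt : inflection β ≤ Real.tanh y := by
    rw [← Real.artanh_le_artanh_iff ⟨by linarith, hl⟩ hmem, Real.artanh_tanh, hy]
    have : 0 ≤ β * (|h| + 1) := by positivity
    linarith
  have hval : h ≤ field β (Real.tanh y) := by
    unfold field
    rw [Real.artanh_tanh, hy, add_div, mul_div_cancel_left₀ _ hβ0.ne']
    have h1 : 0 ≤ Real.artanh (inflection β) / β :=
      div_nonneg (Real.artanh_nonneg hp.le) hβ0.le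
    linarith [le_abs_self h, hmem.2]
  have hsub : Set.Icc (inflection β) (Real.tanh y) ⊆ Set.Ioo (-1) 1 := fun x hx =>
    ⟨by linarith [hx.1], by linarith [hx.2, hmem.2]⟩
  obtain ⟨m, hm, hmh⟩ := intermediate_value_Icc hlt ((continuousOn_field hβ).mono hsub) ⟨hh, hval⟩
  exact ⟨m, ⟨hm.1, by linarith [hm.2, hmem.2]⟩, hmh⟩

/-- On this range `field` first increases and then decreases, with its maximum at the negative
inflection point. -/
lemma field_le_of_le_inflection (hβ : 1 < β) {m : ℝ} (hm : -1 < m) (hm' : m ≤ inflection β) :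
    field β m ≤ -field β (inflection β) := by
  have hp := inflection_pos hβ
  have hl := inflection_lt_one hβ
  rw [← field_neg _ ⟨by linarith, hl⟩]
  rcases le_total m (-inflection β) with h | h
  · exact (strictMonoOn_field_left hβ).monotoneOn ⟨hm, h⟩ ⟨by linarith, le_rfl⟩ h
  · exact (strictAntiOn_field hβ).antitoneOn ⟨le_rfl, by linarith⟩ ⟨h, hm'⟩ h

lemma hasDerivAt_freeEnergy (h : ℝ) {m : ℝ} (hm : m ∈ Set.Ioo (-1 : ℝ) 1) :
    HasDerivAt (freeEnergy β h) (field β m - h) m := by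
  have h1 : (0 : ℝ) < 1 + m := by linarith [hm.1]
  have h2 : (0 : ℝ) < 1 - m := by linarith [hm.2]
  have hu : HasDerivAt (fun x : ℝ => (1 - x) / 2) (-1 / 2) m :=
    ((hasDerivAt_id m).const_sub 1).div_const 2
  have hv : HasDerivAt (fun x : ℝ => (1 + x) / 2) (1 / 2) m :=
    ((hasDerivAt_id m).const_add 1).div_const 2
  have hent : HasDerivAt entropy (-Real.artanh m) m := by
    have := ((hu.fun_neg).mul (hu.log (by positivity))).sub (hv.mul (hv.log (by positivity)))
    refine this.congr_deriv ?_
    rw [Real.artanh_eq_half_log ⟨hm.1.le, hm.2.le⟩, Real.log_div h1.ne' h2.ne',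
      Real.log_div h1.ne' two_ne_zero, Real.log_div h2.ne' two_ne_zero]
    field_simp
    ring
  have := ((((hasDerivAt_pow 2 m).div_const 2).fun_neg).sub ((hasDerivAt_id m).const_mul h)).sub
    (hent.div_const β)
  refine this.congr_deriv ?_
  unfold field
  simp
  ring

/-- For larger h every critical point lies to the right of the positive inflection point, where
`field` is injective, so two minimizers would coincide. -/
lemma le_of_isDoubleWell (hβ : 1 < β) {h : ℝ} (hd : IsDoubleWell β h) :
    h ≤ -field β (inflection β) := by
  by_contra! hlt
  obtain ⟨a, b, c, hab, hbc, hmin, -⟩ := hd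
  have key : ∀ m, m ∈ ({a, c} : Set ℝ) → m ∈ Set.Ioo (inflection β) 1 ∧ field β m = h := by
    intro m hm
    rw [← hmin] at hm
    have h1 := hm.2.hasDerivAt_eq_zero (hasDerivAt_freeEnergy h hm.1)
    refine ⟨⟨?_, hm.1.2⟩, by linarith⟩
    by_contra! hle
    have := field_le_of_le_inflection hβ hm.1.1 hle
    linarith
  obtain ⟨ha, ha'⟩ := key a (by simp)
  obtain ⟨hc, hc'⟩ := key c (by simp)
  have := (strictMonoOn_field_right hβ).injOn ⟨ha.1.le, ha.2⟩ ⟨hc.1.le, hc.2⟩ (ha'.trans hc'.symm)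
  linarith

/-- The derivative of the free energy is `field` minus h. For these h the line at height h cuts the
three monotone pieces of `field` once each, so the derivative has signs -, +, -, + between -1, a, b,
c, 1. -/
lemma isDoubleWell_of_abs_lt (hβ : 1 < β) {h : ℝ} (hh : |h| < -field β (inflection β)) :
    IsDoubleWell β h := by
  have hp := inflection_pos hβ
  have hl := inflection_lt_one hβ
  have hneg : field β (-inflection β) = -field β (inflection β) := field_neg _ ⟨by linarith, hl⟩
  rw [abs_lt] at hh
  obtain ⟨c, hc, hch⟩ := exists_field_eq_right hβ (h := h) (by linarith)
  obtain ⟨a', ha', hah'⟩ := exists_field_eq_right hβ (h := -h) (by linarith)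
  obtain ⟨b, hb, hbh⟩ := intermediate_value_Icc' (by linarith : -inflection β ≤ inflection β)
    ((continuousOn_field hβ).mono fun x hx => ⟨by linarith [hx.1], by linarith [hx.2]⟩)
    (show h ∈ Set.Icc _ _ from ⟨by linarith, by linarith⟩)
  obtain ⟨a, rfl⟩ : ∃ a, a' = -a := ⟨-a', by simp⟩
  have hamem : a ∈ Set.Ioo (-1 : ℝ) 1 := ⟨by linarith [ha'.2], by linarith [ha'.1]⟩
  have hah : field β a = h := by
    rw [field_neg a hamem] at hah'; linarith
  have ha1 : a < -inflection β := by
    rcases ha'.1.eq_or_lt with h1 | h1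
    · exfalso
      rw [← h1] at hah'; linarith
    · linarith
  have hc1 : inflection β < c := by
    rcases hc.1.eq_or_lt with h1 | h1
    · exfalso
      rw [← h1] at hch; linarith
    · linarith
  have hb1 : b < inflection β := by
    rcases hb.2.eq_or_lt with h1 | h1
    · exfalso
      rw [h1] at hbh; linarith
    · linarith
  have hb2 : -inflection β < b := by
    rcases hb.1.eq_or_lt with h1 | h1
    · exfalso
      rw [← h1] at hbh; linarith
    · linarith
  have s1 : ∀ m, -1 < m → m < a → field β m < h := fun m hm1 hm2 => by
    rw [← hah]; exact strictMonoOn_field_left hβ ⟨hm1, by linarith⟩ ⟨hamem.1, ha1.le⟩ hm2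
  have s2 : ∀ m, a < m → m < b → h < field β m := fun m hm1 hm2 => by
    rcases le_total m (-inflection β) with h1 | h1
    · rw [← hah]
      exact strictMonoOn_field_left hβ ⟨hamem.1, ha1.le⟩ ⟨by linarith [hamem.1], h1⟩ hm1
    · rw [← hbh]; exact strictAntiOn_field hβ ⟨h1, by linarith⟩ hb hm2
  have s3 : ∀ m, b < m → m < c → field β m < h := fun m hm1 hm2 => by
    rcases le_total m (inflection β) with h1 | h1
    · rw [← hbh]; exact strictAntiOn_field hβ hb ⟨by linarith, h1⟩ hm1
    · rw [← hch]; exact strictMonoOn_field_right hβ ⟨h1, by linarith [hc.2]⟩ hc hm2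
  have s4 : ∀ m, c < m → m < 1 → h < field β m := fun m hm1 hm2 => by
    rw [← hch]; exact strictMonoOn_field_right hβ hc ⟨by linarith, hm2⟩ hm1
  have hcont : ContinuousOn (freeEnergy β h) (Set.Ioo (-1) 1) := fun m hm =>
    (hasDerivAt_freeEnergy h hm).continuousAt.continuousWithinAt
  have hanti : ∀ x y, -1 < x → y < 1 → (∀ m, x < m → m < y → field β m < h) →
      StrictAntiOn (freeEnergy β h) (Set.Icc x y) := fun x y hx hy hxy => by
    refine strictAntiOn_of_deriv_neg (convex_Icc _ _)
      (hcont.mono fun m hm => ⟨by linarith [hm.1], by linarith [hm.2]⟩) fun m hm => ?_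
    rw [interior_Icc] at hm
    rw [(hasDerivAt_freeEnergy h ⟨by linarith [hm.1], by linarith [hm.2]⟩).deriv]
    linarith [hxy m hm.1 hm.2]
  have hmono : ∀ x y, -1 < x → y < 1 → (∀ m, x < m → m < y → h < field β m) →
      StrictMonoOn (freeEnergy β h) (Set.Icc x y) := fun x y hx hy hxy => by
    refine strictMonoOn_of_deriv_pos (convex_Icc _ _)
      (hcont.mono fun m hm => ⟨by linarith [hm.1], by linarith [hm.2]⟩) fun m hm => ?_
    rw [interior_Icc] at hm
    rw [(hasDerivAt_freeEnergy h ⟨by linarith [hm.1], by linarith [hm.2]⟩).deriv]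
    linarith [hxy m hm.1 hm.2]
  have hbmem : b ∈ Set.Ioo (-1 : ℝ) 1 := ⟨by linarith, by linarith⟩
  have hcmem : c ∈ Set.Ioo (-1 : ℝ) 1 := ⟨by linarith, hc.2⟩
  have m1 := hanti ((-1 + a) / 2) a (by linarith [hamem.1]) hamem.2
    fun m hm1 hm2 => s1 m (by linarith [hamem.1]) hm2
  have m2 := hmono a b hamem.1 hbmem.2 s2
  have m3 := hanti b c hbmem.1 hcmem.2 s3
  have m4 := hmono c ((c + 1) / 2) hcmem.1 (by linarith [hcmem.2])
    fun m hm1 hm2 => s4 m hm1 (by linarith [hcmem.2])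
  have crit : ∀ m ∈ Set.Ioo (-1 : ℝ) 1, field β m = h → m = a ∨ m = b ∨ m = c := by
    intro m hm hmh
    rcases lt_trichotomy m a with h1 | h1 | h1
    · linarith [s1 m hm.1 h1]
    · exact Or.inl h1
    rcases lt_trichotomy m b with h2 | h2 | h2
    · linarith [s2 m h1 h2]
    · exact Or.inr (Or.inl h2)
    rcases lt_trichotomy m c with h3 | h3 | h3
    · linarith [s3 m h2 h3]
    · exact Or.inr (Or.inr h3)
    · linarith [s4 m h3 hm.2]
  have hmin : ∀ x y z, x < y → y < z → StrictAntiOn (freeEnergy β h) (Set.Icc x y) →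
      StrictMonoOn (freeEnergy β h) (Set.Icc y z) →
      IsLocalMin (freeEnergy β h) y ∧ ¬ IsLocalMax (freeEnergy β h) y := by
    intro x y z hxy hyz hA hM
    constructor
    · filter_upwards [Ioo_mem_nhds hxy hyz] with m hm
      rcases le_total m y with h1 | h1
      · exact hA.antitoneOn ⟨hm.1.le, h1⟩ ⟨hxy.le, le_rfl⟩ h1
      · exact hM.monotoneOn ⟨le_rfl, hyz.le⟩ ⟨h1, hm.2.le⟩ h1
    · intro hmax
      have h1 : ∀ᶠ m in 𝓝[>] y, freeEnergy β h m ≤ freeEnergy β h y :=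
        hmax.filter_mono nhdsWithin_le_nhds
      obtain ⟨m, hm, hm2⟩ := (h1.and (Ioo_mem_nhdsGT hyz)).exists
      exact absurd hm (not_le.2 (hM ⟨le_rfl, hyz.le⟩ ⟨hm2.1.le, hm2.2.le⟩ hm2.1))
  have hmax : ∀ x y z, x < y → y < z → StrictMonoOn (freeEnergy β h) (Set.Icc x y) →
      StrictAntiOn (freeEnergy β h) (Set.Icc y z) →
      IsLocalMax (freeEnergy β h) y ∧ ¬ IsLocalMin (freeEnergy β h) y := by
    intro x y z hxy hyz hA hM
    constructor
    · filter_upwards [Ioo_mem_nhds hxy hyz] with m hm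
      rcases le_total m y with h1 | h1
      · exact hA.monotoneOn ⟨hm.1.le, h1⟩ ⟨hxy.le, le_rfl⟩ h1
      · exact hM.antitoneOn ⟨le_rfl, hyz.le⟩ ⟨h1, hm.2.le⟩ h1
    · intro hmin
      have h1 : ∀ᶠ m in 𝓝[>] y, freeEnergy β h y ≤ freeEnergy β h m :=
        hmin.filter_mono nhdsWithin_le_nhds
      obtain ⟨m, hm, hm2⟩ := (h1.and (Ioo_mem_nhdsGT hyz)).exists
      exact absurd hm (not_le.2 (hM ⟨le_rfl, hyz.le⟩ ⟨hm2.1.le, hm2.2.le⟩ hm2.1))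
  have hA := hmin _ a b (by linarith [hamem.1]) (by linarith) m1 m2
  have hB := hmax a b c (by linarith) (by linarith) m2 m3
  have hC := hmin b c _ (by linarith) (by linarith [hcmem.2]) m3 m4
  refine ⟨a, b, c, by linarith, by linarith, ?_, ?_⟩
  · ext m
    constructor
    · rintro ⟨hm, hloc⟩
      have h1 := hloc.hasDerivAt_eq_zero (hasDerivAt_freeEnergy h hm)
      rcases crit m hm (by linarith) with rfl | rfl | rfl
      · simp
      · exact absurd hloc hB.2
      · simp
    · rintro (rfl | rfl)
      · exact ⟨hamem, hA.1⟩
      · exact ⟨hcmem, hC.1⟩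
  · ext m
    constructor
    · rintro ⟨hm, hloc⟩
      have h1 := hloc.hasDerivAt_eq_zero (hasDerivAt_freeEnergy h hm)
      rcases crit m hm (by linarith) with rfl | rfl | rfl
      · exact absurd hloc hA.2
      · simp
      · exact absurd hloc hC.2
    · rintro rfl
      exact ⟨hbmem, hB.1⟩

/-- Since `hc` is a supremum, it is enough that double wells have h at most this value and that they
occur at fields arbitrarily close to it. -/
lemma hc_eq (hβ : 1 < β) : hc β = -field β (inflection β) := by
  have hneg := field_inflection_neg hβ
  refine csSup_eq_of_forall_le_of_forall_lt_exists_gt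
    ⟨0, isDoubleWell_of_abs_lt hβ (by simpa using hneg)⟩ (fun h hd => le_of_isDoubleWell hβ hd) ?_
  intro w hw
  refine ⟨max 0 ((w - field β (inflection β)) / 2), isDoubleWell_of_abs_lt hβ ?_, ?_⟩
  · rw [abs_of_nonneg (le_max_left _ _)]
    exact max_lt (by linarith) (by linarith)
  · exact lt_of_lt_of_le (by linarith) (le_max_right _ _)

lemma hc_pos (hβ : 1 < β) : 0 < hc β := by
  rw [hc_eq hβ]; linarith [field_inflection_neg hβ]

lemma mPlus_spec (hβ : 1 < β) {h : ℝ} (hh : -hc β ≤ h) :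
    mPlus β h ∈ Set.Ico (inflection β) 1 ∧ field β (mPlus β h) = h := by
  rw [hc_eq hβ, neg_neg] at hh
  have hp := inflection_pos hβ
  obtain ⟨m, hm, hmh⟩ := exists_field_eq_right hβ hh
  have hgr : IsGreatest {m : ℝ | m = Real.tanh (β * (m + h))} m := by
    refine ⟨(eq_tanh_iff hβ m h).2 ⟨⟨by linarith [hm.1], hm.2⟩, hmh⟩, ?_⟩
    intro x hx
    obtain ⟨hx1, hx2⟩ := (eq_tanh_iff hβ x h).1 hx
    by_contra! hlt
    have := strictMonoOn_field_right hβ hm ⟨by linarith [hm.1], hx1.2⟩ hlt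
    linarith
  have : mPlus β h = m := hgr.csSup_eq
  rw [this]
  exact ⟨hm, hmh⟩

lemma mPlus_field (hβ : 1 < β) {m : ℝ} (hm : m ∈ Set.Ico (inflection β) 1) :
    mPlus β (field β m) = m := by
  have h1 : -hc β ≤ field β m := by
    rw [hc_eq hβ, neg_neg]
    exact (strictMonoOn_field_right hβ).monotoneOn ⟨le_rfl, inflection_lt_one hβ⟩ hm hm.1
  obtain ⟨h2, h3⟩ := mPlus_spec hβ h1
  exact (strictMonoOn_field_right hβ).injOn h2 hm h3

lemma mc_eq (hβ : 1 < β) : mc β = inflection β := by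
  unfold mc
  rw [hc_eq hβ, neg_neg]
  exact mPlus_field hβ ⟨le_rfl, inflection_lt_one hβ⟩

lemma strictMonoOn_mPlus (hβ : 1 < β) : StrictMonoOn (mPlus β) (Set.Ici (-hc β)) := by
  intro x hx y hy hxy
  obtain ⟨h1, h2⟩ := mPlus_spec hβ hx
  obtain ⟨h3, h4⟩ := mPlus_spec hβ hy
  by_contra! hle
  have := (strictMonoOn_field_right hβ).monotoneOn h3 h1 hle
  linarith

/-- At h = -h_c the branch has infinite slope, so continuity is read off from the order, through the
monotonicity of `field`. -/
lemma continuousWithinAt_mPlus (hβ : 1 < β) {h : ℝ} (hh : -hc β ≤ h) :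
    ContinuousWithinAt (mPlus β) (Set.Ici (-hc β)) h := by
  obtain ⟨h1, h2⟩ := mPlus_spec hβ hh
  have hp := inflection_pos hβ
  have hmono := strictMonoOn_field_right hβ
  refine tendsto_order.2 ⟨fun a ha => ?_, fun b hb => ?_⟩
  · rcases lt_or_ge a (inflection β) with h3 | h3
    · filter_upwards [self_mem_nhdsWithin] with x hx
      exact h3.trans_le (mPlus_spec hβ hx).1.1
    · have h4 : field β a < h := by rw [← h2]; exact hmono ⟨h3, by linarith [h1.2]⟩ h1 ha
      filter_upwards [self_mem_nhdsWithin, mem_nhdsWithin_of_mem_nhds (Ioi_mem_nhds h4)] with x hx hx2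
      obtain ⟨h5, h6⟩ := mPlus_spec hβ hx
      by_contra! hle
      have := hmono.monotoneOn h5 ⟨h3, by linarith [h1.2]⟩ hle
      simp only [Set.mem_Ioi] at hx2
      linarith
  · rcases le_or_gt 1 b with h3 | h3
    · filter_upwards [self_mem_nhdsWithin] with x hx
      exact (mPlus_spec hβ hx).1.2.trans_le h3
    · have hb' : b ∈ Set.Ico (inflection β) 1 := ⟨by linarith [h1.1], h3⟩
      have h4 : h < field β b := by rw [← h2]; exact hmono h1 hb' hb
      filter_upwards [self_mem_nhdsWithin, mem_nhdsWithin_of_mem_nhds (Iio_mem_nhds h4)] with x hx hx2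
      obtain ⟨h5, h6⟩ := mPlus_spec hβ hx
      by_contra! hle
      have := hmono.monotoneOn hb' h5 hle
      simp only [Set.mem_Iio] at hx2
      linarith

lemma hasDerivAt_mPlus (hβ : 1 < β) {h : ℝ} (hh : -hc β < h) :
    HasDerivAt (mPlus β) ((1 - mPlus β h ^ 2) / (mPlus β h ^ 2 - inflection β ^ 2)) h := by
  obtain ⟨h1, h2⟩ := mPlus_spec hβ hh.le
  have hp := inflection_pos hβ
  have h3 : inflection β < mPlus β h := by
    rcases h1.1.eq_or_lt with h4 | h4
    · exfalso; rw [← h4] at h2; rw [hc_eq hβ, neg_neg] at hh; linarith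
    · exact h4
  have h4 : (mPlus β h ^ 2 - inflection β ^ 2) / (1 - mPlus β h ^ 2) ≠ 0 := by
    have h5 := h1.2
    exact (div_pos (by nlinarith) (by nlinarith)).ne'
  have h5 := (hasDerivAt_field hβ ⟨by linarith, h1.2⟩).of_local_left_inverse
    ((continuousWithinAt_mPlus hβ hh.le).continuousAt (Ici_mem_nhds hh)) h4
    (by filter_upwards [Ici_mem_nhds hh] with x hx; exact (mPlus_spec hβ hx).2)
  rwa [inv_div] at h5

end Statics

/-! ### The branch along one period: kink, speed and contraction. -/

section Branch

variable {β : ℝ}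

/-- The upper branch along one period of the oscillating field. -/
noncomputable def branch (β r : ℝ) : ℝ := mPlus β (-hc β * Real.cos r)

lemma neg_hc_le (hβ : 1 < β) (r : ℝ) : -hc β ≤ -hc β * Real.cos r := by
  nlinarith [hc_pos hβ, Real.cos_le_one r]

lemma branch_mem (hβ : 1 < β) (r : ℝ) : branch β r ∈ Set.Ico (mc β) 1 := by
  rw [mc_eq hβ]; exact (mPlus_spec hβ (neg_hc_le hβ r)).1

lemma field_branch (hβ : 1 < β) (r : ℝ) : field β (branch β r) = -hc β * Real.cos r :=
  (mPlus_spec hβ (neg_hc_le hβ r)).2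

lemma mc_pos (hβ : 1 < β) : 0 < mc β := by rw [mc_eq hβ]; exact inflection_pos hβ

lemma mc_lt_one (hβ : 1 < β) : mc β < 1 := by rw [mc_eq hβ]; exact inflection_lt_one hβ

lemma beta_mul_one_sub_mc_sq (hβ : 1 < β) : β * (1 - mc β ^ 2) = 1 := by
  rw [mc_eq hβ]; exact beta_mul_one_sub_inflection_sq hβ

lemma tanh_branch (hβ : 1 < β) (r : ℝ) :
    Real.tanh (β * (branch β r + -hc β * Real.cos r)) = branch β r := by
  have h := branch_mem hβ r
  have := mc_pos hβ
  exact ((eq_tanh_iff hβ _ _).2 ⟨⟨by linarith [h.1], h.2⟩, field_branch hβ r⟩).symm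

/-- The upper branch leaves the critical magnetization at least linearly. -/
lemma exists_mul_abs_le_branch_sub (hβ : 1 < β) :
    ∃ κ : ℝ, 0 < κ ∧ ∀ r : ℝ, |r| ≤ Real.pi / 2 → κ * |r| ≤ branch β r - mc β := by
  have hcp := hc_pos hβ
  have hmp := mc_pos hβ
  set m₁ := mPlus β 0 with hm₁
  obtain ⟨h1, h2⟩ := mPlus_spec hβ (h := 0) (by linarith)
  rw [← hm₁, ← mc_eq hβ] at h1
  set Q := 1 / (1 - m₁ ^ 2) with hQ
  have hm1lt : 0 < 1 - m₁ ^ 2 := by nlinarith [h1.1, h1.2]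
  have hQ0 : 0 < Q := by positivity
  -- The derivative of `field` is (m - m_c)(m + m_c)/(1 - m²), at most 2Q(m - m_c) here, so `field`
  -- rises at most quadratically from -h_c.
  have hquad : ∀ m ∈ Set.Icc (mc β) m₁, field β m + hc β ≤ Q * (m - mc β) ^ 2 := by
    have hmono : MonotoneOn (fun m => Q * (m - mc β) ^ 2 - field β m) (Set.Icc (mc β) m₁) := by
      have hd : ∀ m ∈ Set.Icc (mc β) m₁, HasDerivAt (fun m => Q * (m - mc β) ^ 2 - field β m)
          (Q * (2 * (m - mc β)) - (m ^ 2 - mc β ^ 2) / (1 - m ^ 2)) m := by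
        intro m hm
        have := hasDerivAt_field hβ (m := m) ⟨by linarith [hm.1], by linarith [hm.2, h1.2]⟩
        rw [← mc_eq hβ] at this
        refine (((((hasDerivAt_id m).sub_const (mc β)).pow 2).const_mul Q).sub this).congr_deriv ?_
        simp
      refine monotoneOn_of_hasDerivWithinAt_nonneg (convex_Icc _ _)
        (fun m hm => (hd m hm).continuousAt.continuousWithinAt)
        (fun m hm => (hd m (interior_subset hm)).hasDerivWithinAt) fun m hm => ?_
      have hm' := interior_subset hm
      have h3 : 0 < 1 - m ^ 2 := by nlinarith [hm'.1, hm'.2, h1.2]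
      have h4 : 1 / (1 - m ^ 2) ≤ Q := one_div_le_one_div_of_le hm1lt (by nlinarith [hm'.1, hm'.2])
      have h5 : (m ^ 2 - mc β ^ 2) / (1 - m ^ 2) = (m - mc β) * (m + mc β) * (1 / (1 - m ^ 2)) := by
        field_simp; ring
      have h6 : 0 < 1 / (1 - m ^ 2) := by positivity
      rw [h5]
      have h7 : 0 ≤ m - mc β := by linarith [hm'.1]
      have h8 : m + mc β ≤ 2 := by linarith [hm'.2, h1.2, mc_lt_one hβ]
      calc 0 ≤ 2 * (m - mc β) * (Q - 1 / (1 - m ^ 2)) +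
            (m - mc β) * (2 - (m + mc β)) * (1 / (1 - m ^ 2)) := by
              have : 0 ≤ 2 - (m + mc β) := by linarith
              have : 0 ≤ Q - 1 / (1 - m ^ 2) := by linarith
              positivity
        _ = _ := by ring
    intro m hm
    have := hmono (Set.left_mem_Icc.2 h1.1) hm hm.1
    have h9 : field β (mc β) = -hc β := by rw [mc_eq hβ, hc_eq hβ]; ring
    simp only [sub_self] at this
    rw [h9] at this
    nlinarith
  -- On the branch `field` + h_c equals h_c(1 - cos r) ≥ 2h_c r²/π², and this must be at most Q(M -
  -- m_c)²; κ solves the resulting inequality.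
  set κ := √(2 * hc β / (Real.pi ^ 2 * Q)) with hκ
  have hκ2 : κ ^ 2 = 2 * hc β / (Real.pi ^ 2 * Q) := Real.sq_sqrt (by positivity)
  refine ⟨κ, Real.sqrt_pos.2 (by positivity), fun r hr => ?_⟩
  have hb := branch_mem hβ r
  have hcos : 0 ≤ Real.cos r := Real.cos_nonneg_of_neg_pi_div_two_le_of_le
    (by linarith [neg_abs_le r]) (by linarith [le_abs_self r])
  have hb1 : branch β r ≤ m₁ :=
    (strictMonoOn_mPlus hβ).monotoneOn (neg_hc_le hβ r) (by simp [hcp.le]) (by nlinarith)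
  have hq := hquad _ ⟨hb.1, hb1⟩
  rw [field_branch hβ] at hq
  have hcq : Real.cos r ≤ 1 - 2 / Real.pi ^ 2 * r ^ 2 :=
    Real.cos_le_one_sub_mul_cos_sq (by linarith [Real.pi_pos])
  refine abs_le_of_sq_le_sq' ?_ (by linarith [hb.1]) |>.2
  rw [mul_pow, hκ2, sq_abs]
  have h10 : hc β * (2 / Real.pi ^ 2 * r ^ 2) ≤ Q * (branch β r - mc β) ^ 2 := by nlinarith
  have h11 : 2 * hc β / (Real.pi ^ 2 * Q) * r ^ 2 = hc β * (2 / Real.pi ^ 2 * r ^ 2) / Q := by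
    field_simp
  rw [h11, div_le_iff₀ hQ0]
  linarith

/-- The speed of the upper branch. -/
noncomputable def branchSpeed (β r : ℝ) : ℝ :=
  (1 - branch β r ^ 2) / (branch β r ^ 2 - mc β ^ 2) * (hc β * Real.sin r)

lemma hasDerivAt_branch (hβ : 1 < β) {r : ℝ} (hr : Real.cos r ≠ 1) :
    HasDerivAt (branch β) (branchSpeed β r) r := by
  have hcp := hc_pos hβ
  have hlt : -hc β < -hc β * Real.cos r := by
    have : Real.cos r < 1 := lt_of_le_of_ne (Real.cos_le_one r) hr
    nlinarith
  have h1 := hasDerivAt_mPlus hβ hlt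
  have h2 : HasDerivAt (fun r => -hc β * Real.cos r) (hc β * Real.sin r) r :=
    ((Real.hasDerivAt_cos r).const_mul (-hc β)).congr_deriv (by ring)
  rw [← mc_eq hβ] at h1
  exact HasDerivAt.comp r h1 h2

lemma cos_ne_one {r : ℝ} (hr0 : r ≠ 0) (hr : |r| ≤ Real.pi / 2) : Real.cos r ≠ 1 := by
  intro h
  refine hr0 ((Real.cos_eq_one_iff_of_lt_of_lt ?_ ?_).1 h) <;>
    linarith [neg_abs_le r, le_abs_self r, Real.pi_pos]

/-- The numerator carries sin r = O(|r|) and the denominator is at least of order |r|. The branch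
has a kink at r = 0, but its speed stays bounded on either side. -/
lemma exists_abs_branchSpeed_le (hβ : 1 < β) :
    ∃ C : ℝ, 0 < C ∧ ∀ r : ℝ, r ≠ 0 → |r| ≤ Real.pi / 2 → |branchSpeed β r| ≤ C := by
  obtain ⟨κ, hκ, hlow⟩ := exists_mul_abs_le_branch_sub hβ
  have hcp := hc_pos hβ
  have hmp := mc_pos hβ
  refine ⟨hc β / (κ * mc β), by positivity, fun r hr0 hr => ?_⟩
  have hr' := abs_pos.2 hr0
  have hb := branch_mem hβ r
  have h1 := hlow r hr
  have h2 : 0 < branch β r ^ 2 - mc β ^ 2 := by nlinarith [mul_pos hκ hr']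
  have h3 : 0 ≤ 1 - branch β r ^ 2 := by nlinarith [hb.1, hb.2]
  unfold branchSpeed
  rw [abs_mul, abs_of_nonneg (div_nonneg h3 h2.le), abs_mul, abs_of_pos hcp]
  have hsin : |Real.sin r| ≤ |r| := Real.abs_sin_le_abs
  rw [div_mul_eq_mul_div, div_le_div_iff₀ h2 (by positivity)]
  have h4 : κ * |r| * mc β ≤ branch β r ^ 2 - mc β ^ 2 := by nlinarith [mul_pos hκ hr']
  calc (1 - branch β r ^ 2) * (hc β * |Real.sin r|) * (κ * mc β)
      ≤ 1 * (hc β * |r|) * (κ * mc β) := by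
        gcongr
        nlinarith [sq_nonneg (branch β r)]
    _ = hc β * (κ * |r| * mc β) := by ring
    _ ≤ _ := by gcongr

/-- The mean field drift contracts towards the upper branch. -/
lemma exists_drift_contraction (hβ : 1 < β) :
    ∃ ρ δ : ℝ, 0 < ρ ∧ 0 < δ ∧ ∀ r : ℝ, |r| ≤ Real.pi / 2 → ∀ w : ℝ, -(δ * |r|) ≤ w →
      w * (Real.tanh (β * (branch β r + w + -hc β * Real.cos r)) - (branch β r + w)) ≤
        -(ρ * |r| * w ^ 2) := by
  obtain ⟨κ, hκ, hlow⟩ := exists_mul_abs_le_branch_sub hβ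
  have hmp := mc_pos hβ
  have hβ0 : 0 < β := by linarith
  have hβm := beta_mul_one_sub_mc_sq hβ
  -- The tanh is β-Lipschitz, so for w ≥ -δ|r| with βδ = κ/2 it stays above m_c + κ|r|/2. Because
  -- β(1 - m_c²) = 1, the slope β(1 - tanh²) - 1 of the drift is then at most -βκm_c|r|.
  refine ⟨β * κ * mc β, κ / (2 * β), by positivity, by positivity, fun r hr w hw => ?_⟩
  have hr0 := abs_nonneg r
  set M := branch β r with hM
  set h := -hc β * Real.cos r with hh
  set δ := κ / (2 * β) with hδ
  set ρ := β * κ * mc β with hρ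
  have hβδ : β * δ = κ / 2 := by rw [hδ]; field_simp
  have hMlow := hlow r hr
  have htM : Real.tanh (β * (M + h)) = M := tanh_branch hβ r
  have hT : ∀ x, HasDerivAt (fun x => Real.tanh (β * (x + h)))
      ((1 - Real.tanh (β * (x + h)) ^ 2) * β) x := fun x =>
    ((hasDerivAt_tanh _).comp x (((hasDerivAt_id x).add_const h).const_mul β)).congr_deriv (by simp)
  have hmono : Monotone fun x => Real.tanh (β * (x + h)) := by
    refine monotone_of_hasDerivAt_nonneg (f' := fun x => (1 - Real.tanh (β * (x + h)) ^ 2) * β)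
      hT fun x => ?_
    have := Real.abs_tanh_lt_one (β * (x + h))
    have h2 : Real.tanh (β * (x + h)) ^ 2 < 1 := (sq_lt_one_iff_abs_lt_one _).2 this
    have : 0 < 1 - Real.tanh (β * (x + h)) ^ 2 := by linarith
    exact (mul_pos this hβ0).le
  have hlip : Antitone fun x => Real.tanh (β * (x + h)) - β * x := by
    refine antitone_of_hasDerivAt_nonpos
      (f' := fun x => (1 - Real.tanh (β * (x + h)) ^ 2) * β - β * 1)
      (fun x => (hT x).sub ((hasDerivAt_id x).const_mul β)) fun x => ?_
    simp only [Pi.zero_apply]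
    nlinarith [sq_nonneg (Real.tanh (β * (x + h)))]
  have htlow : ∀ x, M - δ * |r| ≤ x → mc β + κ / 2 * |r| ≤ Real.tanh (β * (x + h)) := by
    intro x hx
    have h1 := hmono hx
    have h2 := hlip (show M - δ * |r| ≤ M by nlinarith [mul_nonneg (by positivity : 0 ≤ δ) hr0])
    simp only at h1 h2
    rw [htM] at h2
    nlinarith
  have hanti : AntitoneOn (fun x => Real.tanh (β * (x + h)) - x + ρ * |r| * x)
      (Set.Ici (M - δ * |r|)) := by
    have hd : ∀ x, HasDerivAt (fun x => Real.tanh (β * (x + h)) - x + ρ * |r| * x)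
        ((1 - Real.tanh (β * (x + h)) ^ 2) * β - 1 + ρ * |r| * 1) x := fun x =>
      ((hT x).sub (hasDerivAt_id x)).add ((hasDerivAt_id x).const_mul _)
    refine antitoneOn_of_hasDerivWithinAt_nonpos (convex_Ici _)
      (fun x _ => (hd x).continuousAt.continuousWithinAt)
      (fun x _ => (hd x).hasDerivWithinAt) fun x hx => ?_
    have h1 := htlow x (interior_subset hx)
    have h2 : 0 ≤ κ / 2 * |r| := by positivity
    have h3 : (mc β + κ / 2 * |r|) ^ 2 ≤ Real.tanh (β * (x + h)) ^ 2 := by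
      gcongr
    have h4 : mc β ^ 2 + κ * mc β * |r| ≤ Real.tanh (β * (x + h)) ^ 2 := by nlinarith
    rw [hρ]
    nlinarith
  have hMmem : M ∈ Set.Ici (M - δ * |r|) := by
    simp only [Set.mem_Ici]; nlinarith [mul_nonneg (by positivity : 0 ≤ δ) hr0]
  have hwmem : M + w ∈ Set.Ici (M - δ * |r|) := by
    simp only [Set.mem_Ici]; linarith
  rcases le_total 0 w with h0 | h0
  · have := hanti hMmem hwmem (by linarith)
    simp only [htM] at this
    nlinarith
  · have := hanti hwmem hMmem (by linarith)
    simp only [htM] at this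
    nlinarith

lemma tendsto_branch (hβ : 1 < β) : Tendsto (branch β) (𝓝[≠] 0) (𝓝[>] (mc β)) := by
  have hcp := hc_pos hβ
  refine tendsto_nhdsWithin_iff.2 ⟨?_, ?_⟩
  · have h1 := (continuousWithinAt_mPlus hβ (h := -hc β) le_rfl).tendsto
    have h2 : Tendsto (fun r => -hc β * Real.cos r) (𝓝[≠] 0) (𝓝[Set.Ici (-hc β)] (-hc β)) := by
      refine tendsto_nhdsWithin_iff.2 ⟨?_, Eventually.of_forall fun r => neg_hc_le hβ r⟩
      have h3 : Continuous fun r => -hc β * Real.cos r := by fun_prop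
      have := (h3.tendsto 0).mono_left (nhdsWithin_le_nhds (s := {0}ᶜ))
      simpa using this
    exact h1.comp h2
  · have hpi : (0 : ℝ) < Real.pi / 2 := by positivity
    filter_upwards [self_mem_nhdsWithin, mem_nhdsWithin_of_mem_nhds
      (Icc_mem_nhds (by linarith : -(Real.pi / 2) < (0 : ℝ)) hpi)] with r hr0 hr
    obtain ⟨κ, hκ, hlow⟩ := exists_mul_abs_le_branch_sub hβ
    have h1 := hlow r (abs_le.2 ⟨hr.1, hr.2⟩)
    have h2 := mul_pos hκ (abs_pos.2 hr0)
    simp only [Set.mem_Ioi]; linarith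

/-- L'Hôpital: the numerator has derivative (m - m_c)(m + m_c)/(1 - m²), and β(1 - m_c²) = 1
simplifies the limit. -/
lemma tendsto_field_add_hc_div_sq (hβ : 1 < β) :
    Tendsto (fun m => (field β m + hc β) / (m - mc β) ^ 2) (𝓝[>] (mc β)) (𝓝 (β * mc β)) := by
  have hmp := mc_pos hβ
  have hml := mc_lt_one hβ
  have hIoo : Set.Ioo (mc β) 1 ∈ 𝓝[>] (mc β) := Ioo_mem_nhdsGT hml
  have hβm := beta_mul_one_sub_mc_sq hβ
  have h9 : field β (mc β) = -hc β := by rw [mc_eq hβ, hc_eq hβ]; ring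
  refine HasDerivAt.lhopital_zero_nhdsGT
    (f' := fun m => (m ^ 2 - mc β ^ 2) / (1 - m ^ 2)) (g' := fun m => 2 * (m - mc β)) ?_ ?_ ?_ ?_ ?_ ?_
  · filter_upwards [hIoo] with m hm
    have := hasDerivAt_field hβ (m := m) ⟨by linarith [hm.1], hm.2⟩
    rw [← mc_eq hβ] at this
    exact this.add_const _
  · refine Eventually.of_forall fun m => ?_
    refine (((hasDerivAt_id m).sub_const (mc β)).pow 2).congr_deriv ?_
    simp
  · filter_upwards [hIoo] with m hm
    have := hm.1
    exact (mul_pos two_pos (by linarith)).ne'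
  · have h1 := (hasDerivAt_field hβ (m := mc β) ⟨by linarith, hml⟩).continuousAt.add_const (hc β)
    have h2 := h1.tendsto.mono_left (nhdsWithin_le_nhds (s := Set.Ioi (mc β)))
    simpa [h9] using h2
  · have h1 : Continuous fun m : ℝ => (m - mc β) ^ 2 := by fun_prop
    have := (h1.tendsto (mc β)).mono_left (nhdsWithin_le_nhds (s := Set.Ioi (mc β)))
    simpa using this
  · have h1 : ContinuousAt (fun m : ℝ => (m + mc β) / (2 * (1 - m ^ 2))) (mc β) := by
      refine ContinuousAt.div (by fun_prop) (by fun_prop) ?_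
      have : 0 < 1 - mc β ^ 2 := by nlinarith
      positivity
    have h2 := h1.tendsto.mono_left (nhdsWithin_le_nhds (s := Set.Ioi (mc β)))
    have h3 : (mc β + mc β) / (2 * (1 - mc β ^ 2)) = β * mc β := by
      have h4 : 1 - mc β ^ 2 ≠ 0 := by intro h0; rw [h0] at hβm; simp at hβm
      rw [div_eq_iff (by positivity)]
      linear_combination (-2 * mc β) * hβm
    rw [h3] at h2
    refine h2.congr' ?_
    filter_upwards [hIoo] with m hm
    have h5 : m - mc β ≠ 0 := by have := hm.1; exact (by linarith : 0 < m - mc β).ne'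
    have h6 : 1 - m ^ 2 ≠ 0 := by
      have := hm.1; have := hm.2
      exact (by nlinarith : 0 < 1 - m ^ 2).ne'
    field_simp
    ring

lemma tendsto_one_sub_cos_div_sq :
    Tendsto (fun r : ℝ => (1 - Real.cos r) / r ^ 2) (𝓝[≠] 0) (𝓝 (1 / 2)) := by
  have h1 : Tendsto (fun r : ℝ => r ^ 2 * (5 / 96)) (𝓝[≠] 0) (𝓝 0) := by
    have h1 : Continuous fun r : ℝ => r ^ 2 * (5 / 96) := by fun_prop
    have := (h1.tendsto 0).mono_left (nhdsWithin_le_nhds (s := {0}ᶜ))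
    simpa using this
  rw [tendsto_iff_norm_sub_tendsto_zero]
  refine squeeze_zero' (Eventually.of_forall fun r => norm_nonneg _) ?_ h1
  filter_upwards [self_mem_nhdsWithin, mem_nhdsWithin_of_mem_nhds
    (Icc_mem_nhds (by norm_num : (-1 : ℝ) < 0) (by norm_num : (0 : ℝ) < 1))] with r hr0 hr
  have hr0' : r ≠ 0 := hr0
  have h2 := Real.cos_bound (x := r) (abs_le.2 ⟨hr.1, hr.2⟩)
  have h3 : (1 - Real.cos r) / r ^ 2 - 1 / 2 = -(Real.cos r - (1 - r ^ 2 / 2)) / r ^ 2 := by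
    field_simp; ring
  rw [h3, Real.norm_eq_abs, abs_div, abs_neg, abs_of_pos (by positivity : 0 < r ^ 2),
    div_le_iff₀ (by positivity)]
  calc _ ≤ |r| ^ 4 * (5 / 96) := h2
    _ = r ^ 2 * (5 / 96) * r ^ 2 := by
      rw [show |r| ^ 4 = (|r| ^ 2) ^ 2 by ring, sq_abs]; ring

/-- The slope of the upper branch at the critical point. -/
lemma tendsto_branch_sub_div (hβ : 1 < β) :
    Tendsto (fun r => (branch β r - mc β) / |r|) (𝓝[≠] 0) (𝓝 √(hc β / (2 * β * mc β))) := by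
  have hcp := hc_pos hβ
  have hmp := mc_pos hβ
  have h1 := (tendsto_field_add_hc_div_sq hβ).comp (tendsto_branch hβ)
  -- On the branch `field` + h_c equals h_c(1 - cos r), so the quotient of the two quadratic
  -- asymptotics is the square of the slope.
  have h2 := (tendsto_one_sub_cos_div_sq.const_mul (hc β)).div h1 (by positivity)
  have h3 := (Real.continuous_sqrt.tendsto _).comp h2
  have h4 : hc β * (1 / 2) / (β * mc β) = hc β / (2 * β * mc β) := by field_simp
  rw [h4] at h3
  refine h3.congr' ?_
  have hgt : ∀ᶠ r in 𝓝[≠] (0 : ℝ), mc β < branch β r :=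
    (tendsto_branch hβ).eventually self_mem_nhdsWithin
  filter_upwards [self_mem_nhdsWithin, hgt, tendsto_one_sub_cos_div_sq.eventually
    (lt_mem_nhds (by norm_num : (0 : ℝ) < 1 / 2))] with r hr0 hr hcos
  have hr0' : r ≠ 0 := hr0
  have hpos : 0 < branch β r - mc β := by linarith
  have hc1 : 0 < 1 - Real.cos r := by
    by_contra! hle
    have : (1 - Real.cos r) / r ^ 2 ≤ 0 := div_nonpos_of_nonpos_of_nonneg hle (by positivity)
    linarith
  simp only [Function.comp, field_branch hβ, Pi.div_apply]
  rw [show -hc β * Real.cos r + hc β = hc β * (1 - Real.cos r) by ring]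
  have h5 : hc β * ((1 - Real.cos r) / r ^ 2) /
      (hc β * (1 - Real.cos r) / (branch β r - mc β) ^ 2) = ((branch β r - mc β) / |r|) ^ 2 := by
    rw [div_pow, sq_abs]; field_simp
  rw [h5, Real.sqrt_sq (by positivity)]

end Branch

/-! ### Jump rates, drift and total rate of the finite system. -/

section Rates

variable {β : ℝ} {N : ℕ}

lemma exp_div_exp_add_exp (x : ℝ) :
    Real.exp x / (Real.exp (-x) + Real.exp x) = (1 + Real.tanh x) / 2 := by
  have h : Real.exp x + Real.exp (-x) ≠ 0 := by positivity
  have h' : Real.exp (-x) + Real.exp x ≠ 0 := by positivity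
  rw [Real.tanh_eq]
  field_simp
  ring

lemma exp_neg_div_exp_add_exp (x : ℝ) :
    Real.exp (-x) / (Real.exp (-x) + Real.exp x) = (1 - Real.tanh x) / 2 := by
  have := exp_div_exp_add_exp (-x)
  rw [neg_neg, add_comm, Real.tanh_neg] at this
  rw [this]; ring

lemma ratePlus_eq (m h : ℝ) : ratePlus β N m h =
    N / 4 * (1 - m) * (1 + Real.tanh (β * (h + (m + 1 / N)))) := by
  unfold ratePlus
  rw [exp_div_exp_add_exp]; ring

lemma rateMinus_eq (m h : ℝ) : rateMinus β N m h =
    N / 4 * (1 + m) * (1 - Real.tanh (β * (h + (m - 1 / N)))) := by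
  unfold rateMinus
  rw [exp_neg_div_exp_add_exp]; ring

lemma abs_tanh_sub_tanh_le (x y : ℝ) : |Real.tanh x - Real.tanh y| ≤ |x - y| := by
  have h : ∀ z : ℝ, ‖1 - Real.tanh z ^ 2‖ ≤ 1 := fun z => by
    have h2 : Real.tanh z ^ 2 < 1 := (sq_lt_one_iff_abs_lt_one _).2 (Real.abs_tanh_lt_one z)
    rw [Real.norm_of_nonneg (by linarith)]
    linarith [sq_nonneg (Real.tanh z)]
  have := convex_univ.norm_image_sub_le_of_norm_hasDerivWithin_le (f := Real.tanh)
    (fun z _ => (hasDerivAt_tanh z).hasDerivWithinAt) (fun z _ => h z)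
    (Set.mem_univ y) (Set.mem_univ x)
  simpa using this

lemma rate_add_le {m : ℝ} (h : ℝ) (hm : m ∈ Set.Icc (-1 : ℝ) 1) :
    ratePlus β N m h + rateMinus β N m h ≤ N := by
  rw [ratePlus_eq, rateMinus_eq]
  have h1 := Real.tanh_lt_one (β * (h + (m + 1 / N)))
  have h2 := Real.neg_one_lt_tanh (β * (h + (m - 1 / N)))
  have h3 : (0 : ℝ) ≤ N := Nat.cast_nonneg N
  have h4 : 0 ≤ 1 - m := by linarith [hm.2]
  have h5 : 0 ≤ 1 + m := by linarith [hm.1]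
  have h6 : (N : ℝ) / 4 * (1 - m) * (1 + Real.tanh (β * (h + (m + 1 / N)))) ≤
      N / 4 * (1 - m) * 2 := by gcongr; linarith
  have h7 : (N : ℝ) / 4 * (1 + m) * (1 - Real.tanh (β * (h + (m - 1 / N)))) ≤
      N / 4 * (1 + m) * 2 := by gcongr; linarith
  linarith

lemma abs_tanh_shift_le (hβ : 0 ≤ β) (m h : ℝ) :
    |Real.tanh (β * (h + (m + 1 / N))) - Real.tanh (β * (m + h))| ≤ β / N ∧
    |Real.tanh (β * (h + (m - 1 / N))) - Real.tanh (β * (m + h))| ≤ β / N := by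
  have hN : 0 ≤ β / N := by positivity
  constructor
  · refine (abs_tanh_sub_tanh_le _ _).trans ?_
    rw [show β * (h + (m + 1 / (N : ℝ))) - β * (m + h) = β / N by ring, abs_of_nonneg hN]
  · refine (abs_tanh_sub_tanh_le _ _).trans ?_
    rw [show β * (h + (m - 1 / (N : ℝ))) - β * (m + h) = -(β / N) by ring, abs_neg,
      abs_of_nonneg hN]

/-- The rates differ from their mean field values only by the shift ±1/N in the argument, which
costs β/N. -/
lemma abs_drift_sub_le (hβ : 0 ≤ β) (hN : 1 ≤ N) {m : ℝ} (h : ℝ) (hm : m ∈ Set.Icc (-1 : ℝ) 1) :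
    |2 / N * (ratePlus β N m h - rateMinus β N m h) - (Real.tanh (β * (m + h)) - m)| ≤ β / N := by
  obtain ⟨h1, h2⟩ := abs_tanh_shift_le (N := N) hβ m h
  have hN' : (N : ℝ) ≠ 0 := by positivity
  rw [ratePlus_eq, rateMinus_eq]
  set a := Real.tanh (β * (h + (m + 1 / N)))
  set b := Real.tanh (β * (h + (m - 1 / N)))
  set c := Real.tanh (β * (m + h))
  have h3 : 2 / N * (N / 4 * (1 - m) * (1 + a) - N / 4 * (1 + m) * (1 - b)) - (c - m) =
      (1 - m) / 2 * (a - c) + (1 + m) / 2 * (b - c) := by field_simp; ring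
  rw [h3, abs_le]
  rw [abs_le] at h1 h2
  constructor <;> nlinarith [hm.1, hm.2]

lemma abs_rate_add_sub_le (hβ : 0 ≤ β) (hN : 1 ≤ N) {m : ℝ} (h : ℝ)
    (hm : m ∈ Set.Icc (-1 : ℝ) 1) :
    |(ratePlus β N m h + rateMinus β N m h) / N - (1 - m * Real.tanh (β * (m + h))) / 2| ≤
      β / N := by
  obtain ⟨h1, h2⟩ := abs_tanh_shift_le (N := N) hβ m h
  have hN' : (N : ℝ) ≠ 0 := by positivity
  rw [ratePlus_eq, rateMinus_eq]
  set a := Real.tanh (β * (h + (m + 1 / N)))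
  set b := Real.tanh (β * (h + (m - 1 / N)))
  set c := Real.tanh (β * (m + h))
  have h3 : (N / 4 * (1 - m) * (1 + a) + N / 4 * (1 + m) * (1 - b)) / N - (1 - m * c) / 2 =
      (1 - m) / 4 * (a - c) - (1 + m) / 4 * (b - c) := by field_simp; ring
  rw [h3, abs_le]
  rw [abs_le] at h1 h2
  constructor <;> nlinarith [hm.1, hm.2]

lemma grid_mem (hN : 1 ≤ N) {k : ℕ} (hk : k ∈ Finset.range (N + 1)) :
    grid N k ∈ Set.Icc (-1 : ℝ) 1 := ⟨neg_one_le_grid hN k, grid_le_one hN hk⟩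

lemma hN_eq {n : ℝ} (hn : 0 < n) (hnN : n ^ 3 = N) (t : ℝ) :
    hN β N t = -hc β * Real.cos (t / n ^ 2) := by
  unfold hN
  rw [← hnN, ← Real.rpow_natCast n 3, ← Real.rpow_mul hn.le]
  norm_num
  left
  congr 1
  rw [div_eq_inv_mul]

lemma mPlus_hN_eq {n : ℝ} (hn : 0 < n) (hnN : n ^ 3 = N) (t : ℝ) :
    mPlus β (hN β N t) = branch β (t / n ^ 2) := by
  rw [hN_eq hn hnN]; rfl

/-- Contraction of the drift of the finite system towards the upper branch. -/
lemma exists_mul_drift_le (hβ : 1 < β) : ∃ ρ δ : ℝ, 0 < ρ ∧ 0 < δ ∧ δ ≤ 1 ∧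
    ∀ N : ℕ, 1 ≤ N → ∀ r : ℝ, |r| ≤ Real.pi / 2 → ∀ m ∈ Set.Icc (-1 : ℝ) 1,
      -(δ * |r|) ≤ m - branch β r →
      (m - branch β r) * (2 / N * (ratePlus β N m (-hc β * Real.cos r) -
        rateMinus β N m (-hc β * Real.cos r))) ≤
        -(ρ * |r| * (m - branch β r) ^ 2) + |m - branch β r| * (β / N) := by
  obtain ⟨ρ, δ, hρ, hδ, hcon⟩ := exists_drift_contraction hβ
  refine ⟨ρ, min δ 1, hρ, by positivity, min_le_right _ _, fun N hN r hr m hm hw => ?_⟩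
  have hδr : min δ 1 * |r| ≤ δ * |r| := by gcongr; exact min_le_left _ _
  have h1 := hcon r hr (m - branch β r) (by linarith)
  rw [add_sub_cancel] at h1
  have h2 := abs_drift_sub_le (β := β) (by linarith) hN (-hc β * Real.cos r) hm
  set d := 2 / N * (ratePlus β N m (-hc β * Real.cos r) - rateMinus β N m (-hc β * Real.cos r))
  set w := m - branch β r
  set τ := Real.tanh (β * (m + -hc β * Real.cos r)) - m
  have h3 : w * (d - τ) ≤ |w| * (β / N) := by
    refine (le_abs_self _).trans ?_
    rw [abs_mul]
    gcongr
  linarith [mul_sub w d τ]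

end Rates

/-! ### The quadratic barrier, away from the critical time. -/

section Barriers

variable {β : ℝ}

lemma two_mul_le_of_pos {c : ℝ} (hc : 0 < c) (x y : ℝ) : 2 * x * y ≤ c * x ^ 2 + y ^ 2 / c := by
  have h : c * x ^ 2 + y ^ 2 / c - 2 * x * y = (c * x - y) ^ 2 / c := by field_simp; ring
  have : 0 ≤ (c * x - y) ^ 2 / c := by positivity
  linarith

/-- The contraction supplies -2ρw². Young's inequality spends ρ/2 on the motion of the branch and
ρ/2 on the lattice error of the drift, and ρ is left for the growth rate `l`. The remainder is
O(1/N), like the jump noise. -/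
lemma macroscopic_generator_bound {ρ C₁ n N w M' cp cm l : ℝ} (hρ0 : 0 < ρ) (hn : 1 ≤ n)
    (hnN : n ^ 3 = N) (hsp : |M'| ≤ C₁) (hsum : cp + cm ≤ N) (hlρ : l ≤ ρ)
    (hD : w * (2 / N * (cp - cm)) ≤ -(ρ * w ^ 2) + |w| * (β / N)) :
    2 * w * (-(M' * (1 / n ^ 2))) + w ^ 2 * l + 2 * (w * (2 / N * (cp - cm))) +
      4 / N ^ 2 * (cp + cm) ≤ (2 * C₁ ^ 2 / ρ + 2 * β ^ 2 / ρ + 4) / N := by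
  have hn0 : 0 < n := by linarith
  have hN1 : 1 ≤ N := by rw [← hnN]; exact one_le_pow₀ hn
  have hN0 : 0 < N := by linarith
  have a1 : 2 * w * (-(M' * (1 / n ^ 2))) ≤ ρ / 2 * w ^ 2 + 2 * C₁ ^ 2 / ρ / N := by
    have b1 := two_mul_le_of_pos (half_pos hρ0) w (-(M' * (1 / n ^ 2)))
    have b2 : (-(M' * (1 / n ^ 2))) ^ 2 ≤ C₁ ^ 2 / N := by
      have b3 : M' ^ 2 ≤ C₁ ^ 2 := by rw [← sq_abs M']; gcongr
      have b4 : (1 / n ^ 2) ^ 2 ≤ 1 / N := by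
        rw [← hnN, div_pow, one_pow]
        refine one_div_le_one_div_of_le (by positivity) ?_
        nlinarith [pow_pos hn0 3]
      calc (-(M' * (1 / n ^ 2))) ^ 2 = M' ^ 2 * (1 / n ^ 2) ^ 2 := by ring
        _ ≤ C₁ ^ 2 * (1 / N) := by gcongr
        _ = _ := by ring
    have b5 : (-(M' * (1 / n ^ 2))) ^ 2 / (ρ / 2) ≤ 2 * C₁ ^ 2 / ρ / N := by
      calc _ ≤ C₁ ^ 2 / N / (ρ / 2) := by gcongr
        _ = _ := by field_simp
    linarith
  have a2 : 2 * (|w| * (β / N)) ≤ ρ / 2 * w ^ 2 + 2 * β ^ 2 / ρ / N := by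
    have b1 := two_mul_le_of_pos (half_pos hρ0) |w| (β / N)
    rw [sq_abs] at b1
    have b2 : (β / N) ^ 2 / (ρ / 2) ≤ 2 * β ^ 2 / ρ / N := by
      calc (β / N) ^ 2 / (ρ / 2) = 2 * β ^ 2 / ρ / N * (1 / N) := by field_simp
        _ ≤ 2 * β ^ 2 / ρ / N * 1 := by
          gcongr; rw [div_le_one hN0]; exact hN1
        _ = _ := mul_one _
    linarith
  have a3 : 4 / N ^ 2 * (cp + cm) ≤ 4 / N := by
    calc 4 / N ^ 2 * (cp + cm) ≤ 4 / N ^ 2 * N := by gcongr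
      _ = 4 / N := by field_simp
  have a5 : w ^ 2 * l ≤ ρ * w ^ 2 := by nlinarith [sq_nonneg w]
  have a6 : (2 * C₁ ^ 2 / ρ + 2 * β ^ 2 / ρ + 4) / N =
    2 * C₁ ^ 2 / ρ / N + 2 * β ^ 2 / ρ / N + 4 / N := by ring
  linarith

open Classical in
/-- Away from the critical time the magnetization stays close to the upper branch, and the
distance contracts exponentially. -/
theorem exists_macroscopic_contraction (hβ : 1 < β) {η : ℝ} (hη : 0 < η) :
    ∃ ρ δ C : ℝ, 0 < ρ ∧ 0 < δ ∧ 0 < C ∧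
    ∀ (N : ℕ) (n : ℝ), 1 ≤ N → 1 ≤ n → n ^ 3 = N → ∀ (s e Λ : ℝ) (p : ℝ → ℕ → ℝ), s ≤ e →
    (∀ t ∈ Set.Icc s e, η ≤ |t / n ^ 2| ∧ |t / n ^ 2| ≤ Real.pi / 2) → IsFlow β N s e Λ p →
    ∀ l d ω : ℝ, 0 ≤ l → l ≤ ρ → 0 < d → d ≤ δ → 0 ≤ ω →
    ∑ k ∈ Finset.range (N + 1), (if grid N k ∈ {m | d ^ 2 ≤ (m - branch β (e / n ^ 2)) ^ 2 *
        Real.exp (l * (e - s))} then p e k else 0) ≤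
      2 * (∑ k ∈ Finset.range (N + 1), (if grid N k ∈ {m | ω < |m - branch β (s / n ^ 2)|}
        then p s k else 0) +
        Λ * (ω ^ 2 / d ^ 2 + C * Real.exp (l * (e - s)) * (e - s) / (N * d ^ 2))) := by
  obtain ⟨ρ₀, δ₀, hρ₀, hδ₀, -, hdrift⟩ := exists_mul_drift_le hβ
  obtain ⟨C₁, hC₁, hspeed⟩ := exists_abs_branchSpeed_le hβ
  set ρ := ρ₀ * η with hρ
  have hρ0 : 0 < ρ := by positivity
  refine ⟨ρ, δ₀ * η, 2 * C₁ ^ 2 / ρ + 2 * β ^ 2 / ρ + 4, hρ0, by positivity,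
    by positivity, ?_⟩
  set C := 2 * C₁ ^ 2 / ρ + 2 * β ^ 2 / ρ + 4 with hC
  intro N n hN hn hnN s e Λ p hse hr hp l d ω hl hlρ hd hdδ hω
  have hn0 : 0 < n := by linarith
  have hN0 : (0 : ℝ) < N := by positivity
  have hd2 : 0 < d ^ 2 := by positivity
  have hCpos : 0 < C := by positivity
  have key := hp.mass_barrier_le hN hse
    (G := fun t m => (m - branch β (t / n ^ 2)) ^ 2 * Real.exp (l * (t - s)) / d ^ 2)
    (G' := fun t m => (2 * (m - branch β (t / n ^ 2)) * (-(branchSpeed β (t / n ^ 2) * (1 / n ^ 2))) *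
      Real.exp (l * (t - s)) + (m - branch β (t / n ^ 2)) ^ 2 * (Real.exp (l * (t - s)) * l)) / d ^ 2)
    (S := fun t => C * Real.exp (l * (e - s)) / (N * d ^ 2) * t)
    (S' := fun _ => C * Real.exp (l * (e - s)) / (N * d ^ 2))
    ?_ (fun t m => by positivity) (fun t _ => hasDerivAt_const_mul _)
    (fun t _ => by positivity) ?_
    (D := {m | d ^ 2 ≤ (m - branch β (e / n ^ 2)) ^ 2 * Real.exp (l * (e - s))})
    (D₀ := {m | ω < |m - branch β (s / n ^ 2)|}) ?_ (g := ω ^ 2 / d ^ 2) ?_ (by positivity)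
  · refine key.trans (le_of_eq ?_)
    congr 3
    ring
  · intro t ht k _
    obtain ⟨h1, h2⟩ := hr t ht
    have hr0 : t / n ^ 2 ≠ 0 := by
      intro h0; rw [h0, abs_zero] at h1; linarith
    have h3 : HasDerivAt (fun t : ℝ => t / n ^ 2) (1 / n ^ 2) t := (hasDerivAt_id t).div_const _
    have h4 := (hasDerivAt_branch hβ (cos_ne_one hr0 h2)).comp t h3
    have h5 : HasDerivAt (fun t => Real.exp (l * (t - s))) (Real.exp (l * (t - s)) * l) t := by
      simpa using (((hasDerivAt_id t).sub_const s).const_mul l).exp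
    refine ((((h4.const_sub (grid N k)).pow 2).mul h5).div_const (d ^ 2)).congr_deriv ?_
    simp [Function.comp]
  · intro t ht k hk hlt
    obtain ⟨h1, h2⟩ := hr t ht
    have hr0 : t / n ^ 2 ≠ 0 := by
      intro h0; rw [h0, abs_zero] at h1; linarith
    have hm := grid_mem hN hk
    set m := grid N k
    set r := t / n ^ 2 with hrdef
    set w := m - branch β r with hw
    set x := Real.exp (l * (t - s)) with hx
    have hx1 : 1 ≤ x := Real.one_le_exp (mul_nonneg hl (by linarith [ht.1]))
    have hxe : x ≤ Real.exp (l * (e - s)) := by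
      refine Real.exp_le_exp.2 (mul_le_mul_of_nonneg_left (by linarith [ht.2]) hl)
    -- Where the barrier is below 1 the distance is below `d`, since the growth factor is at least
    -- 1; this keeps w in the range of the contraction.
    have hwd : |w| ≤ d := by
      have hlt' : w ^ 2 * x < d ^ 2 := by
        rwa [div_lt_one hd2] at hlt
      refine abs_le_of_sq_le_sq ?_ hd.le
      nlinarith [sq_nonneg w]
    have hwlow : -(δ₀ * |r|) ≤ w := by
      have : δ₀ * η ≤ δ₀ * |r| := by gcongr
      linarith [neg_abs_le w]
    have hD := hdrift N hN r h2 m hm hwlow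
    have hsum := rate_add_le (β := β) (N := N) (-hc β * Real.cos r) hm
    rw [hN_eq hn0 hnN]
    unfold generator
    simp only
    set cp := ratePlus β N m (-hc β * Real.cos r)
    set cm := rateMinus β N m (-hc β * Real.cos r)
    have hsp := hspeed r hr0 h2
    set M' := branchSpeed β r
    have e1 : m + 2 / N - branch β r = w + 2 / N := by rw [hw]; ring
    have e2 : m - 2 / N - branch β r = w - 2 / N := by rw [hw]; ring
    rw [e1, e2]
    have a4 : ρ * w ^ 2 ≤ ρ₀ * |r| * w ^ 2 := by rw [hρ]; gcongr
    have hmain := macroscopic_generator_bound (β := β) hρ0 hn hnN hsp hsum hlρ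
      (w := w) (by linarith)
    calc _ = (2 * w * (-(M' * (1 / n ^ 2))) + w ^ 2 * l + 2 * (w * (2 / N * (cp - cm))) +
        4 / N ^ 2 * (cp + cm)) * (x / d ^ 2) := by field_simp; ring
      _ ≤ C / N * (x / d ^ 2) := by gcongr
      _ ≤ C / N * (Real.exp (l * (e - s)) / d ^ 2) := by gcongr
      _ = _ := by field_simp
  · intro k _ hk
    simp only [Set.mem_ofPred_eq] at hk
    rwa [le_div_iff₀ hd2, one_mul]
  · intro k _ hk
    simp only [Set.mem_ofPred_eq, not_lt] at hk
    simp only [sub_self, mul_zero, Real.exp_zero, mul_one]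
    gcongr ?_ / _
    rw [← sq_abs]
    gcongr

end Barriers

/-! ### The exponential barrier and Gaussian tails. -/

section Tail

variable {β : ℝ}

lemma exp_sub_one_le {x : ℝ} (hx : |x| ≤ 1) : Real.exp x - 1 ≤ x + x ^ 2 := by
  have := Real.abs_exp_sub_one_sub_id_le hx
  linarith [le_abs_self (Real.exp x - 1 - x)]

/-- Expansion of the exponential to second order. `X` is the odd part of the increment of the
exponent and sees the drift; `Z` is the even part and sees the total rate. -/
lemma exp_jump_bound {cp cm X Z N : ℝ} (hcp : 0 ≤ cp) (hcm : 0 ≤ cm) (hsum : cp + cm ≤ N)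
    (hX : |X| ≤ 1 / 2) (hZ0 : 0 ≤ Z) (hZ : Z ≤ 1 / 2) :
    cp * (Real.exp (X + Z) - 1) + cm * (Real.exp (-X + Z) - 1) ≤
      (cp - cm) * X + N * (Z + 2 * X ^ 2 + 2 * Z ^ 2) := by
  rw [abs_le] at hX
  have h1 := exp_sub_one_le (x := X + Z) (abs_le.2 ⟨by linarith, by linarith⟩)
  have h2 := exp_sub_one_le (x := -X + Z) (abs_le.2 ⟨by linarith, by linarith⟩)
  have h3 := mul_le_mul_of_nonneg_left h1 hcp
  have h4 := mul_le_mul_of_nonneg_left h2 hcm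
  have h5 : 0 ≤ Z + 2 * X ^ 2 + 2 * Z ^ 2 := by positivity
  have h6 := mul_le_mul_of_nonneg_right hsum h5
  nlinarith [mul_nonneg hcp (sq_nonneg (X - Z)), mul_nonneg hcm (sq_nonneg (X + Z))]

/-- The exponential barrier decays up to a source term of lower order. Here `v` is the rescaled
distance to the branch, and `τ` the rescaled time. -/
lemma exponential_generator_bound {ρ C₁ a n τ v M' σ D : ℝ} (hρ : 0 < ρ) (ha : 0 < a)
    (haρ : 64 * a ≤ ρ) (hn : 1 ≤ n) (hτ1 : 1 ≤ τ) (hτρ : 4 / ρ ≤ τ)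
    (hτn : 8 * a * τ ≤ n ^ 4) (hσ : |σ| ≤ 1) (hM : |M'| ≤ C₁) (hβ : 0 ≤ β)
    (hD : v * D ≤ -(ρ * τ * v ^ 2 / n ^ 2) + |v| * (β / n ^ 3)) :
    (a * σ * v ^ 2 - 2 * a * τ * v * M' - 2 * σ * τ) / n +
      (n ^ 3 / 2 * D * (4 * a * τ * v / n ^ 2) +
        n ^ 3 * (4 * a * τ / n ^ 4 + 2 * (4 * a * τ * v / n ^ 2) ^ 2 +
          2 * (4 * a * τ / n ^ 4) ^ 2)) ≤
      ((2 + 8 * a + a * (4 * C₁ ^ 2 + 4 * β ^ 2) / ρ) * τ - 3 / 4 * a * ρ * (τ * v ^ 2 * τ)) / n := by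
  have hn0 : 0 < n := by linarith
  have hτ0 : 0 < τ := by linarith
  -- All quadratic terms are measured in q². The contraction gives -2aρq²; the time derivative, the
  -- branch motion and the lattice error cost aρq²/4 each, the jump noise aρq²/2, which leaves
  -- -3aρq²/4.
  set q := τ * |v| with hq
  have hq0 : 0 ≤ q := by positivity
  have hq2 : q ^ 2 = τ ^ 2 * v ^ 2 := by rw [hq, mul_pow, sq_abs]
  rw [abs_le] at hσ
  have b1 : a * σ * v ^ 2 ≤ a * (ρ / 4 * q ^ 2) := by
    have h1 : 1 ≤ ρ / 4 * τ ^ 2 := by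
      rw [div_le_iff₀ hρ] at hτρ
      linarith [mul_le_mul_of_nonneg_left hτ1 (by positivity : 0 ≤ τ * ρ)]
    have h2 : v ^ 2 ≤ ρ / 4 * q ^ 2 := by
      rw [hq2]; linarith [mul_le_mul_of_nonneg_right h1 (sq_nonneg v)]
    calc a * σ * v ^ 2 = a * (σ * v ^ 2) := by ring
      _ ≤ a * (ρ / 4 * q ^ 2) :=
        mul_le_mul_of_nonneg_left (by linarith [mul_le_mul_of_nonneg_right hσ.2 (sq_nonneg v)]) ha.le
  have b2 : -(2 * a * τ * v * M') ≤ a * (ρ / 4 * q ^ 2 + 4 * C₁ ^ 2 / ρ) := by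
    have h1 : -(τ * v * M') ≤ q * C₁ := by
      refine (neg_le_abs _).trans ?_
      rw [abs_mul, abs_mul, abs_of_pos hτ0]
      gcongr
    have h2 := two_mul_le_of_pos (c := ρ / 4) (by positivity) q C₁
    have h3 : C₁ ^ 2 / (ρ / 4) = 4 * C₁ ^ 2 / ρ := by field_simp
    rw [h3] at h2
    calc -(2 * a * τ * v * M') = a * (2 * -(τ * v * M')) := by ring
      _ ≤ a * (ρ / 4 * q ^ 2 + 4 * C₁ ^ 2 / ρ) := by gcongr; linarith
  have b3 : -(2 * σ * τ) ≤ 2 * τ := by linarith [mul_le_mul_of_nonneg_right hσ.1 hτ0.le]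
  have b4 : n * (n ^ 3 / 2 * D * (4 * a * τ * v / n ^ 2)) ≤
      a * (-(2 * ρ * q ^ 2) + (ρ / 4 * q ^ 2 + 4 * β ^ 2 / ρ)) := by
    have h2 := two_mul_le_of_pos (c := ρ / 4) (by positivity) q β
    have h3 : β ^ 2 / (ρ / 4) = 4 * β ^ 2 / ρ := by field_simp
    rw [h3] at h2
    have h4 : 2 * q * β / n ≤ 2 * q * β := div_le_self (by positivity) hn
    calc n * (n ^ 3 / 2 * D * (4 * a * τ * v / n ^ 2)) = 2 * a * τ * n ^ 2 * (v * D) := by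
          field_simp; ring
      _ ≤ 2 * a * τ * n ^ 2 * (-(ρ * τ * v ^ 2 / n ^ 2) + |v| * (β / n ^ 3)) := by gcongr
      _ = a * (-(2 * ρ * q ^ 2) + 2 * q * β / n) := by rw [hq2, hq]; field_simp
      _ ≤ a * (-(2 * ρ * q ^ 2) + (ρ / 4 * q ^ 2 + 4 * β ^ 2 / ρ)) := by gcongr; linarith
  have b5 : n * (n ^ 3 * (4 * a * τ / n ^ 4 + 2 * (4 * a * τ * v / n ^ 2) ^ 2 +
          2 * (4 * a * τ / n ^ 4) ^ 2)) ≤ 8 * a * τ + a * (ρ / 2 * q ^ 2) := by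
    have h1 : n * (n ^ 3 * (4 * a * τ / n ^ 4 + 2 * (4 * a * τ * v / n ^ 2) ^ 2 +
          2 * (4 * a * τ / n ^ 4) ^ 2)) =
        4 * a * τ + 32 * a * (a * q ^ 2) + 4 * a * τ * (8 * a * τ / n ^ 4) := by
      rw [hq2]; field_simp; ring
    have h2 : 8 * a * τ / n ^ 4 ≤ 1 := by rw [div_le_one (by positivity)]; exact hτn
    have h3 : 4 * a * τ * (8 * a * τ / n ^ 4) ≤ 4 * a * τ * 1 := by gcongr
    have h4 : 32 * a * (a * q ^ 2) ≤ ρ / 2 * (a * q ^ 2) := by gcongr; linarith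
    rw [h1]; linarith
  have b6 : a * (4 * C₁ ^ 2 + 4 * β ^ 2) / ρ ≤ a * (4 * C₁ ^ 2 + 4 * β ^ 2) / ρ * τ :=
    le_mul_of_one_le_right (by positivity) hτ1
  have b7 : a * (4 * C₁ ^ 2 + 4 * β ^ 2) / ρ = a * (4 * C₁ ^ 2 / ρ) + a * (4 * β ^ 2 / ρ) := by
    ring
  rw [le_div_iff₀ hn0, add_mul, div_mul_cancel₀ _ hn0.ne']
  have e1 : τ * v ^ 2 * τ = q ^ 2 := by rw [hq2]; ring
  rw [e1]
  linarith

set_option maxHeartbeats 1000000 in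
/-- Where it is less than one, the exponential barrier is a supersolution up to a source term. -/
lemma exponential_supersolution {ρ δ C₁ a n τ τ₁ B σ m M M' cp cm N : ℝ} (hρ : 0 < ρ) (hδ : 0 < δ)
    (hδ1 : δ ≤ 1) (ha0 : 0 < a) (ha1 : a ≤ 1 / 32) (haρ : 64 * a ≤ ρ) (hn : 1 ≤ n)
    (hnN : n ^ 3 = N) (hτ1 : 1 ≤ τ) (hτρ : 4 / ρ ≤ τ) (hτδ : 2 / (a * δ ^ 2) ≤ τ)
    (hτn : τ ≤ 2 * n) (hσ1 : |σ| ≤ 1) (hβ : 0 ≤ β) (hsp : |M'| ≤ C₁) (hτ₁ : τ₁ ≤ τ)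
    (hτ₁0 : 0 ≤ τ₁) (hBκ : B ≤ a * δ ^ 2 / 2 * τ₁ ^ 3) (hcp : 0 ≤ cp) (hcm : 0 ≤ cm)
    (hsum : cp + cm ≤ N)
    (hdr : -(δ * (τ / n)) ≤ m - M → (m - M) * (2 / N * (cp - cm)) ≤
      -(ρ * (τ / n) * (m - M) ^ 2) + |m - M| * (β / N))
    (hlt : Real.exp (a * τ * (n * (m - M)) ^ 2 - (B + (τ ^ 2 - τ₁ ^ 2))) < 1) :
    Real.exp (a * τ * (n * (m - M)) ^ 2 - (B + (τ ^ 2 - τ₁ ^ 2))) *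
        ((a * σ * (n * (m - M)) ^ 2 - 2 * a * τ * (n * (m - M)) * M' - 2 * σ * τ) / n) +
      (cp * (Real.exp (a * τ * (n * (m + 2 / N - M)) ^ 2 - (B + (τ ^ 2 - τ₁ ^ 2))) -
          Real.exp (a * τ * (n * (m - M)) ^ 2 - (B + (τ ^ 2 - τ₁ ^ 2)))) +
        cm * (Real.exp (a * τ * (n * (m - 2 / N - M)) ^ 2 - (B + (τ ^ 2 - τ₁ ^ 2))) -
          Real.exp (a * τ * (n * (m - M)) ^ 2 - (B + (τ ^ 2 - τ₁ ^ 2))))) ≤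
      (2 + 8 * a + a * (4 * C₁ ^ 2 + 4 * β ^ 2) / ρ) * Real.exp (a * (4 * (2 + 8 * a +
        a * (4 * C₁ ^ 2 + 4 * β ^ 2) / ρ) / (3 * a * ρ))) * τ / n *
        Real.exp (-(B + (τ ^ 2 - τ₁ ^ 2))) := by
  have hn0 : 0 < n := by linarith
  have hN0 : 0 < N := by rw [← hnN]; positivity
  have hτ0 : 0 < τ := by linarith
  set v := n * (m - M) with hv
  set K := 2 + 8 * a + a * (4 * C₁ ^ 2 + 4 * β ^ 2) / ρ with hK
  have hK0 : 0 < K := by positivity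
  set K' := 4 * K / (3 * a * ρ) with hK'
  have hK'0 : 0 < K' := by positivity
  set C' := K * Real.exp (a * K') with hC'
  have hC'0 : 0 < C' := by positivity
  have hw : m - M = v / n := by rw [hv]; field_simp
  -- Where the barrier is below 1, aτv² < B + τ². Both B and τ² are at most (aδ²/2)τ³, by the bound
  -- on B and the lower bound 2/(aδ²) on τ, so v stays where the drift contracts.
  have hvδ : |v| ≤ δ * τ := by
    rw [Real.exp_lt_one_iff] at hlt
    refine abs_le_of_sq_le_sq ?_ (by positivity)
    have c1 : a * δ ^ 2 / 2 * τ₁ ^ 3 ≤ a * δ ^ 2 / 2 * τ ^ 3 := by gcongr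
    have c2 : τ ^ 2 ≤ a * δ ^ 2 / 2 * τ ^ 3 := by
      rw [div_le_iff₀ (by positivity)] at hτδ
      linarith [mul_le_mul_of_nonneg_left hτδ (sq_nonneg τ)]
    have c3 : a * τ * v ^ 2 ≤ a * τ * (δ * τ) ^ 2 := by linarith [sq_nonneg τ₁]
    exact le_of_mul_le_mul_left c3 (by positivity)
  have hDv : v * (2 / N * (cp - cm)) ≤ -(ρ * τ * v ^ 2 / n ^ 2) + |v| * (β / n ^ 3) := by
    have c1 := hdr (by
      rw [hw, ← mul_div_assoc, ← neg_div]
      gcongr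
      linarith [neg_abs_le v])
    rw [hw, abs_div, abs_of_pos hn0] at c1
    have c2 := mul_le_mul_of_nonneg_left c1 hn0.le
    calc v * (2 / N * (cp - cm)) = n * (v / n * (2 / N * (cp - cm))) := by field_simp
      _ ≤ _ := c2
      _ = _ := by rw [← hnN]; field_simp
  have hX : |4 * a * τ * v / n ^ 2| ≤ 1 / 2 := by
    rw [abs_div, abs_of_pos (by positivity : 0 < n ^ 2), div_le_iff₀ (by positivity), abs_mul,
      abs_of_pos (by positivity : 0 < 4 * a * τ)]
    have c1 : |v| ≤ τ := hvδ.trans (mul_le_of_le_one_left hτ0.le hδ1)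
    calc 4 * a * τ * |v| ≤ 4 * (1 / 32) * (2 * n) * (2 * n) := by gcongr; linarith
      _ = _ := by ring
  have hτn4 : 8 * a * τ ≤ n ^ 4 := by
    have : n ≤ n ^ 4 := le_self_pow₀ hn (by norm_num)
    calc 8 * a * τ ≤ 8 * (1 / 32) * (2 * n) := by gcongr
      _ ≤ n ^ 4 := by linarith
  have hZ : 4 * a * τ / n ^ 4 ≤ 1 / 2 := by
    rw [div_le_iff₀ (by positivity)]; linarith
  have hjump := exp_jump_bound hcp hcm hsum hX (by positivity : 0 ≤ 4 * a * τ / n ^ 4) hZ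
  have hmain := exponential_generator_bound (β := β) hρ ha0 haρ hn hτ1 hτρ hτn4 hσ1 hsp
    (by linarith) hDv
  set E := Real.exp (a * τ * v ^ 2 - (B + (τ ^ 2 - τ₁ ^ 2))) with hE
  have hE0 : 0 < E := Real.exp_pos _
  have eP : Real.exp (a * τ * (n * (m + 2 / N - M)) ^ 2 - (B + (τ ^ 2 - τ₁ ^ 2))) =
      E * Real.exp (4 * a * τ * v / n ^ 2 + 4 * a * τ / n ^ 4) := by
    rw [hE, ← Real.exp_add]
    congr 1
    rw [show m + 2 / (N : ℝ) - M = v / n + 2 / n ^ 3 by rw [← hw, hnN]; ring]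
    field_simp
    ring
  have eM : Real.exp (a * τ * (n * (m - 2 / N - M)) ^ 2 - (B + (τ ^ 2 - τ₁ ^ 2))) =
      E * Real.exp (-(4 * a * τ * v / n ^ 2) + 4 * a * τ / n ^ 4) := by
    rw [hE, ← Real.exp_add]
    congr 1
    rw [show m - 2 / (N : ℝ) - M = v / n - 2 / n ^ 3 by rw [← hw, hnN]; ring]
    field_simp
    ring
  rw [eP, eM]
  have hD2 : n ^ 3 / 2 * (2 / N * (cp - cm)) = cp - cm := by rw [hnN]; field_simp
  rw [hD2, hnN, ← hK] at hmain
  have htot : (a * σ * v ^ 2 - 2 * a * τ * v * M' - 2 * σ * τ) / n +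
      (cp * (Real.exp (4 * a * τ * v / n ^ 2 + 4 * a * τ / n ^ 4) - 1) +
      cm * (Real.exp (-(4 * a * τ * v / n ^ 2) + 4 * a * τ / n ^ 4) - 1)) ≤
      (K * τ - 3 / 4 * a * ρ * (τ * v ^ 2 * τ)) / n := by linarith
  have hfin : E * ((K * τ - 3 / 4 * a * ρ * (τ * v ^ 2 * τ)) / n) ≤
      C' * τ / n * Real.exp (-(B + (τ ^ 2 - τ₁ ^ 2))) := by
    -- For τv² ≤ K' the exponent exceeds minus the offset by at most aK', which gives the source;
    -- beyond K' the contraction outweighs all other terms.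
    rcases le_total (τ * v ^ 2) K' with hle | hge
    · have c1 : E ≤ Real.exp (a * K') * Real.exp (-(B + (τ ^ 2 - τ₁ ^ 2))) := by
        rw [hE, ← Real.exp_add]
        refine Real.exp_le_exp.2 ?_
        linarith [mul_le_mul_of_nonneg_left hle ha0.le]
      have c2 : (K * τ - 3 / 4 * a * ρ * (τ * v ^ 2 * τ)) / n ≤ K * τ / n := by
        gcongr
        have : 0 ≤ 3 / 4 * a * ρ * (τ * v ^ 2 * τ) := by positivity
        linarith
      calc _ ≤ E * (K * τ / n) := by gcongr
        _ ≤ Real.exp (a * K') * Real.exp (-(B + (τ ^ 2 - τ₁ ^ 2))) * (K * τ / n) := by gcongr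
        _ = _ := by rw [hC']; ring
    · have c1 : K * τ ≤ 3 / 4 * a * ρ * (τ * v ^ 2 * τ) := by
        have c2 : K = 3 / 4 * a * ρ * K' := by rw [hK']; field_simp
        calc K * τ = 3 / 4 * a * ρ * (K' * τ) := by rw [c2]; ring
          _ ≤ _ := by gcongr
      have c3 : (K * τ - 3 / 4 * a * ρ * (τ * v ^ 2 * τ)) / n ≤ 0 :=
        div_nonpos_of_nonpos_of_nonneg (by linarith) hn0.le
      have c4 : 0 ≤ C' * τ / n * Real.exp (-(B + (τ ^ 2 - τ₁ ^ 2))) := by positivity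
      exact (mul_nonpos_of_nonneg_of_nonpos hE0.le c3).trans c4
  refine le_trans (le_of_eq ?_) ((mul_le_mul_of_nonneg_left htot hE0.le).trans hfin)
  ring

set_option maxHeartbeats 1000000 in
open Classical in
/-- Gaussian tails around the upper branch, uniformly up to times of order `N^{1/3}` from the
critical time. -/
theorem exists_gaussian_tail (hβ : 1 < β) : ∃ a κ C τ₀ : ℝ, 0 < a ∧ 0 < κ ∧ 0 < C ∧ 0 < τ₀ ∧
    ∀ (N : ℕ) (n : ℝ), 1 ≤ N → 1 ≤ n → n ^ 3 = N → ∀ (s e Λ σ τ₁ B : ℝ) (p : ℝ → ℕ → ℝ), s ≤ e →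
    σ = 1 ∨ σ = -1 → τ₀ ≤ τ₁ → 0 ≤ B → B ≤ κ * τ₁ ^ 3 →
    (∀ t ∈ Set.Icc s e, τ₁ ≤ σ * t / n ∧ |t / n ^ 2| ≤ Real.pi / 2) → 0 ≤ Λ → IsFlow β N s e Λ p →
    ∀ g : ℝ,
    ∑ k ∈ Finset.range (N + 1), (if grid N k ∈ {m | B + ((e / n) ^ 2 - τ₁ ^ 2) ≤
        a * (σ * e / n) * (n * (m - branch β (e / n ^ 2))) ^ 2} then p e k else 0) ≤
      2 * (∑ k ∈ Finset.range (N + 1), (if grid N k ∈ {m | g <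
          a * (σ * s / n) * (n * (m - branch β (s / n ^ 2))) ^ 2} then p s k else 0) +
        Λ * (Real.exp (g - (B + ((s / n) ^ 2 - τ₁ ^ 2))) + C * Real.exp (-B))) := by
  obtain ⟨ρ, δ, hρ, hδ, hδ1, hdrift⟩ := exists_mul_drift_le hβ
  obtain ⟨C₁, hC₁, hspeed⟩ := exists_abs_branchSpeed_le hβ
  set a := min (1 / 32) (ρ / 64) with ha
  have ha0 : 0 < a := by positivity
  have ha1 : a ≤ 1 / 32 := min_le_left _ _
  have haρ : 64 * a ≤ ρ := by have := min_le_right (1 / 32) (ρ / 64); linarith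
  set K := 2 + 8 * a + a * (4 * C₁ ^ 2 + 4 * β ^ 2) / ρ with hK
  have hK0 : 0 < K := by positivity
  set K' := 4 * K / (3 * a * ρ) with hK'
  have hK'0 : 0 < K' := by positivity
  set C' := K * Real.exp (a * K') with hC'
  have hC'0 : 0 < C' := by positivity
  refine ⟨a, a * δ ^ 2 / 2, C' / 2, 1 + 4 / ρ + 2 / (a * δ ^ 2), ha0, by positivity, by positivity,
    by positivity, ?_⟩
  intro N n hN hn hnN s e Λ σ τ₁ B p hse hσ hτ₁ hB hBκ hwin hΛ hp g
  have hn0 : 0 < n := by linarith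
  have hN0 : (0 : ℝ) < N := by positivity
  have hσ2 : σ ^ 2 = 1 := by rcases hσ with rfl | rfl <;> norm_num
  have hσ1 : |σ| ≤ 1 := by rcases hσ with rfl | rfl <;> norm_num
  have hp1 : 0 ≤ 4 / ρ := by positivity
  have hp2 : 0 ≤ 2 / (a * δ ^ 2) := by positivity
  have hτ₁0 : 0 < τ₁ := by linarith
  have hbar : ∀ t ∈ Set.Icc s e, τ₁ ^ 2 ≤ (t / n) ^ 2 := by
    intro t ht
    have h1 := (hwin t ht).1
    have h2 : (t / n) ^ 2 = (σ * t / n) ^ 2 := by rw [mul_div_assoc, mul_pow, hσ2, one_mul]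
    rw [h2]; gcongr
  have hr : ∀ t ∈ Set.Icc s e, |t / n ^ 2| = (σ * t / n) / n := by
    intro t ht
    have h1 := (hwin t ht).1
    have h2 : t / n ^ 2 = σ * ((σ * t / n) / n) := by
      field_simp; rw [hσ2]; ring
    have h3 : |σ| = 1 := by rcases hσ with rfl | rfl <;> norm_num
    rw [h2, abs_mul, h3, one_mul, abs_of_nonneg]
    exact div_nonneg (by linarith) hn0.le
  have hr0 : ∀ t ∈ Set.Icc s e, t / n ^ 2 ≠ 0 := by
    intro t ht h0
    have h1 := (hwin t ht).1
    have h2 := hr t ht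
    rw [h0, abs_zero] at h2
    have : 0 < σ * t / n / n := div_pos (by linarith) hn0
    linarith
  -- The offset B + τ² - τ₁² has two uses: it makes the starting term small when s is far from the
  -- critical time, and its derivative makes the source τe^{-(B + τ² - τ₁²)}/n an exact derivative,
  -- so that the total source is O(e^{-B}) even over times of order n². Before the critical time the
  -- offset decreases; the extra term 2τ is dominated and enters K.
  have key := hp.mass_barrier_le hN hse
    (G := fun t m => Real.exp (a * (σ * t / n) * (n * (m - branch β (t / n ^ 2))) ^ 2 -
      (B + ((t / n) ^ 2 - τ₁ ^ 2))))
    (G' := fun t m => Real.exp (a * (σ * t / n) * (n * (m - branch β (t / n ^ 2))) ^ 2 -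
      (B + ((t / n) ^ 2 - τ₁ ^ 2))) * ((a * σ * (n * (m - branch β (t / n ^ 2))) ^ 2 -
        2 * a * (σ * t / n) * (n * (m - branch β (t / n ^ 2))) * branchSpeed β (t / n ^ 2) -
        2 * σ * (σ * t / n)) / n))
    (S := fun t => -(C' * σ / 2) * Real.exp (-(B + ((t / n) ^ 2 - τ₁ ^ 2))))
    (S' := fun t => C' * (σ * t / n) / n * Real.exp (-(B + ((t / n) ^ 2 - τ₁ ^ 2))))
    ?_ (fun t m => (Real.exp_pos _).le) ?_ ?_ ?_
    (D := {m | B + ((e / n) ^ 2 - τ₁ ^ 2) ≤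
        a * (σ * e / n) * (n * (m - branch β (e / n ^ 2))) ^ 2})
    (D₀ := {m | g < a * (σ * s / n) * (n * (m - branch β (s / n ^ 2))) ^ 2}) ?_
    (g := Real.exp (g - (B + ((s / n) ^ 2 - τ₁ ^ 2)))) ?_ (Real.exp_pos _).le
  · refine key.trans ?_
    gcongr
    have hes : ∀ t ∈ Set.Icc s e, Real.exp (-(B + ((t / n) ^ 2 - τ₁ ^ 2))) ≤ Real.exp (-B) :=
      fun t ht => Real.exp_le_exp.2 (by linarith [hbar t ht])
    have h1 := hes s (Set.left_mem_Icc.2 hse)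
    have h2 := hes e (Set.right_mem_Icc.2 hse)
    have h3 := Real.exp_pos (-(B + ((s / n) ^ 2 - τ₁ ^ 2)))
    have h4 := Real.exp_pos (-(B + ((e / n) ^ 2 - τ₁ ^ 2)))
    rcases hσ with rfl | rfl <;> linarith [mul_le_mul_of_nonneg_left h1 (by positivity : 0 ≤ C'),
        mul_le_mul_of_nonneg_left h2 (by positivity : 0 ≤ C'),
        mul_nonneg (by positivity : 0 ≤ C') h3.le, mul_nonneg (by positivity : 0 ≤ C') h4.le]
  · intro t ht k _
    have h3 : HasDerivAt (fun t : ℝ => t / n ^ 2) (1 / n ^ 2) t := (hasDerivAt_id t).div_const _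
    have h4 := (hasDerivAt_branch hβ (cos_ne_one (hr0 t ht) (hwin t ht).2)).comp t h3
    have h5 : HasDerivAt (fun t : ℝ => a * (σ * t / n)) (a * (σ * 1 / n)) t :=
      (((hasDerivAt_id t).const_mul σ).div_const n).const_mul a
    have h6 : HasDerivAt (fun t : ℝ => B + ((t / n) ^ 2 - τ₁ ^ 2)) (2 * (t / n) * (1 / n)) t := by
      refine (((((hasDerivAt_id t).div_const n).pow 2).sub_const _).const_add B).congr_deriv ?_
      simp
    refine (((h5.mul (((h4.const_sub (grid N k)).const_mul n).pow 2)).sub h6).exp).congr_deriv ?_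
    simp only [Function.comp, Pi.sub_apply, Pi.mul_apply, Pi.pow_apply]
    congr 1
    field_simp
    norm_num
    linear_combination 2 * t * hσ2
  · intro t ht
    have h6 : HasDerivAt (fun t : ℝ => -(B + ((t / n) ^ 2 - τ₁ ^ 2))) (-(2 * (t / n) * (1 / n))) t := by
      refine (((((hasDerivAt_id t).div_const n).pow 2).sub_const _).const_add B).neg.congr_deriv ?_
      simp
    refine (h6.exp.const_mul _).congr_deriv ?_
    field_simp
  · intro t ht
    have := (hwin t ht).1
    have h1 : 0 ≤ σ * t / n := by linarith
    positivity
  · intro t ht k hk hlt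
    have hm := grid_mem hN hk
    have hcp := ratePlus_nonneg (β := β) (N := N) (CurieWeiss.hN β N t) hm.2
    have hcm := rateMinus_nonneg (β := β) (N := N) (CurieWeiss.hN β N t) hm.1
    have hsum := rate_add_le (β := β) (N := N) (CurieWeiss.hN β N t) hm
    have h1 := (hwin t ht).1
    have h2 := (hwin t ht).2
    have hrt := hr t ht
    have hbt := hbar t ht
    have hsp := hspeed _ (hr0 t ht) h2
    have hdr := hdrift N hN _ h2 _ hm
    rw [← hN_eq hn0 hnN] at hdr
    have ht2 : (t / n) ^ 2 = (σ * t / n) ^ 2 := by rw [mul_div_assoc, mul_pow, hσ2, one_mul]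
    unfold generator
    simp only
    rw [ht2] at hlt hbt ⊢
    set τ := σ * t / n with hτ
    set m := grid N k
    set cp := ratePlus β N m (CurieWeiss.hN β N t)
    set cm := rateMinus β N m (CurieWeiss.hN β N t)
    set M := branch β (t / n ^ 2)
    set M' := branchSpeed β (t / n ^ 2)
    have hτ1 : 1 ≤ τ := by linarith
    have hτρ : 4 / ρ ≤ τ := by linarith
    have hτδ : 2 / (a * δ ^ 2) ≤ τ := by linarith
    have hτn : τ ≤ 2 * n := by
      rw [hrt, div_le_iff₀ hn0] at h2
      linarith [mul_lt_mul_of_pos_right Real.pi_lt_four hn0]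
    exact exponential_supersolution hρ hδ hδ1 ha0 ha1 haρ hn hnN hτ1 hτρ hτδ hτn hσ1 (by linarith)
      hsp h1 hτ₁0.le hBκ hcp hcm hsum (by rw [hrt] at hdr; exact hdr) hlt
  · intro k _ hk
    simp only [Set.mem_ofPred_eq] at hk
    exact Real.one_le_exp (by linarith)
  · intro k _ hk
    simp only [Set.mem_ofPred_eq, not_lt] at hk
    exact Real.exp_le_exp.2 (by linarith)

end Tail

/-! ### The generator applied to the space-time bump. -/

section Bump

variable {β : ℝ}

/-- The left side is (l + Δ)⁴ - Δ⁴. If l + Δ is negative, then |l + Δ| ≤ |Δ| and the left side is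
nonpositive. So a third-order expansion bounds the bump from below even for jumps that leave its
support. -/
lemma max_add_zero_pow_four_ge {l Δ : ℝ} (hl : 0 ≤ l) :
    l ^ 4 + 4 * l ^ 3 * Δ + 6 * l ^ 2 * Δ ^ 2 + 4 * l * Δ ^ 3 ≤ max (l + Δ) 0 ^ 4 := by
  have h : l ^ 4 + 4 * l ^ 3 * Δ + 6 * l ^ 2 * Δ ^ 2 + 4 * l * Δ ^ 3 = (l + Δ) ^ 4 - Δ ^ 4 := by ring
  rw [h]
  rcases le_total 0 (l + Δ) with h0 | h0
  · rw [max_eq_left h0]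
    have : 0 ≤ Δ ^ 4 := by positivity
    linarith
  · rw [max_eq_right h0]
    have h1 : (l + Δ) ^ 2 ≤ Δ ^ 2 := by nlinarith
    have h2 : ((l + Δ) ^ 2) ^ 2 ≤ (Δ ^ 2) ^ 2 := by gcongr
    nlinarith

set_option maxHeartbeats 1000000 in
/-- The space-time bump `(1 - v² / R)₊⁴` is a subsolution up to small errors. -/
lemma bump_generator_bound {C₁ S n v M' R l ς x D N cp cm ε₁ : ℝ} (hβ : 0 ≤ β)
    (hS : 0 < S) (hn : 1 ≤ n) (hnN : n ^ 3 = N) (hx : 0 < x) (hxR : x ^ 2 ≤ R) (hR1 : R ≤ 1)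
    (hRC : 8 * C₁ * √R ≤ 24 / 25 * S) (hl : l = 1 - v ^ 2 / R) (hl0 : 0 ≤ l) (hM : |M'| ≤ C₁)
    (hς : cp + cm = ς * N) (hςS : |4 * ς - S| ≤ 4 * ε₁) (hς1 : ς ≤ 1) (hcp : 0 ≤ cp) (hcm : 0 ≤ cm)
    (hdrift : cp - cm = n ^ 3 / 2 * D) (hD : v * D ≤ |v| * (β / n ^ 3)) :
    -(112 * ε₁ + (8 * β + 192 / x ^ 2 + 2048 / x ^ 4) / n) ≤
      R * (5 * S * l ^ 4 / R + 4 * l ^ 3 * (2 * v * M' / R - v ^ 2 * (5 * S) / R ^ 2) +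
      n * (cp * (4 * l ^ 3 * (-(4 * v / n ^ 2 + 4 / n ^ 4) / R) +
          6 * l ^ 2 * (-(4 * v / n ^ 2 + 4 / n ^ 4) / R) ^ 2 +
          4 * l * (-(4 * v / n ^ 2 + 4 / n ^ 4) / R) ^ 3) +
        cm * (4 * l ^ 3 * (-(-(4 * v / n ^ 2) + 4 / n ^ 4) / R) +
          6 * l ^ 2 * (-(-(4 * v / n ^ 2) + 4 / n ^ 4) / R) ^ 2 +
          4 * l * (-(-(4 * v / n ^ 2) + 4 / n ^ 4) / R) ^ 3))) := by
  have hn0 : 0 < n := by linarith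
  have hx2 : 0 < x ^ 2 := by positivity
  have hR0 : 0 < R := by linarith
  have hε : 0 ≤ ε₁ := by linarith [abs_nonneg (4 * ς - S)]
  have hv2 : v ^ 2 = (1 - l) * R := by rw [hl]; field_simp; ring
  have hl1 : l ≤ 1 := by
    rw [hl]; have : 0 ≤ v ^ 2 / R := by positivity
    linarith
  have hvR : v ^ 2 ≤ R := by rw [hv2]; nlinarith
  have hvs : |v| ≤ √R := Real.abs_le_sqrt hvR
  have hv1 : |v| ≤ 1 := hvs.trans ((Real.sqrt_le_sqrt hR1).trans_eq Real.sqrt_one)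
  have hv0 := abs_nonneg v
  rw [abs_le] at hςS
  have hNn : N = n ^ 3 := hnN.symm
  have hN0 : 0 < N := by rw [hNn]; positivity
  have hς0 : 0 ≤ ς := by
    have h1 : 0 ≤ ς * N := by linarith
    exact nonneg_of_mul_nonneg_left h1 hN0
  -- `T1`, `T2`, `T3` are the contributions of the first, second and third order in the increment,
  -- and `T0` is that of time. Drift towards the branch only raises the bump, so an upper bound on v
  -- times the drift is enough.
  have T1 : R * (n * (cp * (4 * l ^ 3 * (-(4 * v / n ^ 2 + 4 / n ^ 4) / R)) +
      cm * (4 * l ^ 3 * (-(-(4 * v / n ^ 2) + 4 / n ^ 4) / R)))) ≥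
      4 * l ^ 3 * (-(2 * β / n) - 4 * ς) := by
    have e1 : R * (n * (cp * (4 * l ^ 3 * (-(4 * v / n ^ 2 + 4 / n ^ 4) / R)) +
      cm * (4 * l ^ 3 * (-(-(4 * v / n ^ 2) + 4 / n ^ 4) / R)))) =
      4 * l ^ 3 * (-(4 / n * (v * (cp - cm))) - 4 / n ^ 3 * (cp + cm)) := by
      field_simp; ring
    rw [e1, hς, hdrift, hNn]
    have e2 : 4 / n * (v * (n ^ 3 / 2 * D)) ≤ 2 * β / n := by
      calc 4 / n * (v * (n ^ 3 / 2 * D)) = 2 * n ^ 2 * (v * D) := by field_simp; ring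
        _ ≤ 2 * n ^ 2 * (|v| * (β / n ^ 3)) := by gcongr
        _ ≤ 2 * n ^ 2 * (1 * (β / n ^ 3)) := by gcongr
        _ = 2 * β / n := by field_simp
    have e3 : 4 / n ^ 3 * (ς * n ^ 3) = 4 * ς := by field_simp
    rw [e3]
    have : 0 ≤ 4 * l ^ 3 := by positivity
    exact mul_le_mul_of_nonneg_left (by linarith) this
  have T2 : R * (n * (cp * (6 * l ^ 2 * (-(4 * v / n ^ 2 + 4 / n ^ 4) / R) ^ 2) +
      cm * (6 * l ^ 2 * (-(-(4 * v / n ^ 2) + 4 / n ^ 4) / R) ^ 2))) ≥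
      6 * l ^ 2 * (16 * ς * (1 - l) - 32 / x ^ 2 / n) := by
    have e1 : R * (n * (cp * (6 * l ^ 2 * (-(4 * v / n ^ 2 + 4 / n ^ 4) / R) ^ 2) +
      cm * (6 * l ^ 2 * (-(-(4 * v / n ^ 2) + 4 / n ^ 4) / R) ^ 2))) =
      6 * l ^ 2 * (16 * ς * v ^ 2 / R + (32 * v * (cp - cm) / n ^ 5 + 16 * ς / n ^ 4) / R) := by
      have : cp + cm = ς * n ^ 3 := by rw [hς, hNn]
      field_simp
      linear_combination (16 * l ^ 2 * n ^ 4 * v ^ 2 + 16 * l ^ 2) * this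
    rw [e1]
    have e2 : 16 * ς * v ^ 2 / R = 16 * ς * (1 - l) := by rw [hv2]; field_simp
    rw [e2]
    have e3 : -(32 / x ^ 2 / n) ≤ (32 * v * (cp - cm) / n ^ 5 + 16 * ς / n ^ 4) / R := by
      have f1 : |v * (cp - cm)| ≤ n ^ 3 := by
        rw [abs_mul]
        have : |cp - cm| ≤ n ^ 3 := by
          rw [hNn] at hς
          have : ς * n ^ 3 ≤ 1 * n ^ 3 := by gcongr
          rw [abs_le]; constructor <;> linarith
        calc |v| * |cp - cm| ≤ 1 * n ^ 3 := by gcongr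
          _ = _ := one_mul _
      have f2 : -(32 / n) ≤ 32 * v * (cp - cm) / n ^ 5 := by
        have g1 : -(n ^ 3) ≤ v * (cp - cm) := (abs_le.1 f1).1
        calc -(32 / n) ≤ -(32 / n ^ 2) := by
              gcongr; exact le_self_pow₀ hn (by norm_num)
          _ = 32 * (-(n ^ 3)) / n ^ 5 := by field_simp
          _ ≤ 32 * (v * (cp - cm)) / n ^ 5 := by gcongr
          _ = _ := by ring
      have f3 : 0 ≤ 16 * ς / n ^ 4 := by positivity
      rw [le_div_iff₀ hR0]
      have f4 : 32 / n ≤ 32 / x ^ 2 / n * R := by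
        calc 32 / n = 32 / x ^ 2 / n * x ^ 2 := by field_simp
          _ ≤ _ := by gcongr
      linarith
    have : 0 ≤ 6 * l ^ 2 := by positivity
    exact mul_le_mul_of_nonneg_left (by linarith) this
  have T3 : R * (n * (cp * (4 * l * (-(4 * v / n ^ 2 + 4 / n ^ 4) / R) ^ 3) +
      cm * (4 * l * (-(-(4 * v / n ^ 2) + 4 / n ^ 4) / R) ^ 3))) ≥ -(2048 / x ^ 4 / n) := by
    have cube : ∀ y : ℝ, |y| ≤ 8 / n ^ 2 → -(512 / n ^ 6 / R ^ 3) ≤ (-y / R) ^ 3 := by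
      intro y hy
      have : |(-y / R) ^ 3| ≤ 512 / n ^ 6 / R ^ 3 := by
        rw [abs_pow, abs_div, abs_neg, abs_of_pos hR0, div_pow]
        calc |y| ^ 3 / R ^ 3 ≤ (8 / n ^ 2) ^ 3 / R ^ 3 := by gcongr
          _ = _ := by field_simp; norm_num
      exact (abs_le.1 this).1
    have y0 : |4 * v / n ^ 2| ≤ 4 / n ^ 2 := by
      rw [abs_div, abs_mul, abs_of_pos (by positivity : 0 < n ^ 2), abs_of_pos (by norm_num : (0:ℝ) < 4)]
      gcongr; linarith
    have y1 : 4 / n ^ 4 ≤ 4 / n ^ 2 := by gcongr; norm_num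
    have y2 : 0 ≤ 4 / n ^ 4 := by positivity
    have y3 : 8 / n ^ 2 = 4 / n ^ 2 + 4 / n ^ 2 := by ring
    rw [abs_le] at y0
    have c1 := cube (4 * v / n ^ 2 + 4 / n ^ 4) (by rw [abs_le]; constructor <;> linarith)
    have c2 := cube (-(4 * v / n ^ 2) + 4 / n ^ 4) (by rw [abs_le]; constructor <;> linarith)
    have d1 := mul_le_mul_of_nonneg_left c1 hcp
    have d2 := mul_le_mul_of_nonneg_left c2 hcm
    have d3 : (cp + cm) * (512 / n ^ 6 / R ^ 3) ≤ n ^ 3 * (512 / n ^ 6 / R ^ 3) := by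
      gcongr
      rw [hς, hNn]
      exact mul_le_of_le_one_left (by positivity) hς1
    calc -(2048 / x ^ 4 / n) ≤ -(2048 / R ^ 2 / n ^ 2) := by
          have : x ^ 4 ≤ R ^ 2 := by
            calc x ^ 4 = (x ^ 2) ^ 2 := by ring
              _ ≤ R ^ 2 := by gcongr
          have h2 : n ≤ n ^ 2 := le_self_pow₀ hn (by norm_num)
          gcongr
      _ ≤ -(l * (2048 / R ^ 2 / n ^ 2)) := by
          have : 0 ≤ 2048 / R ^ 2 / n ^ 2 := by positivity
          nlinarith
      _ = R * n * (4 * l) * (-(n ^ 3 * (512 / n ^ 6 / R ^ 3))) := by field_simp; ring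
      _ ≤ R * n * (4 * l) * (cp * (-(4 * v / n ^ 2 + 4 / n ^ 4) / R) ^ 3 +
          cm * (-(-(4 * v / n ^ 2) + 4 / n ^ 4) / R) ^ 3) := by
          refine mul_le_mul_of_nonneg_left ?_ (by positivity)
          linarith
      _ = _ := by ring
  have T0 : R * (5 * S * l ^ 4 / R + 4 * l ^ 3 * (2 * v * M' / R - v ^ 2 * (5 * S) / R ^ 2)) ≥
      5 * S * l ^ 4 + 4 * l ^ 3 * (-(5 * S * (1 - l))) - l ^ 2 * (24 / 25 * S) := by
    have e1 : R * (5 * S * l ^ 4 / R + 4 * l ^ 3 * (2 * v * M' / R - v ^ 2 * (5 * S) / R ^ 2)) =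
        5 * S * l ^ 4 + 4 * l ^ 3 * (-(5 * S * (1 - l))) + 8 * l ^ 3 * (v * M') := by
      rw [hv2]; field_simp; ring
    rw [e1]
    have e2 : -(√R * C₁) ≤ v * M' := by
      have : |v * M'| ≤ √R * C₁ := by rw [abs_mul]; gcongr
      exact (abs_le.1 this).1
    have e3 : 0 ≤ √R * C₁ := by
      have := (abs_nonneg M').trans hM
      positivity
    have e4 : l ^ 3 ≤ l ^ 2 := pow_le_pow_of_le_one hl0 hl1 (by norm_num)
    have e5 : l ^ 3 * (-(√R * C₁)) ≤ l ^ 3 * (v * M') := by gcongr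
    have e6 : l ^ 3 * (√R * C₁) ≤ l ^ 2 * (√R * C₁) := by gcongr
    have e7 : l ^ 2 * (8 * C₁ * √R) ≤ l ^ 2 * (24 / 25 * S) := by gcongr
    linarith
  -- The leading terms add up to S l²(25l² - 48l + 24). With the factor 5 in the growth of R this
  -- quadratic has negative discriminant and minimum 24/25, a margin that pays for the motion of the
  -- branch.
  have hquad : 0 ≤ l ^ 2 * (S * (25 * l ^ 2 - 48 * l + 24) - 24 / 25 * S) := by
    have : S * (25 * l ^ 2 - 48 * l + 24) - 24 / 25 * S = S * (25 * (l - 24 / 25) ^ 2) := by ring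
    rw [this]; positivity
  have hl2 : l ^ 2 ≤ 1 := pow_le_one₀ hl0 hl1
  have hl3 : l ^ 3 ≤ 1 := pow_le_one₀ hl0 hl1
  have E1 : 4 * l ^ 3 * (-(2 * β / n) - 4 * ς) ≥ -(4 * l ^ 3 * S) - 16 * ε₁ - 8 * β / n := by
    have f1 : 0 ≤ 2 * β / n := by positivity
    have f2 : l ^ 3 * (2 * β / n) ≤ 1 * (2 * β / n) := by gcongr
    have f3 : l ^ 3 * (4 * ς - S) ≤ l ^ 3 * (4 * ε₁) := by gcongr; exact hςS.2
    have f4 : l ^ 3 * (4 * ε₁) ≤ 1 * (4 * ε₁) := by gcongr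
    have f5 : 8 * β / n = 4 * (2 * β / n) := by ring
    linarith
  have E2 : 6 * l ^ 2 * (16 * ς * (1 - l) - 32 / x ^ 2 / n) ≥
      24 * S * l ^ 2 * (1 - l) - 96 * ε₁ - 192 / x ^ 2 / n := by
    have f1 : 0 ≤ 32 / x ^ 2 / n := by positivity
    have f2 : l ^ 2 * (32 / x ^ 2 / n) ≤ 1 * (32 / x ^ 2 / n) := by gcongr
    have f3 : 0 ≤ l ^ 2 * (1 - l) := mul_nonneg (by positivity) (by linarith)
    have f4 : l ^ 2 * (1 - l) ≤ 1 := by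
      calc l ^ 2 * (1 - l) ≤ 1 * 1 := by gcongr; linarith
        _ = 1 := one_mul 1
    have f5 : l ^ 2 * (1 - l) * (S - 4 * ς) ≤ l ^ 2 * (1 - l) * (4 * ε₁) := by
      gcongr; linarith
    have f6 : l ^ 2 * (1 - l) * (4 * ε₁) ≤ 1 * (4 * ε₁) := by gcongr
    have f7 : 192 / x ^ 2 / n = 6 * (32 / x ^ 2 / n) := by ring
    linarith
  have hfin : (8 * β + 192 / x ^ 2 + 2048 / x ^ 4) / n =
      8 * β / n + 192 / x ^ 2 / n + 2048 / x ^ 4 / n := by ring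
  rw [hfin]
  linarith

end Bump

/-! ### Lower bound on the mass near the branch. -/

section Anticoncentration

variable {β : ℝ}

/-- Close to the critical point the total jump rate is nearly constant. -/
lemma exists_rate_add_near_critical (hβ : 1 < β) (b : ℝ) {ε : ℝ} (hε : 0 < ε) :
    ∃ n₀ : ℝ, 1 ≤ n₀ ∧ ∀ (N : ℕ) (n : ℝ), 1 ≤ N → n₀ ≤ n → n ^ 3 = N → ∀ r : ℝ, r ≠ 0 → |r| ≤ b / n →
      ∀ m ∈ Set.Icc (-1 : ℝ) 1, |m - branch β r| ≤ 1 / n →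
      |(ratePlus β N m (-hc β * Real.cos r) + rateMinus β N m (-hc β * Real.cos r)) / N -
        1 / (2 * β)| ≤ ε := by
  have hmp := mc_pos hβ
  have hml := mc_lt_one hβ
  have hcp := hc_pos hβ
  have hβ0 : 0 < β := by linarith
  set ε' := ε / (2 * (1 + β)) with hε'
  have hε'0 : 0 < ε' := by positivity
  have hbr := (tendsto_branch hβ).mono_right nhdsWithin_le_nhds
  rw [Metric.tendsto_nhdsWithin_nhds] at hbr
  obtain ⟨d, hd, hbr⟩ := hbr ε' hε'0
  refine ⟨1 + 2 / ε' + (|b| + 1) / d + hc β * b ^ 2 * β / ε + 4 * β / ε, ?_, ?_⟩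
  · have : 0 ≤ 2 / ε' := by positivity
    have : 0 ≤ (|b| + 1) / d := by positivity
    have : 0 ≤ hc β * b ^ 2 * β / ε := by positivity
    have : 0 ≤ 4 * β / ε := by positivity
    linarith
  intro N n hN hn hnN r hr0 hrb m hm hmr
  have p1 : 0 ≤ 2 / ε' := by positivity
  have p2 : 0 ≤ (|b| + 1) / d := by positivity
  have p3 : 0 ≤ hc β * b ^ 2 * β / ε := by positivity
  have p4 : 0 ≤ 4 * β / ε := by positivity
  have hn1 : 1 ≤ n := by linarith
  have hn0 : 0 < n := by linarith
  have hN0 : (0 : ℝ) < N := by positivity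
  have hnN1 : n ≤ N := by rw [← hnN]; exact le_self_pow₀ hn1 (by norm_num)
  have hM : |branch β r - mc β| < ε' := by
    refine hbr hr0 ?_
    rw [Real.dist_eq, sub_zero]
    refine hrb.trans_lt ?_
    rw [div_lt_iff₀ hn0]
    have : |b| + 1 ≤ d * n := by
      rw [mul_comm, ← div_le_iff₀ hd]; linarith
    linarith [le_abs_self b]
  have h1 := abs_rate_add_sub_le (β := β) hβ0.le hN (-hc β * Real.cos r) hm
  set τ := Real.tanh (β * (m + -hc β * Real.cos r)) with hτ
  have htc : Real.tanh (β * (mc β + -hc β)) = mc β := by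
    have := tanh_branch hβ 0
    rw [Real.cos_zero, mul_one] at this
    have h2 : branch β 0 = mc β := by simp [branch, mc]
    rwa [h2] at this
  have hmmc : |m - mc β| ≤ 1 / n + ε' := by
    calc |m - mc β| ≤ |m - branch β r| + |branch β r - mc β| := abs_sub_le _ _ _
      _ ≤ _ := by linarith
  have h2 : 1 / n ≤ ε' / 2 := by
    rw [div_le_iff₀ hn0]
    have : 2 / ε' ≤ n := by linarith
    rw [div_le_iff₀ hε'0] at this
    linarith
  have h3 : |-hc β * Real.cos r - -hc β| ≤ ε / (2 * β) := by
    have c1 : -hc β * Real.cos r - -hc β = hc β * (1 - Real.cos r) := by ring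
    have c2 := Real.one_sub_sq_div_two_le_cos (x := r)
    have c3 := Real.cos_le_one r
    rw [c1, abs_mul, abs_of_pos hcp, abs_of_nonneg (by linarith)]
    have c4 : r ^ 2 ≤ b ^ 2 / n := by
      rw [← sq_abs]
      calc |r| ^ 2 ≤ (b / n) ^ 2 := by gcongr
        _ = b ^ 2 / n / n := by rw [div_pow]; field_simp
        _ ≤ b ^ 2 / n := div_le_self (by positivity) hn1
    have c5 : hc β * b ^ 2 * β / ε ≤ n := by linarith
    rw [div_le_iff₀ hε] at c5
    rw [le_div_iff₀ (by positivity)]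
    calc hc β * (1 - Real.cos r) * (2 * β) ≤ hc β * (b ^ 2 / n / 2) * (2 * β) := by
          gcongr; linarith
      _ = hc β * b ^ 2 * β / n := by field_simp
      _ ≤ ε := by rw [div_le_iff₀ hn0]; linarith
  have h4 : |τ - mc β| ≤ β * (1 / n + ε' + ε / (2 * β)) := by
    rw [hτ]
    conv_lhs => rw [← htc]
    refine (abs_tanh_sub_tanh_le _ _).trans ?_
    have : β * (m + -hc β * Real.cos r) - β * (mc β + -hc β) =
        β * ((m - mc β) + (-hc β * Real.cos r - -hc β)) := by ring
    rw [this, abs_mul, abs_of_pos hβ0]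
    gcongr
    exact (abs_add_le _ _).trans (by linarith)
  have h5 : |m * τ - mc β ^ 2| ≤ (1 / n + ε') + β * (1 / n + ε' + ε / (2 * β)) := by
    have c1 : m * τ - mc β ^ 2 = (m - mc β) * τ + mc β * (τ - mc β) := by ring
    rw [c1]
    refine (abs_add_le _ _).trans ?_
    rw [abs_mul, abs_mul, abs_of_pos hmp]
    have c2 : |τ| ≤ 1 := (Real.abs_tanh_lt_one _).le
    have c3 : |m - mc β| * |τ| ≤ |m - mc β| := mul_le_of_le_one_right (abs_nonneg _) c2
    have c4 : mc β * |τ - mc β| ≤ |τ - mc β| := mul_le_of_le_one_left (abs_nonneg _) hml.le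
    linarith
  have h6 : β / N ≤ ε / 4 := by
    rw [div_le_iff₀ hN0]
    have : 4 * β / ε ≤ N := by linarith
    rw [div_le_iff₀ hε] at this
    linarith
  -- At the critical point the tanh equals m_c, so the limiting rate per spin is (1 - m_c²)/2.
  have h7 : 1 / (2 * β) = (1 - mc β ^ 2) / 2 := by
    have := beta_mul_one_sub_mc_sq hβ
    rw [div_eq_iff (by positivity)]
    linarith
  have h8 : (1 / n + ε') + β * (1 / n + ε' + ε / (2 * β)) ≤ 5 / 4 * ε := by
    have c1 : ε' * (1 + β) = ε / 2 := by rw [hε']; field_simp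
    have c2 : β * (ε / (2 * β)) = ε / 2 := by field_simp
    calc _ = (1 / n + ε') * (1 + β) + β * (ε / (2 * β)) := by ring
      _ ≤ (ε' / 2 + ε') * (1 + β) + β * (ε / (2 * β)) := by gcongr
      _ = 3 / 2 * (ε' * (1 + β)) + β * (ε / (2 * β)) := by ring
      _ = 5 / 4 * ε := by rw [c1, c2]; ring
  have h9 : (ratePlus β N m (-hc β * Real.cos r) + rateMinus β N m (-hc β * Real.cos r)) / N -
      1 / (2 * β) = ((ratePlus β N m (-hc β * Real.cos r) +
        rateMinus β N m (-hc β * Real.cos r)) / N - (1 - m * τ) / 2) - (m * τ - mc β ^ 2) / 2 := by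
    rw [h7]; ring
  rw [h9]
  rw [abs_le] at h1 h5 ⊢
  constructor <;> linarith

set_option maxHeartbeats 3000000 in
open Classical in
/-- A lower bound on the mass near the upper branch at the end of a short time interval. -/
theorem exists_anticoncentration (hβ : 1 < β) : ∃ R₀ : ℝ, 0 < R₀ ∧ ∀ τ₁ D x : ℝ, 1 ≤ τ₁ → 0 ≤ D →
    0 < x → x ^ 2 + 10 / β * D ≤ R₀ → ∀ ε : ℝ, 0 < ε → ∃ n₀ : ℝ, 1 ≤ n₀ ∧
    ∀ (N : ℕ) (n : ℝ), 1 ≤ N → n₀ ≤ n → n ^ 3 = N → ∀ (s e Λ : ℝ) (p : ℝ → ℕ → ℝ),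
    e = -(τ₁ * n) → s = -((τ₁ + D) * n) → 0 ≤ Λ → IsFlow β N s e Λ p →
    81 / 256 * (x ^ 2 / (x ^ 2 + 10 / β * D)) *
      ∑ k ∈ Finset.range (N + 1), (if grid N k ∈ {m | (n * (m - branch β (s / n ^ 2))) ^ 2 ≤
        (x ^ 2 + 10 / β * D) / 4} then p s k else 0) ≤
      ∑ k ∈ Finset.range (N + 1), (if grid N k ∈ {m | |n * (m - branch β (e / n ^ 2))| < x}
        then p e k else 0) + Λ * ε := by
  obtain ⟨ρ, δ, hρ, hδ, hδ1, hdrift⟩ := exists_mul_drift_le hβ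
  obtain ⟨C₁, hC₁, hspeed⟩ := exists_abs_branchSpeed_le hβ
  have hβ0 : 0 < β := by linarith
  set S := 2 / β with hS
  have hS0 : 0 < S := by positivity
  have hθ : 10 / β = 5 * S := by rw [hS]; ring
  rw [hθ]
  -- The squared radius of the bump stays below 1 and δ², so that the rate and drift estimates hold
  -- on its support, and below the third bound, so that the branch motion fits into the margin of
  -- `bump_generator_bound`.
  refine ⟨min (min 1 (δ ^ 2)) ((24 / 25 * S / (8 * C₁)) ^ 2), by positivity, ?_⟩
  intro τ₁ D x hτ₁ hD hx hxR ε hε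
  have hR1 : x ^ 2 + 5 * S * D ≤ 1 := hxR.trans ((min_le_left _ _).trans (min_le_left _ _))
  have hRδ : x ^ 2 + 5 * S * D ≤ δ ^ 2 := hxR.trans ((min_le_left _ _).trans (min_le_right _ _))
  have hRC : x ^ 2 + 5 * S * D ≤ (24 / 25 * S / (8 * C₁)) ^ 2 := hxR.trans (min_le_right _ _)
  have hx2 : 0 < x ^ 2 := by positivity
  set ε₁ := ε * x ^ 2 / (2 * 112 * (D + 1)) with hε₁
  have hε₁0 : 0 < ε₁ := by positivity
  obtain ⟨n₁, hn₁, hrate⟩ := exists_rate_add_near_critical hβ (τ₁ + D) hε₁0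
  set Q := 8 * β + 192 / x ^ 2 + 2048 / x ^ 4 with hQ
  have hQ0 : 0 < Q := by positivity
  set n₂ := 2 * Q * (D + 1) / (ε * x ^ 2) with hn₂
  have hn₂0 : 0 < n₂ := by positivity
  refine ⟨n₁ + n₂ + 2 * (τ₁ + D), by linarith, ?_⟩
  intro N n hN hn hnN s e Λ p he hs hΛ hp
  have hn1 : 1 ≤ n := by linarith
  have hn0 : 0 < n := by linarith
  have hN0 : (0 : ℝ) < N := by positivity
  have hse : s ≤ e := by rw [he, hs]; linarith [mul_nonneg hD hn0.le]
  -- Backwards in time the squared radius grows at 5 times the diffusivity S/n of v, from x² at time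
  -- e to x² + 5SD at time s. The amplitude x²/R makes F at time e at most the indicator of |v| < x.
  set R : ℝ → ℝ := fun t => x ^ 2 + 5 * S * (e - t) / n with hR
  have hRlow : ∀ t ∈ Set.Icc s e, x ^ 2 ≤ R t := by
    intro t ht
    have : 0 ≤ 5 * S * (e - t) / n := by
      have := ht.2
      have : 0 ≤ e - t := by linarith
      positivity
    simp only [hR]; linarith
  have hRup : ∀ t ∈ Set.Icc s e, R t ≤ x ^ 2 + 5 * S * D := by
    intro t ht
    have h1 : (e - t) / n ≤ D := by
      rw [div_le_iff₀ hn0]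
      have := ht.1
      rw [he]; rw [hs] at this; linarith
    have h2 : 5 * S * (e - t) / n = 5 * S * ((e - t) / n) := by ring
    simp only [hR]
    rw [h2]; gcongr
  have hRs : R s = x ^ 2 + 5 * S * D := by
    simp only [hR]; rw [he, hs]; field_simp; ring
  have hRe : R e = x ^ 2 := by simp [hR]
  set l : ℝ → ℝ → ℝ := fun t m => 1 - (n * (m - branch β (t / n ^ 2))) ^ 2 / R t with hl
  set F : ℝ → ℝ → ℝ := fun t m => x ^ 2 / R t * max (l t m) 0 ^ 4 with hF
  set F' : ℝ → ℝ → ℝ := fun t m => x ^ 2 * (5 * S / n) / R t ^ 2 * max (l t m) 0 ^ 4 +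
    x ^ 2 / R t * (4 * max (l t m) 0 ^ 3 *
      ((2 * (n * (m - branch β (t / n ^ 2))) * branchSpeed β (t / n ^ 2) / R t -
        (n * (m - branch β (t / n ^ 2))) ^ 2 * (5 * S) / R t ^ 2) / n)) with hF'
  set W := 1 / x ^ 2 * (112 * ε₁ + Q / n) with hW
  have hW0 : 0 ≤ W := by positivity
  have hr : ∀ t ∈ Set.Icc s e, t / n ^ 2 ≠ 0 ∧ |t / n ^ 2| ≤ Real.pi / 2 ∧
      |t / n ^ 2| ≤ (τ₁ + D) / n ∧ 1 / n ≤ |t / n ^ 2| := by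
    intro t ht
    have ht1 : t ≤ -(τ₁ * n) := he ▸ ht.2
    have ht2 : -((τ₁ + D) * n) ≤ t := hs ▸ ht.1
    have h1 : t < 0 := by linarith [mul_pos (by linarith : 0 < τ₁) hn0]
    have h2 : |t / n ^ 2| = -t / n ^ 2 := by
      rw [abs_of_neg (div_neg_of_neg_of_pos h1 (by positivity)), neg_div]
    have h3 : |t / n ^ 2| ≤ (τ₁ + D) / n := by
      rw [h2, div_le_div_iff₀ (by positivity) hn0]; linarith [mul_le_mul_of_nonneg_right ht2 hn0.le]
    refine ⟨(div_neg_of_neg_of_pos h1 (by positivity)).ne, h3.trans ?_, h3, ?_⟩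
    · have : (τ₁ + D) / n ≤ 1 / 2 := by rw [div_le_iff₀ hn0]; linarith
      linarith [Real.pi_gt_three]
    · rw [h2, div_le_div_iff₀ hn0 (by positivity)]
      linarith [mul_le_mul_of_nonneg_right ht1 hn0.le,
        mul_le_mul_of_nonneg_right hτ₁ (sq_nonneg n)]
  have key := hp.sum_le_of_supersolution hN hse (F := fun t m => -F t m) (F' := fun t m => -F' t m)
    (S := fun t => W / n * t) (S' := fun _ => W / n) ?_ (fun t _ => hasDerivAt_const_mul _) ?_
  · have hWD : W / n * e - W / n * s ≤ ε := by
      have h1 : W / n * e - W / n * s = W * D := by rw [he, hs]; field_simp; ring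
      rw [h1]
      have h2 : 112 * ε₁ ≤ ε * x ^ 2 / (2 * (D + 1)) := by
        rw [hε₁]; apply le_of_eq; field_simp
      have h3 : Q / n ≤ ε * x ^ 2 / (2 * (D + 1)) := by
        have : n₂ ≤ n := by linarith
        rw [hn₂, div_le_iff₀ (by positivity)] at this
        rw [div_le_div_iff₀ hn0 (by positivity)]
        linarith
      calc W * D ≤ 1 / x ^ 2 * (ε * x ^ 2 / (2 * (D + 1)) + ε * x ^ 2 / (2 * (D + 1))) * D := by
            rw [hW]; gcongr
        _ = ε * (D / (D + 1)) := by field_simp; ring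
        _ ≤ ε * 1 := by
            gcongr
            rw [div_le_one (by positivity)]; linarith
        _ = ε := mul_one ε
    have h1 : ∑ k ∈ Finset.range (N + 1), p e k * F e (grid N k) ≤
        ∑ k ∈ Finset.range (N + 1), (if grid N k ∈ {m | |n * (m - branch β (e / n ^ 2))| < x}
        then p e k else 0) := by
      refine Finset.sum_le_sum fun k _ => ?_
      have hp0 := hp.nonneg e (Set.right_mem_Icc.2 hse) k
      have hFe : F e (grid N k) = max (l e (grid N k)) 0 ^ 4 := by
        simp only [hF]; rw [hRe, div_self hx2.ne', one_mul]
      rw [hFe]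
      split_ifs with h
      · have h2 : max (l e (grid N k)) 0 ≤ 1 := by
          refine max_le ?_ zero_le_one
          simp only [hl]
          have : 0 ≤ (n * (grid N k - branch β (e / n ^ 2))) ^ 2 / R e := by
            rw [hRe]; positivity
          linarith
        exact mul_le_of_le_one_right hp0 (pow_le_one₀ (le_max_right _ _) h2)
      · simp only [Set.mem_ofPred_eq, not_lt] at h
        have h2 : l e (grid N k) ≤ 0 := by
          simp only [hl]
          rw [hRe, sub_nonpos, le_div_iff₀ hx2, one_mul, ← sq_abs (n * _)]
          gcongr
        rw [max_eq_right h2]; simp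
    have h2 : 81 / 256 * (x ^ 2 / (x ^ 2 + 5 * S * D)) *
        ∑ k ∈ Finset.range (N + 1), (if grid N k ∈ {m | (n * (m - branch β (s / n ^ 2))) ^ 2 ≤
        (x ^ 2 + 5 * S * D) / 4} then p s k else 0) ≤
        ∑ k ∈ Finset.range (N + 1), p s k * F s (grid N k) := by
      rw [Finset.mul_sum]
      refine Finset.sum_le_sum fun k _ => ?_
      have hp0 := hp.nonneg s (Set.left_mem_Icc.2 hse) k
      have hRs0 : 0 < x ^ 2 + 5 * S * D := by positivity
      split_ifs with h
      · simp only [Set.mem_ofPred_eq] at h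
        -- On v² ≤ R/4 the bump is at least (3/4)⁴ = 81/256, times the amplitude x²/R.
        have h3 : 3 / 4 ≤ max (l s (grid N k)) 0 := by
          refine le_max_of_le_left ?_
          simp only [hl]
          rw [hRs]
          have : (n * (grid N k - branch β (s / n ^ 2))) ^ 2 / (x ^ 2 + 5 * S * D) ≤ 1 / 4 := by
            rw [div_le_iff₀ hRs0]; linarith
          linarith
        have h4 : (81 : ℝ) / 256 ≤ max (l s (grid N k)) 0 ^ 4 := by
          calc (81 : ℝ) / 256 = (3 / 4) ^ 4 := by norm_num
            _ ≤ _ := by gcongr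
        simp only [hF]
        rw [hRs, mul_comm (p s k)]
        gcongr ?_ * _
        rw [mul_comm]
        gcongr
      · rw [mul_zero]
        refine mul_nonneg hp0 ?_
        simp only [hF]; rw [hRs]; positivity
    have h3 : Λ * (W / n * e - W / n * s) ≤ Λ * ε := by gcongr
    simp only [mul_neg, Finset.sum_neg_distrib] at key
    linarith
  · intro t ht k _
    have hR0 : 0 < R t := hx2.trans_le (hRlow t ht)
    have h3 : HasDerivAt (fun t : ℝ => t / n ^ 2) (1 / n ^ 2) t := (hasDerivAt_id t).div_const _
    obtain ⟨q1, q2, -⟩ := hr t ht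
    have h4 := (hasDerivAt_branch hβ (cos_ne_one q1 q2)).comp t h3
    have h5 : HasDerivAt R (-(5 * S / n)) t := by
      refine ((((((hasDerivAt_id t).const_sub e).const_mul (5 * S)).div_const n)).const_add
        (x ^ 2)).congr_deriv ?_
      ring
    have h6 : HasDerivAt (fun t => l t (grid N k))
        ((2 * (n * (grid N k - branch β (t / n ^ 2))) * branchSpeed β (t / n ^ 2) / R t -
          (n * (grid N k - branch β (t / n ^ 2))) ^ 2 * (5 * S) / R t ^ 2) / n) t := by
      refine ((((((h4.const_sub (grid N k)).const_mul n).pow 2)).div h5 hR0.ne').const_sub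
        1).congr_deriv ?_
      simp only [Function.comp, Pi.pow_apply]
      field_simp
      norm_num
      ring
    have h7 := (hasDerivAt_max_zero_pow 2 (l t (grid N k))).comp t h6
    have h8 := (((hasDerivAt_const t (x ^ 2)).div h5 hR0.ne').mul h7).neg
    refine h8.congr_deriv ?_
    simp only [hF', Function.comp, Pi.div_apply]
    norm_num
  · intro t ht k hk
    obtain ⟨hr0, hr1, hr2, hr3⟩ := hr t ht
    have hR0 : 0 < R t := hx2.trans_le (hRlow t ht)
    have hm := grid_mem hN hk
    have hcp := ratePlus_nonneg (β := β) (N := N) (CurieWeiss.hN β N t) hm.2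
    have hcm := rateMinus_nonneg (β := β) (N := N) (CurieWeiss.hN β N t) hm.1
    have hsum := rate_add_le (β := β) (N := N) (CurieWeiss.hN β N t) hm
    have hdr := hdrift N hN _ hr1 _ hm
    have hra := hrate N n hN (by linarith) hnN _ hr0 hr2 _ hm
    rw [← hN_eq hn0 hnN] at hdr hra
    have hsp := hspeed _ hr0 hr1
    unfold generator
    simp only
    set m := grid N k
    set cp := ratePlus β N m (CurieWeiss.hN β N t)
    set cm := rateMinus β N m (CurieWeiss.hN β N t)
    have hF0 : ∀ m, 0 ≤ F t m := fun m => by simp only [hF]; positivity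
    -- Off the support F and its time derivative vanish, and jumps can only increase F.
    rcases le_or_gt (l t m) 0 with hl0 | hl0
    · have e1 : F t m = 0 := by simp only [hF]; rw [max_eq_right hl0]; simp
      have e2 : F' t m = 0 := by simp only [hF']; rw [max_eq_right hl0]; simp
      rw [e1, e2]
      have h1 := mul_nonneg hcp (hF0 (m + 2 / N))
      have h2 := mul_nonneg hcm (hF0 (m - 2 / N))
      have h3 : 0 ≤ W / n := by positivity
      linarith
    · set v := n * (m - branch β (t / n ^ 2)) with hv
      set M' := branchSpeed β (t / n ^ 2) with hM'
      have hlv : l t m = 1 - v ^ 2 / R t := rfl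
      have hw : m - branch β (t / n ^ 2) = v / n := by rw [hv]; field_simp
      have hvR : v ^ 2 ≤ R t := by
        rw [hlv, sub_pos, div_lt_one hR0] at hl0; exact hl0.le
      have hRt := hRup t ht
      have hv1 : |v| ≤ 1 := abs_le_of_sq_le_sq (by linarith) zero_le_one
      have hvδ : |v| ≤ δ := abs_le_of_sq_le_sq (by linarith) hδ.le
      have hD : v * (2 / N * (cp - cm)) ≤ |v| * (β / n ^ 3) := by
        have c1 := hdr (by
          have c2 : δ * (1 / n) ≤ δ * |t / n ^ 2| := by gcongr
          have c3 : |v| / n ≤ δ / n := by gcongr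
          have c4 : -(|v| / n) ≤ v / n := by
            rw [← neg_div]; gcongr; exact neg_abs_le v
          rw [hw]
          linarith [mul_one_div δ n])
        rw [hw, abs_div v n, abs_of_pos hn0] at c1
        have c2 : 0 ≤ ρ * |t / n ^ 2| * (v / n) ^ 2 := by positivity
        calc v * (2 / N * (cp - cm)) = n * (v / n * (2 / N * (cp - cm))) := by field_simp
          _ ≤ n * (|v| / n * (β / N)) :=
            mul_le_mul_of_nonneg_left (by linarith) hn0.le
          _ = _ := by rw [← hnN]; field_simp
      have hςS : |4 * ((cp + cm) / N) - S| ≤ 4 * ε₁ := by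
        have c1 := hra (by
          rw [hw, abs_div, abs_of_pos hn0]; gcongr)
        have c2 : 4 * ((cp + cm) / N) - S = 4 * ((cp + cm) / N - 1 / (2 * β)) := by
          rw [hS]; field_simp; ring
        rw [c2, abs_mul, abs_of_pos (by norm_num : (0 : ℝ) < 4)]
        gcongr
      have hsq : √(R t) ≤ 24 / 25 * S / (8 * C₁) :=
        Real.sqrt_le_iff.2 ⟨by positivity, by linarith⟩
      have hbump := bump_generator_bound (v := v) (M' := M') (R := R t) (l := l t m)
        (ς := (cp + cm) / N) (D := 2 / N * (cp - cm)) hβ0.le hS0 hn1 hnN hx (hRlow t ht)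
        (by linarith) (by rw [le_div_iff₀ (by positivity)] at hsq; linarith) hlv hl0.le hsp
        (by field_simp) hςS ((div_le_one hN0).2 hsum) hcp hcm (by rw [hnN]; field_simp) hD
      rw [← hQ] at hbump
      have eP : l t (m + 2 / N) = l t m + -(4 * v / n ^ 2 + 4 / n ^ 4) / R t := by
        simp only [hl]
        rw [show m + 2 / (N : ℝ) - branch β (t / n ^ 2) = v / n + 2 / n ^ 3 by
          rw [← hw, hnN]; ring, hw]
        field_simp
        ring
      have eM : l t (m - 2 / N) = l t m + -(-(4 * v / n ^ 2) + 4 / n ^ 4) / R t := by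
        simp only [hl]
        rw [show m - 2 / (N : ℝ) - branch β (t / n ^ 2) = v / n - 2 / n ^ 3 by
          rw [← hw, hnN]; ring, hw]
        field_simp
        ring
      set l₀ := l t m with hl₀
      set ΔP := -(4 * v / n ^ 2 + 4 / n ^ 4) / R t
      set ΔM := -(-(4 * v / n ^ 2) + 4 / n ^ 4) / R t
      have gP := max_add_zero_pow_four_ge (Δ := ΔP) hl0.le
      have gM := max_add_zero_pow_four_ge (Δ := ΔM) hl0.le
      set A := x ^ 2 / R t with hA
      have hA0 : 0 < A := by positivity
      have fP : A * (4 * l₀ ^ 3 * ΔP + 6 * l₀ ^ 2 * ΔP ^ 2 + 4 * l₀ * ΔP ^ 3) ≤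
          F t (m + 2 / N) - F t m := by
        simp only [hF]
        rw [eP, ← hl₀, ← hA, max_eq_left hl0.le, ← mul_sub]
        gcongr; linarith
      have fM : A * (4 * l₀ ^ 3 * ΔM + 6 * l₀ ^ 2 * ΔM ^ 2 + 4 * l₀ * ΔM ^ 3) ≤
          F t (m - 2 / N) - F t m := by
        simp only [hF]
        rw [eM, ← hl₀, ← hA, max_eq_left hl0.le, ← mul_sub]
        gcongr; linarith
      have fP' := mul_le_mul_of_nonneg_left fP hcp
      have fM' := mul_le_mul_of_nonneg_left fM hcm
      have fT : F' t m = A / n * (5 * S * l₀ ^ 4 / R t + 4 * l₀ ^ 3 *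
          (2 * v * M' / R t - v ^ 2 * (5 * S) / R t ^ 2)) := by
        simp only [hF']
        rw [← hl₀, max_eq_left hl0.le, ← hv, hA, ← hM']
        field_simp
      set err := 112 * ε₁ + Q / n with herr
      have herr0 : 0 ≤ err := by positivity
      set BB := 5 * S * l₀ ^ 4 / R t + 4 * l₀ ^ 3 *
          (2 * v * M' / R t - v ^ 2 * (5 * S) / R t ^ 2) with hBB
      set J := cp * (4 * l₀ ^ 3 * ΔP + 6 * l₀ ^ 2 * ΔP ^ 2 + 4 * l₀ * ΔP ^ 3) +
        cm * (4 * l₀ ^ 3 * ΔM + 6 * l₀ ^ 2 * ΔM ^ 2 + 4 * l₀ * ΔM ^ 3) with hJ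
      have hfin : -(W / n) ≤ A / n * (BB + n * J) := by
        have c1 : -(A / (n * R t) * err) ≤ A / n * (BB + n * J) := by
          have c2 := mul_le_mul_of_nonneg_left hbump (by positivity : 0 ≤ A / (n * R t))
          calc -(A / (n * R t) * err) = A / (n * R t) * -err := by ring
            _ ≤ A / (n * R t) * (R t * (BB + n * J)) := c2
            _ = _ := by field_simp
        refine le_trans ?_ c1
        rw [neg_le_neg_iff, hW]
        have c3 : A / R t ≤ 1 / x ^ 2 := by
          rw [hA, div_div, div_le_div_iff₀ (by positivity) hx2]
          rw [one_mul]
          exact mul_le_mul (hRlow t ht) (hRlow t ht) hx2.le hR0.le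
        calc A / (n * R t) * err = A / R t * err / n := by field_simp
          _ ≤ 1 / x ^ 2 * err / n := by gcongr
      have hexp : A / n * (BB + n * J) = A / n * BB + A * J := by field_simp
      rw [fT]
      have hAJ : A * J = cp * (A * (4 * l₀ ^ 3 * ΔP + 6 * l₀ ^ 2 * ΔP ^ 2 + 4 * l₀ * ΔP ^ 3)) +
        cm * (A * (4 * l₀ ^ 3 * ΔM + 6 * l₀ ^ 2 * ΔM ^ 2 + 4 * l₀ * ΔM ^ 3)) := by rw [hJ]; ring
      linarith

end Anticoncentration

/-! ### Masses of sets under a flow. -/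

section Mass

variable {β : ℝ} {N : ℕ} {s e Λ t : ℝ} {p : ℝ → ℕ → ℝ} {S S' : Set ℝ}

open Classical in
/-- The mass that a flow puts on the set `S` at time `t`. -/
noncomputable def massIn (N : ℕ) (p : ℝ → ℕ → ℝ) (t : ℝ) (S : Set ℝ) : ℝ :=
  ∑ k ∈ Finset.range (N + 1), if grid N k ∈ S then p t k else 0

lemma IsFlow.massIn_mono (hp : IsFlow β N s e Λ p) (ht : t ∈ Set.Icc s e) (h : S ⊆ S') :
    massIn N p t S ≤ massIn N p t S' := by
  refine Finset.sum_le_sum fun k _ => ?_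
  have := hp.nonneg t ht k
  by_cases h1 : grid N k ∈ S
  · simp [h1, h h1]
  · rw [if_neg h1]; split_ifs <;> simp [this]

lemma IsFlow.massIn_add_compl (hp : IsFlow β N s e Λ p) (ht : t ∈ Set.Icc s e) :
    massIn N p t S + massIn N p t Sᶜ = Λ := by
  rw [← hp.mass t ht, massIn, massIn, ← Finset.sum_add_distrib]
  refine Finset.sum_congr rfl fun k _ => ?_
  by_cases h1 : grid N k ∈ S <;> simp [h1]

end Mass

/-! ### Barrier estimates as bounds on masses, and the scaling constants. -/

section TailMass

variable {β : ℝ}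

lemma tail_massIn (hβ : 1 < β) : ∃ a κ C τ₀ : ℝ, 0 < a ∧ 0 < κ ∧ 0 < C ∧ 0 < τ₀ ∧
    ∀ (N : ℕ) (n : ℝ), 1 ≤ N → 1 ≤ n → n ^ 3 = N → ∀ (s e Λ σ τ₁ B : ℝ) (p : ℝ → ℕ → ℝ), s ≤ e →
      (σ = 1 ∨ σ = -1) → τ₀ ≤ τ₁ → 0 ≤ B → B ≤ κ * τ₁ ^ 3 →
      (∀ t ∈ Set.Icc s e, τ₁ ≤ σ * t / n ∧ |t / n ^ 2| ≤ Real.pi / 2) → 0 ≤ Λ →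
      IsFlow β N s e Λ p → ∀ g : ℝ,
      massIn N p e {m | B + ((e / n) ^ 2 - τ₁ ^ 2) ≤
          a * (σ * e / n) * (n * (m - branch β (e / n ^ 2))) ^ 2} ≤
        2 * (massIn N p s {m | g < a * (σ * s / n) * (n * (m - branch β (s / n ^ 2))) ^ 2} +
          Λ * (Real.exp (g - (B + ((s / n) ^ 2 - τ₁ ^ 2))) + C * Real.exp (-B))) := by
  obtain ⟨a, κ, C, τ₀, h1, h2, h3, h4, h⟩ := exists_gaussian_tail hβ
  refine ⟨a, κ, C, τ₀, h1, h2, h3, h4, fun N n hN hn hnN s e Λ σ τ₁ B p a1 a2 a3 a4 a5 a6 a7 a8 g => ?_⟩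
  have := h N n hN hn hnN s e Λ σ τ₁ B p a1 a2 a3 a4 a5 a6 a7 a8 g
  unfold massIn
  convert this

lemma macroscopic_massIn (hβ : 1 < β) {η : ℝ} (hη : 0 < η) :
    ∃ ρ δ C : ℝ, 0 < ρ ∧ 0 < δ ∧ 0 < C ∧ ∀ (N : ℕ) (n : ℝ), 1 ≤ N → 1 ≤ n → n ^ 3 = N →
      ∀ (s e Λ : ℝ) (p : ℝ → ℕ → ℝ), s ≤ e →
      (∀ t ∈ Set.Icc s e, η ≤ |t / n ^ 2| ∧ |t / n ^ 2| ≤ Real.pi / 2) → IsFlow β N s e Λ p →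
      ∀ l d ω : ℝ, 0 ≤ l → l ≤ ρ → 0 < d → d ≤ δ → 0 ≤ ω →
      massIn N p e {m | d ^ 2 ≤ (m - branch β (e / n ^ 2)) ^ 2 * Real.exp (l * (e - s))} ≤
        2 * (massIn N p s {m | ω < |m - branch β (s / n ^ 2)|} +
          Λ * (ω ^ 2 / d ^ 2 + C * Real.exp (l * (e - s)) * (e - s) / (N * d ^ 2))) := by
  obtain ⟨ρ, δ, C, h1, h2, h3, h⟩ := exists_macroscopic_contraction hβ hη
  refine ⟨ρ, δ, C, h1, h2, h3, fun N n hN hn hnN s e Λ p a1 a2 a3 l d ω b1 b2 b3 b4 b5 => ?_⟩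
  have := h N n hN hn hnN s e Λ p a1 a2 a3 l d ω b1 b2 b3 b4 b5
  unfold massIn
  convert this

lemma anticoncentration_massIn (hβ : 1 < β) : ∃ R₀ : ℝ, 0 < R₀ ∧ ∀ τ₁ D x : ℝ, 1 ≤ τ₁ → 0 ≤ D → 0 < x →
    x ^ 2 + 10 / β * D ≤ R₀ → ∀ ε : ℝ, 0 < ε → ∃ n₀ : ℝ, 1 ≤ n₀ ∧
    ∀ (N : ℕ) (n : ℝ), 1 ≤ N → n₀ ≤ n → n ^ 3 = N → ∀ (s e Λ : ℝ) (p : ℝ → ℕ → ℝ),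
      e = -(τ₁ * n) → s = -((τ₁ + D) * n) → 0 ≤ Λ → IsFlow β N s e Λ p →
      81 / 256 * (x ^ 2 / (x ^ 2 + 10 / β * D)) *
        massIn N p s {m | (n * (m - branch β (s / n ^ 2))) ^ 2 ≤ (x ^ 2 + 10 / β * D) / 4} ≤
      massIn N p e {m | |n * (m - branch β (e / n ^ 2))| < x} + Λ * ε := by
  obtain ⟨R₀, h1, h⟩ := exists_anticoncentration hβ
  refine ⟨R₀, h1, fun τ₁ D x a1 a2 a3 a4 ε a5 => ?_⟩
  obtain ⟨n₀, h2, h3⟩ := h τ₁ D x a1 a2 a3 a4 ε a5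
  refine ⟨n₀, h2, fun N n b1 b2 b3 s e Λ p c1 c2 c3 c4 => ?_⟩
  have := h3 N n b1 b2 b3 s e Λ p c1 c2 c3 c4
  unfold massIn
  convert this

/-- The slope of the branch at the critical point is exactly what μ and ν normalize to 1; fourth
powers remove the roots. -/
lemma nu_mul_mu_mul_sqrt (hβ : 1 < β) : nu β * mu β * √(hc β / (2 * β * mc β)) = 1 := by
  have h1 := hc_pos hβ
  have h2 := mc_pos hβ
  have h0 : 0 < β := by linarith
  have hP : 0 < nu β * mu β * √(hc β / (2 * β * mc β)) := by unfold nu mu; positivity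
  have key : (nu β * mu β * √(hc β / (2 * β * mc β))) ^ 4 = 1 := by
    have e1 : (nu β) ^ 4 = (β * mc β) ^ 3 * (2 / hc β) := by
      unfold nu
      rw [mul_pow, ← Real.rpow_mul_natCast (by positivity), ← Real.rpow_mul_natCast (by positivity)]
      norm_num
    have e2 : (mu β) ^ 4 = 2 / (β * hc β * mc β) := by
      unfold mu
      rw [← Real.rpow_mul_natCast (by positivity)]
      norm_num
    have e3 : √(hc β / (2 * β * mc β)) ^ 4 = (hc β / (2 * β * mc β)) ^ 2 := by
      rw [show 4 = 2 * 2 by norm_num, pow_mul, Real.sq_sqrt (by positivity)]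
    rw [mul_pow, mul_pow, e1, e2, e3]
    field_simp
  exact (pow_eq_one_iff_of_nonneg hP.le (by norm_num)).1 key

lemma mu_pos (hβ : 1 < β) : 0 < mu β := by
  have h1 := hc_pos hβ
  have h2 := mc_pos hβ
  have h0 : 0 < β := by linarith
  unfold mu; positivity

lemma nu_pos (hβ : 1 < β) : 0 < nu β := by
  have h1 := hc_pos hβ
  have h2 := mc_pos hβ
  have h0 : 0 < β := by linarith
  unfold nu; positivity

/-- On the time scale `n` around the critical time the branch is a rescaled absolute value. -/
lemma tendsto_rescaled_branch (hβ : 1 < β) {T σ : ℝ} (hT : 0 < T) (hσ : |σ| = 1) :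
    Tendsto (fun n : ℝ => nu β * n * (branch β (σ * (mu β * T * n) / n ^ 2) - mc β)) atTop (𝓝 T) := by
  have hμ := mu_pos hβ
  have hσ0 : σ ≠ 0 := by rintro rfl; simp at hσ
  have h1 : Tendsto (fun n : ℝ => σ * (mu β * T) / n) atTop (𝓝[≠] 0) := by
    refine tendsto_nhdsWithin_iff.2 ⟨tendsto_const_nhds.div_atTop tendsto_id, ?_⟩
    filter_upwards [eventually_gt_atTop 0] with n hn
    simp only [Set.mem_compl_iff, Set.mem_singleton_iff]
    positivity
  have h2 := ((tendsto_branch_sub_div hβ).comp h1).const_mul (nu β * (mu β * T))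
  rw [show nu β * (mu β * T) * √(hc β / (2 * β * mc β)) = T by
    linear_combination T * nu_mul_mu_mul_sqrt hβ] at h2
  refine h2.congr' ?_
  filter_upwards [eventually_gt_atTop 0] with n hn
  simp only [Function.comp]
  rw [abs_div, abs_mul, hσ, abs_of_pos (mul_pos hμ hT), abs_of_pos hn, show σ * (mu β * T * n) / n ^ 2 = σ * (mu β * T) / n by field_simp]
  field_simp

end TailMass

/-! ### Entering the critical window. -/

section BeforeCritical

variable {β : ℝ}

set_option maxHeartbeats 1600000 in
/-- A flow that starts near the branch long before the critical time has Gaussian tails when it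
enters the critical window. -/
lemma exists_tail_before (hβ : 1 < β) : ∃ a κ C τ₀ : ℝ, 0 < a ∧ 0 < κ ∧ 0 < C ∧ 0 < τ₀ ∧
    ∀ τ₁ B : ℝ, τ₀ ≤ τ₁ → 0 ≤ B → B ≤ κ * τ₁ ^ 3 → ∀ η : ℝ, 0 < η → η ≤ Real.pi / 2 →
    ∀ δ' : ℝ, 0 < δ' → ∃ ω : ℝ, 0 < ω ∧ ∀ᶠ n : ℝ in atTop, ∀ N : ℕ, n ^ 3 = N →
    ∀ (Λ : ℝ) (p : ℝ → ℕ → ℝ), 0 ≤ Λ → IsFlow β N (-(η * n ^ 2)) (-(τ₁ * n)) Λ p →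
      massIn N p (-(η * n ^ 2)) {m | ω < |m - branch β (-(η * n ^ 2) / n ^ 2)|} = 0 →
      massIn N p (-(τ₁ * n)) {m | B ≤ a * τ₁ * (n * (m - branch β (-(τ₁ * n) / n ^ 2))) ^ 2} ≤
        Λ * (2 * C * Real.exp (-B) + δ') := by
  obtain ⟨a, κ, C, τ₀, ha, hκ, hC, hτ₀, htail⟩ := tail_massIn hβ
  refine ⟨a, κ, C, τ₀, ha, hκ, hC, hτ₀, fun τ₁ B hτ₁ hB hBκ η hη hηπ δ' hδ' => ?_⟩
  obtain ⟨ρ, d, C₁, hρ, hd, hC₁, hmac⟩ := macroscopic_massIn hβ (half_pos hη)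
  have hτ₁0 : 0 < τ₁ := hτ₀.trans_le hτ₁
  -- Starting within ω of the branch costs ω²/d² = δ'/12 in the quadratic barrier.
  set ω := d * √(δ' / 12) with hω
  have hω0 : 0 < ω := by positivity
  have hωsq : ω ^ 2 / d ^ 2 = δ' / 12 := by
    rw [hω, mul_pow, Real.sq_sqrt (by positivity)]; field_simp
  refine ⟨ω, hω0, ?_⟩
  have hlog : Tendsto (fun n : ℝ => 8 * C₁ / (ρ * d ^ 2) * (Real.log n / n)) atTop (𝓝 0) := by
    simpa using (Real.isLittleO_log_id_atTop.tendsto_div_nhds_zero).const_mul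
      (8 * C₁ / (ρ * d ^ 2))
  have hexp : Tendsto (fun n : ℝ => 2 * Real.exp (τ₁ ^ 2 +
      n * (a * (Real.pi / 2) * d ^ 2 - (η / 2) ^ 2 * n))) atTop (𝓝 0) := by
    have h1 : Tendsto (fun n : ℝ => a * (Real.pi / 2) * d ^ 2 - (η / 2) ^ 2 * n) atTop atBot :=
      tendsto_atBot_add_const_left _ _ (tendsto_neg_atTop_atBot.comp
        (tendsto_id.const_mul_atTop (by positivity)))
    have h2 := tendsto_atBot_add_const_left _ (τ₁ ^ 2) (tendsto_id.atTop_mul_atBot₀ h1)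
    simpa using (Real.tendsto_exp_atBot.comp h2).const_mul 2
  filter_upwards [eventually_ge_atTop 1, eventually_ge_atTop (2 * τ₁ / η),
    eventually_ge_atTop (4 / (ρ * η)), hlog.eventually_le_const (by positivity : 0 < δ' / 3),
    hexp.eventually_le_const (by positivity : 0 < δ' / 3)] with n hn1 hn2 hn3 hn4 hn5
  intro N hnN Λ p hΛ hp hstart
  have hn0 : 0 < n := by linarith
  have hN0 : (0 : ℝ) < N := by rw [← hnN]; positivity
  have hN : 1 ≤ N := by exact_mod_cast hN0
  -- During this time the distance shrinks from order 1 to d/n, so v becomes bounded; the noise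
  -- contributes an error of order (log n)/n.
  set Δ := 2 * Real.log n / ρ with hΔ
  have hlogn : 0 ≤ Real.log n := Real.log_nonneg hn1
  have hΔ0 : 0 ≤ Δ := by positivity
  have hΔn : Δ ≤ η / 2 * n ^ 2 := by
    have h1 : Real.log n ≤ n := (Real.log_le_sub_one_of_pos hn0).trans (by linarith)
    rw [div_le_iff₀ (by positivity)] at hn3
    rw [hΔ, div_le_iff₀ hρ]
    linarith [mul_le_mul_of_nonneg_right hn3 hn0.le]
  have hτn : τ₁ * n ≤ η / 2 * n ^ 2 := by
    rw [div_le_iff₀ hη] at hn2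
    linarith [mul_le_mul_of_nonneg_right hn2 hn0.le]
  set s := -(η * n ^ 2) with hs
  set e := -(τ₁ * n) with he
  set s' := s + Δ with hs'
  have hs'e : s' ≤ e := by linarith
  have hexpΔ : Real.exp (ρ * (s' - s)) = n ^ 2 := by
    rw [hs', add_sub_cancel_left, hΔ, show ρ * (2 * Real.log n / ρ) = 2 * Real.log n by field_simp,
      mul_comm, Real.exp_mul, Real.exp_log hn0]
    norm_num
  have hrange : ∀ t, s ≤ t → t ≤ 0 → |t / n ^ 2| ≤ Real.pi / 2 := by
    intro t h1 h2
    rw [abs_div, abs_of_nonpos h2, abs_of_pos (by positivity), div_le_iff₀ (by positivity)]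
    linarith [mul_le_mul_of_nonneg_right hηπ (sq_nonneg n)]
  have he0 : e ≤ 0 := by rw [he]; simp; positivity
  have h1 := hmac N n hN hn1 hnN s s' Λ p (by linarith) (by
      intro t ht
      have ht0 : t ≤ -(η / 2 * n ^ 2) := by linarith [ht.2]
      have hh : 0 ≤ η / 2 * n ^ 2 := by positivity
      refine ⟨?_, hrange t ht.1 (by linarith)⟩
      rw [abs_div, abs_of_nonpos (by linarith), abs_of_pos (by positivity),
        le_div_iff₀ (by positivity)]
      linarith)
    (hp.mono le_rfl hs'e) ρ d ω hρ.le le_rfl hd le_rfl hω0.le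
  rw [hexpΔ, hstart, hωsq, zero_add] at h1
  have h2 := htail N n hN hn1 hnN s' e Λ (-1) τ₁ B p hs'e (Or.inr rfl) hτ₁ hB hBκ (by
      intro t ht
      refine ⟨?_, hrange t (by linarith [ht.1]) (ht.2.trans he0)⟩
      rw [le_div_iff₀ hn0]; linarith [ht.2])
    hΛ (hp.mono (by linarith) le_rfl) (a * (Real.pi / 2) * n * d ^ 2)
  have h3 : massIn N p s' {m | a * (Real.pi / 2) * n * d ^ 2 <
      a * (-1 * s' / n) * (n * (m - branch β (s' / n ^ 2))) ^ 2} ≤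
      massIn N p s' {m | d ^ 2 ≤ (m - branch β (s' / n ^ 2)) ^ 2 * n ^ 2} := by
    refine hp.massIn_mono ⟨by linarith, hs'e⟩ fun m hm => ?_
    simp only [Set.mem_ofPred_eq] at hm ⊢
    have c1 : -1 * s' / n ≤ Real.pi / 2 * n := by
      rw [div_le_iff₀ hn0]
      linarith [mul_le_mul_of_nonneg_right hηπ (sq_nonneg n)]
    have c2 : a * (-1 * s' / n) * (n * (m - branch β (s' / n ^ 2))) ^ 2 ≤
        a * (Real.pi / 2 * n) * (n * (m - branch β (s' / n ^ 2))) ^ 2 := by gcongr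
    have c3 : a * (Real.pi / 2 * n) * d ^ 2 <
        a * (Real.pi / 2 * n) * (n * (m - branch β (s' / n ^ 2))) ^ 2 := by linarith
    have c4 := lt_of_mul_lt_mul_left c3 (by positivity)
    rw [mul_pow] at c4
    linarith
  have h4 : C₁ * n ^ 2 * (s' - s) / (N * d ^ 2) ≤ δ' / 12 := by
    rw [hs', add_sub_cancel_left, ← hnN, hΔ]
    have : C₁ * n ^ 2 * (2 * Real.log n / ρ) / (n ^ 3 * d ^ 2) =
      (8 * C₁ / (ρ * d ^ 2) * (Real.log n / n)) / 4 := by field_simp; ring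
    linarith
  -- With v bounded by d the exponent at s' is of order n, while the offset is at least of order n².
  have h5 : Real.exp (a * (Real.pi / 2) * n * d ^ 2 - (B + ((s' / n) ^ 2 - τ₁ ^ 2))) ≤ δ' / 6 := by
    have c1 : (η / 2 * n) ^ 2 ≤ (s' / n) ^ 2 := by
      rw [← neg_sq (s' / n), ← neg_div]
      gcongr
      rw [le_div_iff₀ hn0]
      linarith
    have c2 : Real.exp (a * (Real.pi / 2) * n * d ^ 2 - (B + ((s' / n) ^ 2 - τ₁ ^ 2))) ≤
        Real.exp (τ₁ ^ 2 + n * (a * (Real.pi / 2) * d ^ 2 - (η / 2) ^ 2 * n)) :=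
      Real.exp_le_exp.2 (by linarith)
    linarith
  have h6 : {m | B ≤ a * τ₁ * (n * (m - branch β (e / n ^ 2))) ^ 2} =
      {m | B + ((e / n) ^ 2 - τ₁ ^ 2) ≤
          a * (-1 * e / n) * (n * (m - branch β (e / n ^ 2))) ^ 2} := by
    have c1 : e / n = -τ₁ := by rw [he]; field_simp
    have c2 : -1 * e / n = τ₁ := by rw [he]; field_simp
    ext m
    rw [Set.mem_ofPred_eq, Set.mem_ofPred_eq, c1, c2, neg_sq, sub_self, add_zero]
  rw [h6]
  have h7 : Λ * (δ' / 12 + C₁ * n ^ 2 * (s' - s) / (N * d ^ 2)) ≤ Λ * (δ' / 6) := by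
    gcongr; linarith
  have h8 : Λ * (Real.exp (a * (Real.pi / 2) * n * d ^ 2 - (B + ((s' / n) ^ 2 - τ₁ ^ 2))) +
      C * Real.exp (-B)) ≤ Λ * (δ' / 6 + C * Real.exp (-B)) := by gcongr
  linarith

set_option maxHeartbeats 1600000 in
/-- A flow that starts near the branch long before the critical time does not concentrate too
much around the branch, nor too little, when it enters the critical window. -/
theorem exists_deviation_before (hβ : 1 < β) : ∃ c : ℝ, 0 < c ∧ ∀ E : ℝ, 0 < E → ∀ᶠ τ₁ : ℝ in atTop,
    ∀ x : ℝ, 0 < x → x ≤ E → ∀ η : ℝ, 0 < η → η ≤ Real.pi / 2 →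
    ∀ δ' : ℝ, 0 < δ' → ∃ ω : ℝ, 0 < ω ∧ ∀ᶠ n : ℝ in atTop, ∀ N : ℕ, n ^ 3 = N →
    ∀ (Λ : ℝ) (p : ℝ → ℕ → ℝ), 0 ≤ Λ → IsFlow β N (-(η * n ^ 2)) (-(τ₁ * n)) Λ p →
      massIn N p (-(η * n ^ 2)) {m | ω < |m - branch β (-(η * n ^ 2) / n ^ 2)|} = 0 →
      massIn N p (-(τ₁ * n)) {m | x ≤ |n * (m - branch β (-(τ₁ * n) / n ^ 2))|} ≤
        Λ * (Real.exp (-c * x ^ 2 * τ₁) + δ') := by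
  obtain ⟨a, κ, C, τ₀, ha, hκ, hC, hτ₀, htail⟩ := exists_tail_before hβ
  obtain ⟨R₀, hR₀, hanti⟩ := anticoncentration_massIn hβ
  have hβ0 : 0 < β := by linarith
  set θ := 10 / β with hθ
  have hθ0 : 0 < θ := by positivity
  -- The threshold for x²τ₁: above it the prefactor satisfies 2C ≤ e^{ax²τ₁/2}, so half of the
  -- exponent absorbs it.
  set K := 2 * |Real.log (2 * C)| / a + 1 with hK
  have hK0 : 0 < K := by positivity
  have hKC : 2 * C ≤ Real.exp (a * K / 2) := by
    rw [← Real.log_le_iff_le_exp (by positivity), hK]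
    have : a * (2 * |Real.log (2 * C)| / a + 1) / 2 = |Real.log (2 * C)| + a / 2 := by field_simp
    linarith [le_abs_self (Real.log (2 * C))]
  -- The level at which the tail bound drops to 1/4; with a further error 1/4, at least half of the
  -- mass lies below it.
  set B' := |Real.log (8 * C)| with hB'
  have hB'0 : 0 ≤ B' := abs_nonneg _
  have hB'C : 2 * C * Real.exp (-B') ≤ 1 / 4 := by
    have h1 : 8 * C ≤ Real.exp B' :=
      (Real.log_le_iff_le_exp (by positivity)).1 (le_abs_self _)
    rw [Real.exp_neg, ← div_eq_mul_inv, div_le_iff₀ (Real.exp_pos _)]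
    linarith
  -- The bump starts L/τ₁ earlier on the scale n. Then R ≥ θL/τ₁, and aτ₁R/4 ≥ B' puts half of the
  -- mass into v² ≤ R/4, while R stays of order 1/τ₁.
  set L := 4 * B' / (a * θ) with hL
  have hL0 : 0 ≤ L := by positivity
  set c₅ := 81 / 512 / (K + θ * L) with hc₅
  have hc₅0 : 0 < c₅ := by positivity
  refine ⟨min c₅ (a / 2), by positivity, fun E hE => ?_⟩
  have hKθ : 0 < K + θ * L := by positivity
  filter_upwards [eventually_ge_atTop 1, eventually_ge_atTop τ₀, eventually_ge_atTop (B' / κ),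
    eventually_ge_atTop (a * E ^ 2 / κ), eventually_ge_atTop ((K + θ * L) / R₀)]
    with τ₁ hτ1 hτ2 hτ3 hτ4 hτ5
  intro x hx hxE η hη hηπ δ' hδ'
  have hτ0 : 0 < τ₁ := by linarith
  have hcx : ∀ c, min c₅ (a / 2) ≤ c → Real.exp (-c * x ^ 2 * τ₁) ≤
      Real.exp (-min c₅ (a / 2) * x ^ 2 * τ₁) := fun c hc => by
    refine Real.exp_le_exp.2 ?_
    rw [mul_assoc, mul_assoc, neg_mul, neg_mul, neg_le_neg_iff]
    gcongr
  have hpow : τ₁ ≤ τ₁ ^ 2 := le_self_pow₀ hτ1 two_ne_zero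
  -- Large deviations follow from the tail bound. For small x²τ₁ the tail bound is useless, and the
  -- mass near the branch is bounded from below instead.
  rcases le_or_gt K (x ^ 2 * τ₁) with hcase | hcase
  · have hB : a * τ₁ * x ^ 2 ≤ κ * τ₁ ^ 3 := by
      rw [div_le_iff₀ hκ] at hτ4
      have h1 : x ^ 2 ≤ E ^ 2 := by gcongr
      calc a * τ₁ * x ^ 2 ≤ a * τ₁ * E ^ 2 := by gcongr
        _ = τ₁ * (a * E ^ 2) := by ring
        _ ≤ τ₁ * (τ₁ * κ) := by gcongr
        _ ≤ τ₁ * (τ₁ ^ 2 * κ) := by gcongr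
        _ = _ := by ring
    obtain ⟨ω, hω, hev⟩ := htail τ₁ (a * τ₁ * x ^ 2) hτ2 (by positivity) hB η hη hηπ δ' hδ'
    refine ⟨ω, hω, ?_⟩
    filter_upwards [hev, eventually_ge_atTop (τ₁ / η), eventually_gt_atTop 0] with n hn hn1 hn0
    intro N hnN Λ p hΛ hp hstart
    have hse : -(η * n ^ 2) ≤ -(τ₁ * n) := by
      rw [div_le_iff₀ hη] at hn1; linarith [mul_le_mul_of_nonneg_right hn1 hn0.le]
    refine (hp.massIn_mono (Set.right_mem_Icc.2 hse) fun m hm => ?_).trans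
      ((hn N hnN Λ p hΛ hp hstart).trans ?_)
    · simp only [Set.mem_ofPred_eq] at hm ⊢
      rw [← sq_abs (n * _)]
      gcongr
    · gcongr
      refine le_trans ?_ (hcx (a / 2) (min_le_right _ _))
      calc 2 * C * Real.exp (-(a * τ₁ * x ^ 2)) ≤
          Real.exp (a * K / 2) * Real.exp (-(a * τ₁ * x ^ 2)) := by gcongr
        _ ≤ _ := by
          rw [← Real.exp_add]
          refine Real.exp_le_exp.2 ?_
          have := mul_le_mul_of_nonneg_left hcase ha.le
          linarith
  · set D := L / τ₁ with hD
    have hD0 : 0 ≤ D := by positivity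
    have hxR : x ^ 2 + θ * D = (x ^ 2 * τ₁ + θ * L) / τ₁ := by rw [hD]; field_simp
    have hxR0 : 0 < x ^ 2 + θ * D := by positivity
    have hB : B' ≤ κ * (τ₁ + D) ^ 3 := by
      rw [div_le_iff₀ hκ] at hτ3
      have h1 : τ₁ ≤ (τ₁ + D) ^ 3 := by
        calc τ₁ ≤ τ₁ + D := by linarith
          _ ≤ (τ₁ + D) ^ 3 := le_self_pow₀ (by linarith) (by norm_num)
      linarith [mul_le_mul_of_nonneg_left h1 hκ.le]
    obtain ⟨ω, hω, hev⟩ := htail (τ₁ + D) B' (by linarith) hB'0 hB η hη hηπ (1 / 4) (by norm_num)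
    obtain ⟨n₀, -, hanti'⟩ := hanti τ₁ D x hτ1 hD0 hx (by
      rw [hxR, div_le_iff₀ hτ0]
      rw [div_le_iff₀ hR₀] at hτ5
      linarith) δ' hδ'
    refine ⟨ω, hω, ?_⟩
    filter_upwards [hev, eventually_ge_atTop ((τ₁ + D) / η), eventually_gt_atTop 0,
      eventually_ge_atTop n₀] with n hn hn1 hn0 hn2
    intro N hnN Λ p hΛ hp hstart
    have hN0 : (0 : ℝ) < N := by rw [← hnN]; positivity
    have hN : 1 ≤ N := by exact_mod_cast hN0
    have hsm : -(η * n ^ 2) ≤ -((τ₁ + D) * n) := by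
      rw [div_le_iff₀ hη] at hn1; linarith [mul_le_mul_of_nonneg_right hn1 hn0.le]
    have hme : -((τ₁ + D) * n) ≤ -(τ₁ * n) := by linarith [mul_nonneg hD0 hn0.le]
    have h1 := hn N hnN Λ p hΛ (hp.mono le_rfl hme) hstart
    have h2 := hanti' N n hN hn2 hnN _ _ Λ p rfl rfl hΛ (hp.mono hsm le_rfl)
    set S := {m | (n * (m - branch β (-((τ₁ + D) * n) / n ^ 2))) ^ 2 ≤ (x ^ 2 + θ * D) / 4} with hS
    have h3 := hp.massIn_add_compl (S := S) ⟨hsm, hme⟩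
    have h4 : massIn N p (-((τ₁ + D) * n)) Sᶜ ≤ massIn N p (-((τ₁ + D) * n)) {m | B' ≤
        a * (τ₁ + D) * (n * (m - branch β (-((τ₁ + D) * n) / n ^ 2))) ^ 2} := by
      refine hp.massIn_mono ⟨hsm, hme⟩ fun m hm => ?_
      simp only [hS, Set.mem_compl_iff, Set.mem_ofPred_eq, not_le] at hm ⊢
      have c1 : θ * D / 4 ≤ (n * (m - branch β (-((τ₁ + D) * n) / n ^ 2))) ^ 2 := by
        linarith [sq_nonneg x]
      have c2 : a * τ₁ * (θ * D / 4) = B' := by rw [hD, hL]; field_simp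
      rw [← c2]
      gcongr
      linarith
    have h5 : Λ / 2 ≤ massIn N p (-((τ₁ + D) * n)) S := by
      have : Λ * (2 * C * Real.exp (-B') + 1 / 4) ≤ Λ * (1 / 2) := by gcongr; linarith
      linarith
    have h6 : 2 * c₅ * (x ^ 2 * τ₁) ≤ 81 / 256 * (x ^ 2 / (x ^ 2 + θ * D)) := by
      rw [hxR, hc₅, div_div_eq_mul_div,
        show 2 * (81 / 512 / (K + θ * L)) * (x ^ 2 * τ₁) = 81 / 256 * (x ^ 2 * τ₁ / (K + θ * L)) by
          ring]
      gcongr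
    have h7 : 2 * c₅ * (x ^ 2 * τ₁) * (Λ / 2) ≤
        massIn N p (-(τ₁ * n)) {m | |n * (m - branch β (-(τ₁ * n) / n ^ 2))| < x} + Λ * δ' := by
      refine le_trans ?_ h2
      gcongr
    have h8 := hp.massIn_add_compl (S := {m | |n * (m - branch β (-(τ₁ * n) / n ^ 2))| < x})
      (Set.right_mem_Icc.2 (hsm.trans hme))
    have h9 : {m | |n * (m - branch β (-(τ₁ * n) / n ^ 2))| < x}ᶜ =
        {m | x ≤ |n * (m - branch β (-(τ₁ * n) / n ^ 2))|} := by ext m; simp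
    rw [h9] at h8
    -- The mass within x is at least c₅x²τ₁Λ up to the error, and 1 - y ≤ e^{-y} turns this into the
    -- exponential form.
    have h10 : Λ * (1 - c₅ * x ^ 2 * τ₁) ≤ Λ * Real.exp (-min c₅ (a / 2) * x ^ 2 * τ₁) := by
      gcongr
      refine le_trans ?_ (hcx c₅ (min_le_left _ _))
      linarith [Real.add_one_le_exp (-c₅ * x ^ 2 * τ₁)]
    linarith

end BeforeCritical

/-! ### Leaving the critical window, and stability away from it. -/

section AfterCritical

variable {β : ℝ}

set_option maxHeartbeats 1600000 in
/-- A flow that leaves the critical window near the branch converges to the branch. -/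
theorem exists_convergence_after (hβ : 1 < β) : ∃ c : ℝ, 0 < c ∧ ∀ E : ℝ, 0 < E → ∀ᶠ τ₁ : ℝ in atTop,
    ∀ η : ℝ, 0 < η → η ≤ Real.pi / 2 → ∀ γ : ℝ, 0 < γ → ∀ δ' : ℝ, 0 < δ' →
    ∀ᶠ n : ℝ in atTop, ∀ N : ℕ, n ^ 3 = N →
    ∀ (Λ : ℝ) (p : ℝ → ℕ → ℝ), 0 ≤ Λ → IsFlow β N (τ₁ * n) (η * n ^ 2) Λ p →
      massIn N p (τ₁ * n) {m | E < |n * (m - branch β (τ₁ * n / n ^ 2))|} = 0 →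
      massIn N p (η * n ^ 2)
        {m | (N : ℝ) ^ (-(1 / 2) + γ) < |m - branch β (η * n ^ 2 / n ^ 2)|} ≤
        Λ * (Real.exp (-c * E ^ 2 * τ₁) + δ') := by
  obtain ⟨a, κ, C, τ₀, ha, hκ, hC, hτ₀, htail⟩ := tail_massIn hβ
  refine ⟨a, ha, fun E hE => ?_⟩
  filter_upwards [eventually_ge_atTop 1, eventually_ge_atTop τ₀,
    eventually_ge_atTop ((2 * a * E ^ 2 + 1) / κ), eventually_ge_atTop (Real.log (4 * (1 + C)))]
    with τ₁ hτ1 hτ2 hτ3 hτ4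
  intro η hη hηπ γ hγ δ' hδ'
  have hτ0 : 0 < τ₁ := by linarith
  obtain ⟨ρ, δ, C₁, hρ, hδ, hC₁, hmac⟩ := macroscopic_massIn hβ (half_pos hη)
  set d := min δ 1 with hd
  have hd0 : 0 < d := lt_min hδ one_pos
  set ω := d * √(δ' / 4) with hω
  have hω0 : 0 < ω := by positivity
  have hωsq : ω ^ 2 / d ^ 2 = δ' / 4 := by
    rw [hω, mul_pow, Real.sq_sqrt (by positivity)]; field_simp
  -- The target is reached at a smaller γ' ≤ 1/4, which keeps the exponent q positive; n^{-q} is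
  -- N^{-1 + 2γ'}, the square of the target distance.
  set γ' := min γ (1 / 4) with hγ'
  have hγ'0 : 0 < γ' := lt_min hγ (by norm_num)
  have hγ'1 : γ' ≤ 1 / 4 := min_le_right _ _
  set q := 3 - 6 * γ' with hq
  have hq0 : 0 < q := by linarith
  have hlog : Tendsto (fun n : ℝ => C₁ * q / (ρ * d ^ 2) * (Real.log n / n ^ (6 * γ'))) atTop
      (𝓝 0) := by
    simpa using ((isLittleO_log_rpow_atTop (by linarith : 0 < 6 * γ')).tendsto_div_nhds_zero).const_mul
      (C₁ * q / (ρ * d ^ 2))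
  -- The process starts at level aτ₁E². Twice that level leaves e^{-aτ₁E²}, and the extra τ₁ absorbs
  -- the constant 4(1 + C).
  set B := 2 * a * τ₁ * E ^ 2 + τ₁ with hB
  have hB0 : 0 ≤ B := by positivity
  have hBκ : B ≤ κ * τ₁ ^ 3 := by
    rw [div_le_iff₀ hκ] at hτ3
    calc B = τ₁ * (2 * a * E ^ 2 + 1) := by rw [hB]; ring
      _ ≤ τ₁ * (τ₁ * κ) := by gcongr
      _ = κ * τ₁ ^ 2 := by ring
      _ ≤ κ * τ₁ ^ 3 :=
          mul_le_mul_of_nonneg_left (pow_le_pow_right₀ hτ1 (by norm_num)) hκ.le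
  have hfinal : 4 * (Real.exp (a * τ₁ * E ^ 2 - B) + C * Real.exp (-B)) ≤
      Real.exp (-a * E ^ 2 * τ₁) := by
    have h1 : Real.exp (a * τ₁ * E ^ 2 - B) = Real.exp (-a * E ^ 2 * τ₁) * Real.exp (-τ₁) := by
      rw [← Real.exp_add, hB]; congr 1; ring
    have h2 : Real.exp (-B) ≤ Real.exp (a * τ₁ * E ^ 2 - B) :=
      Real.exp_le_exp.2 (by have : 0 ≤ a * τ₁ * E ^ 2 := by positivity
                            linarith)
    have h3 : 4 * (1 + C) ≤ Real.exp τ₁ := (Real.log_le_iff_le_exp (by positivity)).1 hτ4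
    calc 4 * (Real.exp (a * τ₁ * E ^ 2 - B) + C * Real.exp (-B)) ≤
        4 * (Real.exp (a * τ₁ * E ^ 2 - B) + C * Real.exp (a * τ₁ * E ^ 2 - B)) := by gcongr
      _ = 4 * (1 + C) * Real.exp (a * τ₁ * E ^ 2 - B) := by ring
      _ ≤ Real.exp τ₁ * (Real.exp (-a * E ^ 2 * τ₁) * Real.exp (-τ₁)) := by rw [h1]; gcongr
      _ = Real.exp (-a * E ^ 2 * τ₁) * (Real.exp τ₁ * Real.exp (-τ₁)) := by ring
      _ = _ := by rw [← Real.exp_add, add_neg_cancel, Real.exp_zero, mul_one]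
  filter_upwards [eventually_ge_atTop 1, eventually_ge_atTop (2 * τ₁ / η),
    eventually_ge_atTop (2 * q / (ρ * η)), hlog.eventually_le_const (by positivity : 0 < δ' / 4),
    eventually_ge_atTop B, eventually_ge_atTop ((1 + Real.pi / 2) / (a * ω ^ 2))]
    with n hn1 hn2 hn3 hn4 hn5 hn6
  intro N hnN Λ p hΛ hp hstart
  have hn0 : 0 < n := by linarith
  have hN0 : (0 : ℝ) < N := by rw [← hnN]; positivity
  have hN : 1 ≤ N := by exact_mod_cast hN0
  -- This time gives contraction by n^q in the square; the noise term is of order n^q (log n)/N =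
  -- n^{-6γ'} log n and vanishes.
  set Δ := q * Real.log n / ρ with hΔ
  have hlogn : 0 ≤ Real.log n := Real.log_nonneg hn1
  have hΔ0 : 0 ≤ Δ := by positivity
  have hΔn : Δ ≤ η / 2 * n ^ 2 := by
    have h1 : Real.log n ≤ n := (Real.log_le_sub_one_of_pos hn0).trans (by linarith)
    rw [div_le_iff₀ (by positivity)] at hn3
    rw [hΔ, div_le_iff₀ hρ]
    calc q * Real.log n ≤ q * n := by gcongr
      _ = (2 * q) * n / 2 := by ring
      _ ≤ (n * (ρ * η)) * n / 2 := by gcongr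
      _ = _ := by ring
  have hτn : τ₁ * n ≤ η / 2 * n ^ 2 := by
    rw [div_le_iff₀ hη] at hn2
    linarith [mul_le_mul_of_nonneg_right hn2 hn0.le]
  set s := τ₁ * n with hs
  set e := η * n ^ 2 with he
  set s' := e - Δ with hs'
  have hs0 : 0 < s := by positivity
  have hs'e : s' ≤ e := by linarith
  have hss' : s ≤ s' := by linarith
  have hexpΔ : Real.exp (ρ * (e - s')) = n ^ q := by
    rw [hs', sub_sub_cancel, hΔ, show ρ * (q * Real.log n / ρ) = Real.log n * q by field_simp,
      Real.exp_mul, Real.exp_log hn0]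
  have hrange : ∀ t, 0 ≤ t → t ≤ e → |t / n ^ 2| ≤ Real.pi / 2 := by
    intro t h1 h2
    rw [abs_div, abs_of_nonneg h1, abs_of_pos (by positivity), div_le_iff₀ (by positivity)]
    linarith [mul_le_mul_of_nonneg_right hηπ (sq_nonneg n)]
  have h1 := hmac N n hN hn1 hnN s' e Λ p hs'e (by
      intro t ht
      have ht0 : η / 2 * n ^ 2 ≤ t := by linarith [ht.1]
      have hh : 0 ≤ η / 2 * n ^ 2 := by positivity
      refine ⟨?_, hrange t (by linarith) ht.2⟩
      rw [abs_div, abs_of_nonneg (by linarith), abs_of_pos (by positivity),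
        le_div_iff₀ (by positivity)]
      exact ht0)
    (hp.mono hss' le_rfl) ρ d ω hρ.le le_rfl hd0 (min_le_left _ _) hω0.le
  rw [hexpΔ, hωsq] at h1
  have h2 := htail N n hN hn1 hnN s s' Λ 1 τ₁ B p hss' (Or.inl rfl) hτ2 hB0 hBκ (by
      intro t ht
      refine ⟨?_, hrange t (by linarith [ht.1]) (by linarith [ht.2])⟩
      rw [le_div_iff₀ hn0]; linarith [ht.1])
    hΛ (hp.mono le_rfl hs'e) (a * τ₁ * E ^ 2)
  have hsn : s / n = τ₁ := by rw [hs]; field_simp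
  have h3 : massIn N p s {m | a * τ₁ * E ^ 2 <
      a * (1 * s / n) * (n * (m - branch β (s / n ^ 2))) ^ 2} ≤ 0 := by
    rw [← hstart]
    refine hp.massIn_mono ⟨le_rfl, hss'.trans hs'e⟩ fun m hm => ?_
    simp only [Set.mem_ofPred_eq, one_mul, hsn] at hm ⊢
    have c1 := lt_of_mul_lt_mul_left hm (by positivity)
    exact lt_of_pow_lt_pow_left₀ 2 (abs_nonneg _) (by rwa [sq_abs])
  rw [hsn, sub_self, add_zero] at h2
  have h4 : massIn N p s' {m | ω < |m - branch β (s' / n ^ 2)|} ≤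
      massIn N p s' {m | B + ((s' / n) ^ 2 - τ₁ ^ 2) ≤
          a * (1 * s' / n) * (n * (m - branch β (s' / n ^ 2))) ^ 2} := by
    refine hp.massIn_mono ⟨hss', hs'e⟩ fun m hm => ?_
    simp only [Set.mem_ofPred_eq, one_mul] at hm ⊢
    have c0 : 1 ≤ s' / n := hτ1.trans (by rw [le_div_iff₀ hn0]; exact hss')
    have c1 : s' / n ≤ Real.pi / 2 * n := by
      rw [div_le_iff₀ hn0]
      linarith [mul_le_mul_of_nonneg_right hηπ (sq_nonneg n)]
    have c2 : ω ^ 2 ≤ (m - branch β (s' / n ^ 2)) ^ 2 := by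
      rw [← sq_abs (m - _)]; gcongr
    rw [div_le_iff₀ (by positivity)] at hn6
    set τ := s' / n
    calc B + (τ ^ 2 - τ₁ ^ 2) ≤ n * 1 + τ * τ := by linarith [sq_nonneg τ₁]
      _ ≤ n * τ + τ * (Real.pi / 2 * n) := by gcongr
      _ = τ * n * (1 + Real.pi / 2) := by ring
      _ ≤ τ * n * (n * (a * ω ^ 2)) := by gcongr
      _ = a * τ * n ^ 2 * ω ^ 2 := by ring
      _ ≤ a * τ * n ^ 2 * (m - branch β (s' / n ^ 2)) ^ 2 := by gcongr
      _ = _ := by ring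
  have h5 : C₁ * n ^ q * (e - s') / (N * d ^ 2) ≤ δ' / 4 := by
    rw [hs', sub_sub_cancel, ← hnN, hΔ]
    have c1 : n ^ q * n ^ (6 * γ') = n ^ 3 := by
      rw [← Real.rpow_add hn0, hq, sub_add_cancel]; exact_mod_cast Real.rpow_natCast n 3
    have : C₁ * n ^ q * (q * Real.log n / ρ) / (n ^ 3 * d ^ 2) =
        C₁ * q / (ρ * d ^ 2) * (Real.log n / n ^ (6 * γ')) := by
      have := Real.rpow_pos_of_pos hn0 q
      have := Real.rpow_pos_of_pos hn0 (6 * γ')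
      rw [← c1]; field_simp
    linarith
  have h6 : massIn N p e {m | (N : ℝ) ^ (-(1 / 2) + γ) < |m - branch β (e / n ^ 2)|} ≤
      massIn N p e {m | d ^ 2 ≤ (m - branch β (e / n ^ 2)) ^ 2 * n ^ q} := by
    refine hp.massIn_mono ⟨hss'.trans hs'e, le_rfl⟩ fun m hm => ?_
    simp only [Set.mem_ofPred_eq] at hm ⊢
    have c1 : (N : ℝ) ^ (-(1 / 2) + γ') ≤ (N : ℝ) ^ (-(1 / 2) + γ) :=
      Real.rpow_le_rpow_of_exponent_le (by exact_mod_cast hN) (by linarith [min_le_left γ (1 / 4)])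
    have c2 : ((N : ℝ) ^ (-(1 / 2) + γ')) ^ 2 * n ^ q = 1 := by
      rw [← hnN, ← Real.rpow_natCast n 3, ← Real.rpow_mul hn0.le, ← Real.rpow_mul_natCast hn0.le,
        ← Real.rpow_add hn0, hq]
      norm_num
      ring_nf
      exact Real.rpow_zero n
    have c3 : ((N : ℝ) ^ (-(1 / 2) + γ')) ^ 2 ≤ (m - branch β (e / n ^ 2)) ^ 2 := by
      rw [← sq_abs (m - _)]
      have := c1.trans hm.le
      gcongr
    calc d ^ 2 ≤ 1 := pow_le_one₀ hd0.le (min_le_right _ _)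
      _ = _ := c2.symm
      _ ≤ _ := by gcongr
  have h7 : Λ * (δ' / 4 + C₁ * n ^ q * (e - s') / (N * d ^ 2)) ≤ Λ * (δ' / 2) := by
    gcongr; linarith
  have h8 := mul_le_mul_of_nonneg_left hfinal hΛ
  linarith

/-- A flow that starts near the branch stays near the branch away from the critical time. -/
theorem exists_near_before (hβ : 1 < β) {η : ℝ} (hη : 0 < η) (hηπ : η ≤ Real.pi / 2) {δ' : ℝ}
    (hδ' : 0 < δ') : ∃ ω : ℝ, 0 < ω ∧ ∀ᶠ n : ℝ in atTop, ∀ N : ℕ, n ^ 3 = N →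
    ∀ (Λ : ℝ) (p : ℝ → ℕ → ℝ), 0 ≤ Λ → IsFlow β N (-(Real.pi / 2 * n ^ 2)) (-(η * n ^ 2)) Λ p →
      massIn N p (-(Real.pi / 2 * n ^ 2))
        {m | ω < |m - branch β (-(Real.pi / 2 * n ^ 2) / n ^ 2)|} = 0 →
      massIn N p (-(η * n ^ 2)) {m | 1 < |m - branch β (-(η * n ^ 2) / n ^ 2)|} ≤ Λ * δ' := by
  obtain ⟨ρ, δ, C₁, hρ, hδ, hC₁, hmac⟩ := macroscopic_massIn hβ hη
  set d := min δ 1 with hd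
  have hd0 : 0 < d := lt_min hδ one_pos
  set ω := d * √(δ' / 4) with hω
  have hω0 : 0 < ω := by positivity
  have hωsq : ω ^ 2 / d ^ 2 = δ' / 4 := by
    rw [hω, mul_pow, Real.sq_sqrt (by positivity)]; field_simp
  refine ⟨ω, hω0, ?_⟩
  filter_upwards [eventually_ge_atTop 1, eventually_ge_atTop (C₁ * (Real.pi / 2) / (d ^ 2 * (δ' / 4)))]
    with n hn1 hn2
  intro N hnN Λ p hΛ hp hstart
  have hn0 : 0 < n := by linarith
  have hN0 : (0 : ℝ) < N := by rw [← hnN]; positivity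
  have hN : 1 ≤ N := by exact_mod_cast hN0
  have hse : -(Real.pi / 2 * n ^ 2) ≤ -(η * n ^ 2) := by gcongr
  -- No decay is needed here, so the growth rate is 0: over a time of order n² the noise accumulates
  -- only n²/N = 1/n.
  have h1 := hmac N n hN hn1 hnN _ _ Λ p hse (by
      intro t ht
      have hh : 0 ≤ η * n ^ 2 := by positivity
      rw [abs_div, abs_of_nonpos (by linarith [ht.2]), abs_of_pos (by positivity : 0 < n ^ 2),
        le_div_iff₀ (by positivity), div_le_iff₀ (by positivity)]
      exact ⟨by linarith [ht.2], by linarith [ht.1]⟩) hp 0 d ω le_rfl hρ.le hd0 (min_le_left _ _)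
    hω0.le
  rw [hstart, hωsq, zero_mul, Real.exp_zero, zero_add] at h1
  have h2 : C₁ * 1 * (-(η * n ^ 2) - -(Real.pi / 2 * n ^ 2)) / (N * d ^ 2) ≤ δ' / 4 := by
    rw [div_le_iff₀ (by positivity)] at hn2 ⊢
    have hh : 0 ≤ η * n ^ 2 := by positivity
    calc C₁ * 1 * (-(η * n ^ 2) - -(Real.pi / 2 * n ^ 2)) ≤ C₁ * 1 * (Real.pi / 2 * n ^ 2) := by
          gcongr; linarith
      _ = C₁ * (Real.pi / 2) * n ^ 2 := by ring
      _ ≤ n * (d ^ 2 * (δ' / 4)) * n ^ 2 := by gcongr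
      _ = _ := by rw [← hnN]; ring
  have h3 : Λ * (δ' / 4 + C₁ * 1 * (-(η * n ^ 2) - -(Real.pi / 2 * n ^ 2)) / (N * d ^ 2)) ≤
      Λ * (δ' / 2) := by gcongr; linarith
  refine (hp.massIn_mono ⟨hse, le_rfl⟩ fun m hm => ?_).trans (h1.trans (by linarith))
  simp only [Set.mem_ofPred_eq, mul_one] at hm ⊢
  rw [← sq_abs (m - _)]
  have : d ≤ |m - branch β (-(η * n ^ 2) / n ^ 2)| := (min_le_right _ _).trans hm.le
  gcongr

end AfterCritical

/-! ### The scale n = N^{1/3} and the time window. -/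

section CubeRoot

lemma cbrt_pow_three (N : ℕ) : ((N : ℝ) ^ (1 / 3 : ℝ)) ^ 3 = N := by
  rw [← Real.rpow_mul_natCast (Nat.cast_nonneg N)]; norm_num

lemma rpow_two_thirds (N : ℕ) : (N : ℝ) ^ (2 / 3 : ℝ) = ((N : ℝ) ^ (1 / 3 : ℝ)) ^ 2 := by
  rw [← Real.rpow_mul_natCast (Nat.cast_nonneg N)]; norm_num

lemma tendsto_cbrt : Tendsto (fun N : ℕ => (N : ℝ) ^ (1 / 3 : ℝ)) atTop atTop :=
  (tendsto_rpow_atTop (by norm_num)).comp tendsto_natCast_atTop_atTop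

lemma mem_window_of_abs_le {N : ℕ} {t : ℝ} (h : |t| ≤ Real.pi / 2 * (N : ℝ) ^ (2 / 3 : ℝ)) :
    t ∈ window N := by
  rw [mul_comm] at h
  exact abs_le.1 h

lemma eventually_rpow_le {γ w : ℝ} (hγ : γ < 1 / 2) (hw : 0 < w) :
    ∀ᶠ N : ℕ in atTop, (N : ℝ) ^ (-(1 / 2) + γ) ≤ w := by
  have h := (tendsto_rpow_neg_atTop (by linarith : 0 < 1 / 2 - γ)).comp tendsto_natCast_atTop_atTop
  filter_upwards [h.eventually_le_const hw] with N hN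
  rw [show -(1 / 2) + γ = -(1 / 2 - γ) by ring]
  exact hN

lemma nearUpper_singleton {β : ℝ} {N : ℕ} {Ω : Type*} {X : ℝ → Ω → ℝ}
    (hN : 1 ≤ N) (γ t : ℝ) :
    nearUpper β N X γ {t} = {ω | X t ω ∈ {m | |m - branch β (t / ((N : ℝ) ^ (1 / 3 : ℝ)) ^ 2)| ≤
      (N : ℝ) ^ (-(1 / 2) + γ)}} := by
  have hn0 : 0 < (N : ℝ) ^ (1 / 3 : ℝ) := by
    have : (0 : ℝ) < N := by exact_mod_cast hN
    positivity
  ext ω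
  simp only [nearUpper, Set.mem_ofPred_eq, Set.mem_singleton_iff, forall_eq,
    mPlus_hN_eq hn0 (cbrt_pow_three N)]

end CubeRoot

/-! ### Events of the process as masses of its flow. -/

section Events

variable {β m₀ : ℝ} {N : ℕ} {Ω : Type*} [MeasurableSpace Ω] {P : Measure Ω} {X : ℝ → Ω → ℝ}

lemma finite_magnetizations (N : ℕ) : (magnetizations N).Finite :=
  ((Finset.range (N + 1)).finite_toSet.image (grid N)).subset fun m hm => by
    obtain ⟨k, hk, rfl⟩ := mem_magnetizations_iff.1 hm
    exact ⟨k, hk, rfl⟩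

/-- The state space is finite, so an arbitrary `S` can be replaced by a finite set. -/
lemma IsMagnetizationProcess.measurableSet_natural (hX : IsMagnetizationProcess β N m₀ P X) {t : ℝ} (ht : t ∈ window N) (S : Set ℝ) :
    MeasurableSet[⨆ r ∈ window N ∩ Set.Iic t, MeasurableSpace.comap (X r) (borel ℝ)]
      {ω | X t ω ∈ S} := by
  refine le_iSup₂ (f := fun r (_ : r ∈ window N ∩ Set.Iic t) =>
    MeasurableSpace.comap (X r) (borel ℝ)) t ⟨ht, Set.self_mem_Iic⟩ _ ⟨S ∩ magnetizations N, ?_, ?_⟩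
  · rw [← BorelSpace.measurable_eq (α := ℝ)]
    exact ((finite_magnetizations N).inter_of_right S).measurableSet
  · ext ω
    simp [hX.mem t ht ω]

lemma IsMagnetizationProcess.measurableSet_mem (hX : IsMagnetizationProcess β N m₀ P X) {t : ℝ} (ht : t ∈ window N) (S : Set ℝ) : MeasurableSet {ω | X t ω ∈ S} := by
  have h : {ω | X t ω ∈ S} = X t ⁻¹' (S ∩ magnetizations N) := by
    ext ω
    simp [hX.mem t ht ω]
  rw [h]
  exact hX.measurable t ht ((finite_magnetizations N).inter_of_right S).measurableSet

lemma IsMagnetizationProcess.massIn_massOn (hX : IsMagnetizationProcess β N m₀ P X)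
    (hN : 1 ≤ N) {t : ℝ} (ht : t ∈ window N) (A : Set Ω) (S : Set ℝ) :
    massIn N (massOn P X N A) t S = P.real (A ∩ {ω | X t ω ∈ S}) := by
  classical
  have h1 := hX.setIntegral_eq_sum hN (A := A) (S.indicator fun _ => 1) ht
  have h2 : (fun ω => S.indicator (fun _ => (1 : ℝ)) (X t ω)) =
      {ω | X t ω ∈ S}.indicator fun _ => (1 : ℝ) := rfl
  rw [h2, integral_indicator_const _ (hX.measurableSet_mem ht S),
    measureReal_restrict_apply (hX.measurableSet_mem ht S), Set.inter_comm, smul_eq_mul,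
    mul_one] at h1
  rw [h1]
  refine Finset.sum_congr rfl fun k _ => ?_
  by_cases h : grid N k ∈ S <;> simp [h]

/-- At the left end of the window the cosine vanishes, so the branch there is m_+(0); only the
almost sure starting value matters. -/
lemma IsMagnetizationProcess.start_near (hX : IsMagnetizationProcess β N m₀ P X) {w : ℝ} (hN : 1 ≤ N)
    (h : |m₀ - mPlus β 0| ≤ w) :
    P.real (Set.univ ∩ {ω | X (-(Real.pi / 2 * (N : ℝ) ^ (2 / 3 : ℝ))) ω ∈
      {m | w < |m - branch β (-(Real.pi / 2 * (N : ℝ) ^ (2 / 3 : ℝ)) /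
        ((N : ℝ) ^ (1 / 3 : ℝ)) ^ 2)|}}) = 0 := by
  have hn0 : 0 < ((N : ℝ) ^ (1 / 3 : ℝ)) ^ 2 := by
    have : (0 : ℝ) < N := by exact_mod_cast hN
    positivity
  have h1 : branch β (-(Real.pi / 2 * (N : ℝ) ^ (2 / 3 : ℝ)) / ((N : ℝ) ^ (1 / 3 : ℝ)) ^ 2) =
      mPlus β 0 := by
    rw [rpow_two_thirds, neg_div, mul_div_assoc, div_self hn0.ne', mul_one, branch]
    simp
  rw [h1, Set.univ_inter, measureReal_def, ENNReal.toReal_eq_zero_iff]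
  left
  rw [← nonpos_iff_eq_zero, ← (show P {ω | ¬ X (-((N : ℝ) ^ (2 / 3 : ℝ) * (Real.pi / 2))) ω = m₀} = 0
    from hX.start)]
  refine measure_mono fun ω hω => ?_
  simp only [Set.mem_ofPred_eq] at hω ⊢
  intro h2
  rw [mul_comm, h2] at hω
  linarith

end Events

/-! ### Translation to the rescaled process. -/

section Rescaled

variable {β : ℝ}

universe u

/-- Before the critical time the rescaled process deviates little from the rescaled branch. -/
theorem exists_rescaled_deviation_before (hβ : 1 < β) : ∃ c : ℝ, 0 < c ∧ ∀ E : ℝ, 0 < E →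
    ∃ T₀ : ℝ, 0 < T₀ ∧ ∀ T : ℝ, T₀ ≤ T → ∀ ε : ℝ, 0 < ε → ε ≤ E → ∀ η : ℝ, 0 < η →
    η ≤ Real.pi / 2 → ∀ δ' : ℝ, 0 < δ' → ∃ w : ℝ, 0 < w ∧ ∀ᶠ N : ℕ in atTop,
    ∀ (m₀ : ℝ) (Ω : Type u) [MeasurableSpace Ω] (P : Measure Ω) (X : ℝ → Ω → ℝ),
      IsMagnetizationProcess β N m₀ P X → ∀ A : Set Ω,
      MeasurableSet[⨆ r ∈ window N ∩ Set.Iic (-(η * (N : ℝ) ^ (2 / 3 : ℝ))),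
        MeasurableSpace.comap (X r) (borel ℝ)] A →
      P.real (A ∩ {ω | X (-(η * (N : ℝ) ^ (2 / 3 : ℝ))) ω ∈ {m | w < |m - branch β
        (-(η * (N : ℝ) ^ (2 / 3 : ℝ)) / ((N : ℝ) ^ (1 / 3 : ℝ)) ^ 2)|}}) = 0 →
      P.real (A ∩ {ω | ε ≤ |rescaled β N X (-T) ω - T|}) ≤
        P.real A * (Real.exp (-c * ε ^ 2 * T) + δ') := by
  obtain ⟨c, hc, h⟩ := exists_deviation_before hβ
  have hμ := mu_pos hβ
  have hν := nu_pos hβ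
  refine ⟨c * mu β / (4 * nu β ^ 2), by positivity, fun E hE => ?_⟩
  obtain ⟨τ₀, hτ₀⟩ := eventually_atTop.1 (h (E / (2 * nu β)) (by positivity))
  refine ⟨max τ₀ 1 / mu β, by positivity, fun T hT ε hε hεE η hη hηπ δ' hδ' => ?_⟩
  rw [div_le_iff₀ hμ] at hT
  have hτ₁ : τ₀ ≤ mu β * T := by linarith [le_max_left τ₀ 1]
  have hτ1 : 1 ≤ mu β * T := by linarith [le_max_right τ₀ 1]
  have hT0 : 0 < T := (mul_pos_iff_of_pos_left hμ).1 (by linarith)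
  -- Half of ε is left for the error of the rescaled branch, which tends to T; the other half must
  -- come from νv.
  obtain ⟨w, hw, hev⟩ := hτ₀ _ hτ₁ (ε / (2 * nu β)) (by positivity) (by gcongr) η hη hηπ δ' hδ'
  refine ⟨w, hw, ?_⟩
  have hbr := (Metric.tendsto_nhds.1 (tendsto_rescaled_branch hβ (σ := -1) hT0 (by simp)))
    (ε / 2) (by positivity)
  filter_upwards [tendsto_cbrt.eventually hev, tendsto_cbrt.eventually hbr,
    tendsto_cbrt.eventually (eventually_ge_atTop (mu β * T / η)), eventually_ge_atTop 1]
    with N hev hbr hn hN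
  intro m₀ Ω _ P X hX A hA hstart
  rw [rpow_two_thirds] at hA hstart
  have hn0 : 0 < (N : ℝ) ^ (1 / 3 : ℝ) := by
    have : (0 : ℝ) < N := by exact_mod_cast hN
    positivity
  have hwin : ∀ t, -(η * ((N : ℝ) ^ (1 / 3 : ℝ)) ^ 2) ≤ t → t ≤ 0 → t ∈ window N := by
    intro t h1 h2
    refine mem_window_of_abs_le ?_
    rw [abs_of_nonpos h2, rpow_two_thirds]
    have := mul_le_mul_of_nonneg_right hηπ (sq_nonneg ((N : ℝ) ^ (1 / 3 : ℝ)))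
    linarith
  set n := (N : ℝ) ^ (1 / 3 : ℝ) with hn_def
  have hse : -(η * n ^ 2) ≤ -(mu β * T * n) := by
    rw [div_le_iff₀ hη] at hn; linarith [mul_le_mul_of_nonneg_right hn hn0.le]
  have he0 : -(mu β * T * n) ≤ 0 := by simp only [Left.neg_nonpos_iff]; positivity
  have hsw := hwin _ le_rfl (hse.trans he0)
  have hew := hwin _ hse he0
  have key := hev N (cbrt_pow_three N) _ _ measureReal_nonneg (hX.isFlow hN hsw hew hse hA) (by
    rw [hX.massIn_massOn hN hsw]; exact hstart)
  rw [hX.massIn_massOn hN hew] at key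
  have := hX.isProbabilityMeasure
  have hc' : -c * (ε / (2 * nu β)) ^ 2 * (mu β * T) = -(c * mu β / (4 * nu β ^ 2)) * ε ^ 2 * T := by
    field_simp; norm_num
  rw [hc'] at key
  refine (measureReal_mono (Set.inter_subset_inter_right A fun ω hω => ?_)).trans key
  simp only [Set.mem_ofPred_eq, rescaled, ← hn_def] at hω ⊢
  rw [show mu β * n * -T = -(mu β * T * n) by ring] at hω
  rw [Real.dist_eq, neg_one_mul] at hbr
  set x := X (-(mu β * T * n)) ω
  set M := branch β (-(mu β * T * n) / n ^ 2)
  have h1 : nu β * n * (x - mc β) - T = nu β * (n * (x - M)) + (nu β * n * (M - mc β) - T) := by ring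
  have h2 := abs_add_le (nu β * (n * (x - M))) (nu β * n * (M - mc β) - T)
  rw [← h1, abs_mul, abs_of_pos hν] at h2
  rw [div_le_iff₀ (by positivity)]
  linarith

/-- A rescaled process that is close to the rescaled branch after the critical time converges to
the branch. -/
theorem exists_convergence_of_rescaled_near (hβ : 1 < β) : ∃ c : ℝ, 0 < c ∧ ∀ E : ℝ, 0 < E →
    ∃ T₀ : ℝ, 0 < T₀ ∧ ∀ T : ℝ, T₀ ≤ T → ∀ ε : ℝ, 0 < ε → ε ≤ E → ∀ η : ℝ, 0 < η →
    η ≤ Real.pi / 2 → ∀ γ : ℝ, 0 < γ → ∀ δ' : ℝ, 0 < δ' → ∀ᶠ N : ℕ in atTop,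
    ∀ (m₀ : ℝ) (Ω : Type u) [MeasurableSpace Ω] (P : Measure Ω) (X : ℝ → Ω → ℝ),
      IsMagnetizationProcess β N m₀ P X → MeasurableSet {ω | |rescaled β N X T ω - T| ≤ ε} ∧
      P.real ({ω | |rescaled β N X T ω - T| ≤ ε} ∩
          (nearUpper β N X γ {η * (N : ℝ) ^ (2 / 3 : ℝ)})ᶜ) ≤
        P.real {ω | |rescaled β N X T ω - T| ≤ ε} * (Real.exp (-c * ε ^ 2 * T) + δ') := by
  obtain ⟨c, hc, h⟩ := exists_convergence_after hβ
  have hμ := mu_pos hβ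
  have hν := nu_pos hβ
  refine ⟨c * (2 / nu β) ^ 2 * mu β, by positivity, fun E hE => ?_⟩
  -- The deviation ε ≤ E and a branch error below E put |v| below 2E/ν. Working with E instead of ε
  -- only improves the exponential bound.
  obtain ⟨τ₀, hτ₀⟩ := eventually_atTop.1 (h (2 / nu β * E) (by positivity))
  refine ⟨max τ₀ 1 / mu β, by positivity, fun T hT ε hε hεE η hη hηπ γ hγ δ' hδ' => ?_⟩
  rw [div_le_iff₀ hμ] at hT
  have hτ₁ : τ₀ ≤ mu β * T := by linarith [le_max_left τ₀ 1]
  have hτ1 : 1 ≤ mu β * T := by linarith [le_max_right τ₀ 1]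
  have hT0 : 0 < T := (mul_pos_iff_of_pos_left hμ).1 (by linarith)
  have hev := hτ₀ _ hτ₁ η hη hηπ γ hγ δ' hδ'
  have hbr := (Metric.tendsto_nhds.1 (tendsto_rescaled_branch hβ (σ := 1) hT0 (by simp))) E hE
  filter_upwards [tendsto_cbrt.eventually hev, tendsto_cbrt.eventually hbr,
    tendsto_cbrt.eventually (eventually_ge_atTop (mu β * T / η)), eventually_ge_atTop 1]
    with N hev hbr hn hN
  intro m₀ Ω _ P X hX
  rw [nearUpper_singleton hN, rpow_two_thirds]
  have hn0 : 0 < (N : ℝ) ^ (1 / 3 : ℝ) := by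
    have : (0 : ℝ) < N := by exact_mod_cast hN
    positivity
  have hwin : ∀ t, 0 ≤ t → t ≤ η * ((N : ℝ) ^ (1 / 3 : ℝ)) ^ 2 → t ∈ window N := by
    intro t h1 h2
    refine mem_window_of_abs_le ?_
    rw [abs_of_nonneg h1, rpow_two_thirds]
    have := mul_le_mul_of_nonneg_right hηπ (sq_nonneg ((N : ℝ) ^ (1 / 3 : ℝ)))
    linarith
  set n := (N : ℝ) ^ (1 / 3 : ℝ) with hn_def
  have hse : mu β * T * n ≤ η * n ^ 2 := by
    rw [div_le_iff₀ hη] at hn; linarith [mul_le_mul_of_nonneg_right hn hn0.le]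
  have hs0 : 0 ≤ mu β * T * n := by positivity
  have hsw := hwin _ hs0 hse
  have hew := hwin _ (hs0.trans hse) le_rfl
  set A := {ω | |rescaled β N X T ω - T| ≤ ε} with hA
  have hA' : A = {ω | X (mu β * T * n) ω ∈ {m | |nu β * n * (m - mc β) - T| ≤ ε}} := by
    ext ω
    simp only [hA, rescaled, Set.mem_ofPred_eq, ← hn_def]
    rw [show mu β * n * T = mu β * T * n by ring]
  have hAm : MeasurableSet[⨆ r ∈ window N ∩ Set.Iic (mu β * T * n),
      MeasurableSpace.comap (X r) (borel ℝ)] A := hA' ▸ hX.measurableSet_natural hsw _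
  refine ⟨hA' ▸ hX.measurableSet_mem hsw _, ?_⟩
  have key := hev N (cbrt_pow_three N) _ _ measureReal_nonneg (hX.isFlow hN hsw hew hse hAm) (by
    rw [hX.massIn_massOn hN hsw]
    convert measureReal_empty
    refine Set.eq_empty_of_forall_notMem fun ω hω => ?_
    rw [hA'] at hω
    obtain ⟨h3, h4⟩ := hω
    simp only [Set.mem_ofPred_eq] at h3 h4
    rw [Real.dist_eq, one_mul] at hbr
    set x := X (mu β * T * n) ω
    set M := branch β (mu β * T * n / n ^ 2)
    have h1 : nu β * (n * (x - M)) = (nu β * n * (x - mc β) - T) - (nu β * n * (M - mc β) - T) := by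
      ring
    have h2 := abs_sub (nu β * n * (x - mc β) - T) (nu β * n * (M - mc β) - T)
    rw [← h1, abs_mul, abs_of_pos hν] at h2
    rw [div_mul_eq_mul_div, div_lt_iff₀ hν] at h4
    linarith)
  rw [hX.massIn_massOn hN hew] at key
  have := hX.isProbabilityMeasure
  refine (measureReal_mono (Set.inter_subset_inter_right A fun ω hω => ?_)).trans (key.trans ?_)
  · simpa using hω
  · have h1 : ε ^ 2 ≤ E ^ 2 := by gcongr
    refine mul_le_mul_of_nonneg_left (add_le_add_left (Real.exp_le_exp.2 ?_) _) measureReal_nonneg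
    have : c * (2 / nu β) ^ 2 * mu β * T * ε ^ 2 ≤ c * (2 / nu β) ^ 2 * mu β * T * E ^ 2 := by gcongr
    rw [mul_pow]
    linarith

/-- A process that starts near the upper branch stays near it away from the critical time. -/
theorem exists_nearUpper_before (hβ : 1 < β) {η : ℝ} (hη : 0 < η) (hηπ : η ≤ Real.pi / 2) {δ' : ℝ}
    (hδ' : 0 < δ') {γ : ℝ} (hγ : 1 / 2 ≤ γ) : ∃ w : ℝ, 0 < w ∧ ∀ᶠ N : ℕ in atTop,
    ∀ (m₀ : ℝ) (Ω : Type u) [MeasurableSpace Ω] (P : Measure Ω) (X : ℝ → Ω → ℝ),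
      IsMagnetizationProcess β N m₀ P X → |m₀ - mPlus β 0| ≤ w →
      1 - δ' ≤ P.real (nearUpper β N X γ {-(η * (N : ℝ) ^ (2 / 3 : ℝ))}) := by
  obtain ⟨w, hw, hev⟩ := exists_near_before hβ hη hηπ hδ'
  refine ⟨w, hw, ?_⟩
  filter_upwards [tendsto_cbrt.eventually hev, eventually_ge_atTop 1] with N hev hN
  intro m₀ Ω _ P X hX hm₀
  have := hX.isProbabilityMeasure
  have hstart := hX.start_near hN hm₀
  rw [nearUpper_singleton hN]
  have hη0 : 0 ≤ η * (N : ℝ) ^ (2 / 3 : ℝ) := by positivity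
  have hηπ' : η * (N : ℝ) ^ (2 / 3 : ℝ) ≤ Real.pi / 2 * (N : ℝ) ^ (2 / 3 : ℝ) := by gcongr
  have hsw : -(Real.pi / 2 * (N : ℝ) ^ (2 / 3 : ℝ)) ∈ window N :=
    mem_window_of_abs_le (by rw [abs_neg, abs_of_nonneg (hη0.trans hηπ')])
  have hew : -(η * (N : ℝ) ^ (2 / 3 : ℝ)) ∈ window N :=
    mem_window_of_abs_le (by rwa [abs_neg, abs_of_nonneg hη0])
  have hse := neg_le_neg hηπ'
  have hflow := hX.isFlow hN hsw hew hse (A := Set.univ) MeasurableSet.univ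
  have hms := hX.measurableSet_mem hew {m | |m - branch β (-(η * (N : ℝ) ^ (2 / 3 : ℝ)) /
    ((N : ℝ) ^ (1 / 3 : ℝ)) ^ 2)| ≤ (N : ℝ) ^ (-(1 / 2) + γ)}
  rw [← hX.massIn_massOn hN hsw] at hstart
  rw [rpow_two_thirds] at hstart hflow hew hms ⊢
  have key := hev N (cbrt_pow_three N) _ _ measureReal_nonneg hflow hstart
  rw [hX.massIn_massOn hN hew, Set.univ_inter, probReal_univ, one_mul] at key
  -- For γ ≥ 1/2 the tolerance is at least 1, so staying within distance 1 is enough.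
  have h2 : 1 ≤ (N : ℝ) ^ (-(1 / 2) + γ) :=
    Real.one_le_rpow (by exact_mod_cast hN) (by linarith)
  refine sub_le_comm.1 (((probReal_compl_eq_one_sub hms).symm.le.trans
    (measureReal_mono fun ω hω => ?_)).trans key)
  simp only [Set.mem_compl_iff, Set.mem_ofPred_eq, not_le] at hω ⊢
  exact h2.trans_lt hω

lemma StartsNearUpper.eventually {m₀ : ℕ → ℝ} (h : StartsNearUpper β m₀) {w : ℝ} (hw : 0 < w) :
    ∀ᶠ N : ℕ in atTop, |m₀ N - mPlus β 0| ≤ w := by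
  obtain ⟨γ, -, hγ, h⟩ := h
  filter_upwards [h, eventually_rpow_le hγ hw] with N h1 h2 using h1.trans h2

end Rescaled

/-! ### Limits superior of real sequences and conditional probabilities. -/

section Limsup

/-- Nonnegativity ensures that the real-valued limsup is a genuine infimum and not a default value;
in `le_limsup_of_forall_pos` the eventual bound by 1 has this role. -/
lemma limsup_le_of_forall_pos {u : ℕ → ℝ} {b : ℝ} (hu : ∀ N, 0 ≤ u N)
    (h : ∀ δ : ℝ, 0 < δ → ∀ᶠ N in atTop, u N ≤ b + δ) : limsup u atTop ≤ b :=
  le_of_forall_pos_le_add fun δ hδ =>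
    limsup_le_of_le (isCoboundedUnder_le_of_le atTop hu) (h δ hδ)

lemma le_limsup_of_forall_pos {u : ℕ → ℝ} {b : ℝ} (hu : ∀ᶠ N in atTop, u N ≤ 1)
    (h : ∀ δ : ℝ, 0 < δ → ∀ᶠ N in atTop, b ≤ u N + δ) : b ≤ limsup u atTop :=
  le_of_forall_pos_le_add fun δ hδ => sub_le_iff_le_add.1
    (le_limsup_of_frequently_le ((h δ hδ).mono fun _ hN => sub_le_iff_le_add.2 hN).frequently
      (isBoundedUnder_of_eventually_le hu))

/-- For a null event the conditional measure is zero, and `hb` covers this case. -/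
lemma cond_real_le {Ω : Type*} [MeasurableSpace Ω] {P : Measure Ω} {A S : Set Ω} {b : ℝ}
    (hA : MeasurableSet A) (hb : 0 ≤ b) (h : P.real (A ∩ S) ≤ P.real A * b) :
    (cond P A).real S ≤ b := by
  have h1 : (cond P A).real S = (P.real A)⁻¹ * P.real (A ∩ S) := by
    simp only [measureReal_def, cond_apply hA, ENNReal.toReal_mul, ENNReal.toReal_inv]
  rw [h1]
  exact inv_mul_le_of_le_mul₀ measureReal_nonneg hb h

end Limsup
end CurieWeiss

/-! ### Assembly of the theorem. -/

open CurieWeiss in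
theorem theorem3p1 (β : ℝ) (hβ : 1 < β) :
    ∃ c : ℝ, 0 < c ∧
      (∃ T₀ : ℝ, 0 < T₀ ∧ ∃ ε₀ : ℝ, 0 < ε₀ ∧
        ∀ T : ℝ, T₀ ≤ T → ∀ ε : ℝ, 0 < ε → ε ≤ ε₀ →
        ∀ (m₀ : ℕ → ℝ) (Ω : ℕ → Type*) [∀ N, MeasurableSpace (Ω N)]
          (P : ∀ N, Measure (Ω N)) (X : ∀ N, ℝ → Ω N → ℝ),
          (∀ N : ℕ, 1 ≤ N → CurieWeiss.IsMagnetizationProcess β N (m₀ N) (P N) (X N)) →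
          CurieWeiss.StartsNearUpper β m₀ →
          1 - Real.exp (-c * ε ^ 2 * T) ≤
            limsup (fun N : ℕ =>
              (P N).real {ω | |CurieWeiss.rescaled β N (X N) (-T) ω - T| ≤ ε}) atTop) ∧
      (∀ E : ℝ, 0 < E → ∃ T₀ : ℝ, 0 < T₀ ∧
        ∀ T : ℝ, T₀ ≤ T → ∀ γ η ε : ℝ, 0 < γ → 0 < η → η ≤ Real.pi / 2 → 0 < ε → ε ≤ E →
        ∀ (m₀ : ℕ → ℝ) (Ω : ℕ → Type*) [∀ N, MeasurableSpace (Ω N)]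
          (P : ∀ N, Measure (Ω N)) (X : ∀ N, ℝ → Ω N → ℝ),
          (∀ N : ℕ, 1 ≤ N → CurieWeiss.IsMagnetizationProcess β N (m₀ N) (P N) (X N)) →
          (γ < 1 / 2 ∨ CurieWeiss.StartsNearUpper β m₀ →
            limsup (fun N : ℕ =>
              (cond (P N) (CurieWeiss.nearUpper β N (X N) γ {-(η * (N : ℝ) ^ (2 / 3 : ℝ))})).real
                {ω | ε ≤ |CurieWeiss.rescaled β N (X N) (-T) ω - T|}) atTop
              ≤ Real.exp (-c * ε ^ 2 * T)) ∧
          limsup (fun N : ℕ =>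
              (cond (P N) {ω | |CurieWeiss.rescaled β N (X N) T ω - T| ≤ ε}).real
                (CurieWeiss.nearUpper β N (X N) γ {η * (N : ℝ) ^ (2 / 3 : ℝ)})ᶜ) atTop
              ≤ Real.exp (-c * ε ^ 2 * T)) := by
  obtain ⟨c₁, hc₁, h₁⟩ := exists_rescaled_deviation_before hβ
  -- A second copy, because the probability spaces in (i) and (ii) range over different universes;
  -- the constant is the minimum over all copies.
  obtain ⟨c₁', hc₁', h₁'⟩ := exists_rescaled_deviation_before hβ
  obtain ⟨c₂, hc₂, h₂⟩ := exists_convergence_of_rescaled_near hβ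
  have hexp : ∀ {c ε T : ℝ}, min (min c₁ c₁') c₂ ≤ c → 0 < T →
      Real.exp (-c * ε ^ 2 * T) ≤ Real.exp (-min (min c₁ c₁') c₂ * ε ^ 2 * T) := fun hc hT => by
    refine Real.exp_le_exp.2 ?_
    rw [mul_assoc, mul_assoc, neg_mul, neg_mul, neg_le_neg_iff]
    gcongr
  refine ⟨min (min c₁ c₁') c₂, by positivity, ?_, fun E hE => ?_⟩
  · obtain ⟨T₀, hT₀, h⟩ := h₁ 1 one_pos
    refine ⟨T₀, hT₀, 1, one_pos, fun T hT ε hε hε1 m₀ Ω _ P X hX hstart => ?_⟩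
    refine le_limsup_of_forall_pos ?_ fun δ hδ => ?_
    · filter_upwards [eventually_ge_atTop 1] with N hN
      have := (hX N hN).isProbabilityMeasure
      exact measureReal_le_one
    obtain ⟨w, hw, hev⟩ := h T hT ε hε hε1 (Real.pi / 2) Real.pi_div_two_pos le_rfl δ hδ
    filter_upwards [hev, hstart.eventually hw, eventually_ge_atTop 1] with N hev hw hN
    have := (hX N hN).isProbabilityMeasure
    have key := hev (m₀ N) (Ω N) (P N) (X N) (hX N hN) Set.univ MeasurableSet.univ
      ((hX N hN).start_near hN hw)
    rw [Set.univ_inter, probReal_univ, one_mul] at key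
    have hcover := measureReal_union_le (μ := P N)
      {ω | |rescaled β N (X N) (-T) ω - T| ≤ ε} {ω | ε ≤ |rescaled β N (X N) (-T) ω - T|}
    rw [show {ω | |rescaled β N (X N) (-T) ω - T| ≤ ε} ∪
      {ω | ε ≤ |rescaled β N (X N) (-T) ω - T|} = Set.univ from
        Set.eq_univ_of_forall fun ω => (le_total _ _ :
          |rescaled β N (X N) (-T) ω - T| ≤ ε ∨ ε ≤ |rescaled β N (X N) (-T) ω - T|), probReal_univ] at hcover
    have := hexp (c := c₁) (ε := ε) ((min_le_left _ _).trans (min_le_left _ _)) (hT₀.trans_le hT)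
    linarith
  · obtain ⟨T₁, hT₁, h⟩ := h₁' E hE
    obtain ⟨T₂, hT₂, h'⟩ := h₂ E hE
    refine ⟨max T₁ T₂, by positivity, fun T hT γ η ε hγ hη hηπ hε hεE m₀ Ω _ P X hX => ?_⟩
    have hTT₁ : T₁ ≤ T := (le_max_left _ _).trans hT
    have hTT₂ : T₂ ≤ T := (le_max_right _ _).trans hT
    have he₁ := hexp (c := c₁') (ε := ε) ((min_le_left _ _).trans (min_le_right _ _))
      (hT₁.trans_le hTT₁)
    have he₂ := hexp (c := c₂) (ε := ε) (min_le_right _ _) (hT₁.trans_le hTT₁)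
    have hwin : ∀ N, -(η * (N : ℝ) ^ (2 / 3 : ℝ)) ∈ window N := fun N =>
      mem_window_of_abs_le (by rw [abs_neg, abs_of_nonneg (by positivity)]; gcongr)
    refine ⟨fun hcase => limsup_le_of_forall_pos (fun _ => measureReal_nonneg) fun δ hδ => ?_,
      limsup_le_of_forall_pos (fun _ => measureReal_nonneg) fun δ hδ => ?_⟩
    -- For γ < 1/2 the conditioning event itself forces the process near the branch at time
    -- -ηN^{2/3}, and the flow starts there. For γ ≥ 1/2 it carries no such information; the flow
    -- starts at the left end of the window, and the event has probability at least 1 - δ'.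
    · rcases lt_or_ge γ (1 / 2) with hγ2 | hγ2
      · obtain ⟨w, hw, hev⟩ := h T hTT₁ ε hε hεE η hη hηπ δ hδ
        filter_upwards [hev, eventually_rpow_le hγ2 hw, eventually_ge_atTop 1] with N hev hw hN
        rw [nearUpper_singleton hN]
        refine cond_real_le ((hX N hN).measurableSet_mem (hwin N) _) (by positivity) ?_
        refine (hev (m₀ N) (Ω N) (P N) (X N) (hX N hN) _
          ((hX N hN).measurableSet_natural (hwin N) _) ?_).trans ?_
        · convert measureReal_empty
          refine Set.eq_empty_of_forall_notMem fun ω hω => ?_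
          exact absurd (hω.1.trans hw) (not_le.2 hω.2)
        · gcongr
      · have hstart := hcase.resolve_left (not_lt.2 hγ2)
        -- With this choice b + δ' ≤ (1 - δ')(b + δ) for every b ≤ 1, which removes the
        -- conditioning.
        set δ' := min (δ / 4) (1 / 2) with hδ'
        have hδ'0 : 0 < δ' := by positivity
        obtain ⟨w, hw, hev⟩ := h T hTT₁ ε hε hεE (Real.pi / 2) Real.pi_div_two_pos le_rfl δ' hδ'0
        obtain ⟨w', hw', hev'⟩ := exists_nearUpper_before hβ hη hηπ hδ'0 hγ2
        filter_upwards [hev, hev', hstart.eventually hw, hstart.eventually hw',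
          eventually_ge_atTop 1] with N hev hev' hw hw' hN
        have := (hX N hN).isProbabilityMeasure
        have h3 := hev' (m₀ N) (Ω N) (P N) (X N) (hX N hN) hw'
        have h4 := hev (m₀ N) (Ω N) (P N) (X N) (hX N hN) Set.univ MeasurableSet.univ
          ((hX N hN).start_near hN hw)
        rw [probReal_univ, one_mul] at h4
        rw [nearUpper_singleton hN] at h3 ⊢
        refine cond_real_le ((hX N hN).measurableSet_mem (hwin N) _) (by positivity) ?_
        refine (measureReal_mono (Set.inter_subset_inter_left _ (Set.subset_univ _))).trans
          (h4.trans (le_trans ?_ (mul_le_mul_of_nonneg_right h3 (by positivity))))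
        set b := Real.exp (-min (min c₁ c₁') c₂ * ε ^ 2 * T)
        have hb : b ≤ 1 := by
          refine Real.exp_le_one_iff.2 ?_
          have : 0 ≤ min (min c₁ c₁') c₂ * ε ^ 2 * T :=
            mul_nonneg (by positivity) (hT₁.trans_le hTT₁).le
          linarith
        have h5 : δ' ≤ δ / 4 := min_le_left _ _
        have h6 : δ' ≤ 1 / 2 := min_le_right _ _
        nlinarith [mul_le_mul_of_nonneg_left hb hδ'0.le, mul_le_mul_of_nonneg_right h6 hδ.le]
    · filter_upwards [h' T hTT₂ ε hε hεE η hη hηπ γ hγ δ hδ, eventually_ge_atTop 1] with N hev hN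
      obtain ⟨h3, h4⟩ := hev (m₀ N) (Ω N) (P N) (X N) (hX N hN)
      refine cond_real_le h3 (by positivity) (h4.trans ?_)
      gcongr
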